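/- Let $N\ge 1$ and $0\le m\le N$ be integers, $0<\gamma<N$, $0<\alpha<\frac{2}{\gamma+m}$ and $a\in\{1,-1\}$. Let $\Omega=\{x\in\mathbb R^N:\ x_1>0,\dots,x_m>0\}$ (so $\Omega=\mathbb R^N$ if $m=0$), and let $C_0(\Omega)$ be the space of continuous functions on $\overline\Omega$ that vanish on $\partial\Omega$ and tend to $0$ as $|x|\to\infty$, with the sup norm. For $t>0$ let $e^{t\Delta_\Omega}f(x)=\int_\Omega K_t(x,y)f(y)\,dy$, where $$K_t(x,y)=(4\pi t)^{-N/2}\prod_{j=m+1}^N e^{-\frac{|x_j-y_j|^2}{4t}}\prod_{i=1}^m\Big[e^{-\frac{|x_i-y_i|^2}{4t}}-e^{-\frac{|x_i+y_i|^2}{4t}}\Big].$$ Put $\psi_0(x)=c_{m,\gamma}\,x_1\cdots x_m|x|^{-\gamma-2m}$ with $c_{m,\gamma}=\gamma(\gamma+2)\cdots(\gamma+2m-2)$ ($c_{0,\gamma}=1$), and $\Psi(t)=e^{t\Delta_\Omega}\psi_0$. Let $\mathcal X=\{\psi\in L^1_{loc}(\Omega):\psi/\psi_0\in L^\infty(\Omega)\}$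 with $\|\psi\|_{\mathcal X}=\|\psi/\psi_0\|_{L^\infty(\Omega)}$, and $\mathcal B_R=\{\psi\in\mathcal X:\|\psi\|_{\mathcal X}\le R\}$. Let $\mathcal B_R^*$ be $\mathcal B_R$ with the weak-$*$ topology of $\mathcal X=\mathcal Y'$, where $\mathcal Y=\{\varphi\in L^1_{loc}(\Omega):\varphi\psi_0\in L^1(\Omega)\}$ and the pairing is $\int_\Omega\psi\varphi\,dx$. For $T>0$ let $X_T$ be the set of $u\in C((0,T];C_0(\Omega))$ such that $|u(t,x)|\le M'\,\Psi(t,x)$ on $(0,T]\times\Omega$ for some $M'>0$, with norm $|||u|||_{X_T}=\sup_{0<t\le T,\,x\in\Omega}|u(t,x)|/\Psi(t,x)$. Let $K,M,T>0$ satisfy $$K+2(\alpha+1)M^{\alpha+1}\int_0^T\|\Psi(\sigma)\|_{L^\infty(\Omega)}^\alpha d\sigma\le M,\qquad q:=2(\alpha+1)M^{\alpha}\int_0^T\|\Psi(\sigma)\|_{L^\infty(\Omega)}^\alpha d\sigma<1.$$ Then for every $\psi\in\mathcal B_K$ there is a unique $u\in X_T$ with $|||u|||_{X_T}\le M$ such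 that, for all $t\in(0,T]$, $$u(t)=e^{t\Delta_\Omega}\psi+a\int_0^t e^{(t-\sigma)\Delta_\Omega}\big(|u(\sigma)|^\alpha u(\sigma)\big)\,d\sigma ,\qquad (1)$$ and the integral in (1) is absolutely convergent in $C_0(\Omega)$. Below, "the solution" of (1) always means this one. Moreover: (i) There is a constant $\mathcal C\ge1$ with $\|e^{t\Delta_\Omega}\varphi\|_{\mathcal X}\le\mathcal C\|\varphi\|_{\mathcal X}$ for all $t>0$ and $\varphi\in\mathcal X$. As $t\to0$, $u(t)\to\psi$ in $L^1_{loc}(\Omega)$, in $\mathcal D'(\Omega)$ and, for every such $\mathcal C$, in $\mathcal B_{\mathcal CM}^*$ (in particular $\psi\in\mathcal B_{\mathcal CM}$ and $u(t)\in\mathcal B_{\mathcal CM}$ for all $t\in(0,T]$). (ii) If $u_1,u_2$ are the solutions of (1) with initial values $\psi_1,\psi_2\in\mathcal B_K$, then, with $C=(1-q)^{-1}$, $$|||u_1-u_2|||_{X_T}\le C\,|||e^{t\Delta_\Omega}(\psi_1-\psi_2)|||_{X_T}\le C\,\|\psi_1-\psi_2\|_{\mathcal X}.$$ (iii) Let $\psi_k$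 ($k\ge 1$) and $\psi$ be in $\mathcal B_K$, with solutions $u_k$ and $u$. Then $\psi_k\to\psi$ in $\mathcal D'(\Omega)$ if and only if $\psi_k\to\psi$ in $\mathcal B_K^*$, and in that case $u_k(t)\to u(t)$ in $C_0(\Omega)$ for every $t\in(0,T]$, uniformly for $t\in[t_0,T]$ for every $t_0\in(0,T)$. (iv) If $\psi\in\mathcal B_K$, $u$ is the solution with initial value $\psi$ and $v$ is the solution with initial value $|\psi|$, then $|u(t)|\le v(t)$ on $\Omega$ for all $t\in(0,T]$. (v) If $\psi\in\mathcal B_K$ and $\psi\ge0$ a.e. on $\Omega$, then $u(t)\ge0$ on $\Omega$ for all $t\in(0,T]$. (vi) If $\psi_1,\psi_2\in\mathcal B_K$ and $\psi_1\le\psi_2$ a.e. on $\Omega$, then the corresponding solutions satisfy $u_1(t)\le u_2(t)$ on $\Omega$ for all $t\in(0,T]$. -/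

import Mathlib

open MeasureTheory Filter Topology Set TopologicalSpace
open scoped ENNReal ZeroAtInfty Distributions

namespace SectorHeat

noncomputable section

/-- The open sector `Ω = {x ∈ ℝ^N : x_1 > 0, …, x_m > 0}` (coordinates are numbered from `0`).
For `m = 0` it is all of `ℝ^N`. -/
def sector (N m : ℕ) : Opens (EuclideanSpace ℝ (Fin N)) where
  carrier := {x | ∀ i : Fin N, (i : ℕ) < m → 0 < x i}
  is_open' := by
    have h : {x : EuclideanSpace ℝ (Fin N) | ∀ i : Fin N, (i : ℕ) < m → 0 < x i}
        = ⋂ i : Fin N, ⋂ _ : (i : ℕ) < m, {x | 0 < x i} := by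
      ext x; simp
    rw [h]
    exact isOpen_iInter_of_finite fun i => isOpen_iInter_of_finite fun _ =>
      isOpen_lt continuous_const (by fun_prop)

/-- Lebesgue measure on `Ω`. -/
def leb (N m : ℕ) : Measure (sector N m) := Measure.comap Subtype.val volume

/-- The Dirichlet heat kernel `K_t(x, y)` of the sector. -/
def kernel (N m : ℕ) (t : ℝ) (x y : sector N m) : ℝ :=
  (4 * Real.pi * t) ^ (-(N : ℝ) / 2)
    * (∏ j ∈ Finset.univ.filter (fun k : Fin N => m ≤ k.val), Real.exp (-|x.1 j - y.1 j| ^ 2 / (4 * t)))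
    * ∏ i ∈ Finset.univ.filter (fun k : Fin N => k.val < m),
        (Real.exp (-|x.1 i - y.1 i| ^ 2 / (4 * t)) - Real.exp (-|x.1 i + y.1 i| ^ 2 / (4 * t)))

/-- The heat semigroup `e^{tΔ_Ω} f (x) = ∫_Ω K_t(x, y) f(y) dy`, for `t > 0`. -/
def heat (N m : ℕ) (t : ℝ) (f : sector N m → ℝ) (x : sector N m) : ℝ :=
  ∫ y, kernel N m t x y * f y ∂(leb N m)

/-- `ψ₀(x) = c_{m,γ} x_1 ⋯ x_m |x|^{-γ-2m}` with `c_{m,γ} = γ (γ + 2) ⋯ (γ + 2m - 2)`. -/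
def psi0 (N m : ℕ) (γ : ℝ) (x : sector N m) : ℝ :=
  (∏ k ∈ Finset.range m, (γ + 2 * (k : ℝ)))
    * (∏ i ∈ Finset.univ.filter (fun k : Fin N => k.val < m), x.1 i) * ‖x.1‖ ^ (-γ - 2 * (m : ℝ))

/-- `Ψ(t) = e^{tΔ_Ω} ψ₀`. -/
def Psi (N m : ℕ) (γ t : ℝ) : sector N m → ℝ := heat N m t (psi0 N m γ)

/-- The norm `‖ψ‖_𝒳 = ‖ψ / ψ₀‖_{L^∞(Ω)}`, as an extended nonnegative number. -/
def normX (N m : ℕ) (γ : ℝ) (ψ : sector N m → ℝ) : ℝ≥0∞ :=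
  eLpNorm (fun x => ψ x / psi0 N m γ x) ∞ (leb N m)

/-- `ψ ∈ 𝒳`: `ψ ∈ L¹_loc(Ω)` and `ψ / ψ₀ ∈ L^∞(Ω)`. -/
def MemX (N m : ℕ) (γ : ℝ) (ψ : sector N m → ℝ) : Prop :=
  LocallyIntegrable ψ (leb N m) ∧ MemLp (fun x => ψ x / psi0 N m γ x) ∞ (leb N m)

/-- `ψ` belongs to the closed ball `𝓑_K` of `𝒳`. -/
def MemBall (N m : ℕ) (γ K : ℝ) (ψ : sector N m → ℝ) : Prop :=
  MemX N m γ ψ ∧ normX N m γ ψ ≤ ENNReal.ofReal K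

/-- `φ ∈ 𝒴`, the predual of `𝒳`: `φ ∈ L¹_loc(Ω)` and `φ ψ₀ ∈ L¹(Ω)`. -/
def MemY (N m : ℕ) (γ : ℝ) (φ : sector N m → ℝ) : Prop :=
  LocallyIntegrable φ (leb N m) ∧ Integrable (fun x => φ x * psi0 N m γ x) (leb N m)

/-- Weak-* convergence in `𝒳 = 𝒴'`. -/
def TendstoWeakStar (N m : ℕ) (γ : ℝ) {ι : Type*} (l : Filter ι)
    (f : ι → sector N m → ℝ) (g : sector N m → ℝ) : Prop :=
  ∀ φ : sector N m → ℝ, MemY N m γ φ →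
    Tendsto (fun i => ∫ x, f i x * φ x ∂(leb N m)) l (𝓝 (∫ x, g x * φ x ∂(leb N m)))

/-- Convergence in `𝓓'(Ω)` of locally integrable functions. -/
def TendstoDistr (N m : ℕ) {ι : Type*} (l : Filter ι)
    (f : ι → sector N m → ℝ) (g : sector N m → ℝ) : Prop :=
  ∀ φ : 𝓓(sector N m, ℝ),
    Tendsto (fun i => ∫ x, f i x * φ x ∂(leb N m)) l (𝓝 (∫ x, g x * φ x ∂(leb N m)))

/-- Convergence in `L¹_loc(Ω)`. -/
def TendstoL1loc (N m : ℕ) {ι : Type*} (l : Filter ι)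
    (f : ι → sector N m → ℝ) (g : sector N m → ℝ) : Prop :=
  ∀ S : Set (sector N m), IsCompact S →
    Tendsto (fun i => ∫⁻ x in S, ‖f i x - g x‖ₑ ∂(leb N m)) l (𝓝 0)

/-- `C` is a constant for which `‖e^{tΔ_Ω} ψ‖_𝒳 ≤ C ‖ψ‖_𝒳` for all `t > 0` and `ψ ∈ 𝒳`. -/
def IsSemigroupBound (N m : ℕ) (γ C : ℝ) : Prop :=
  1 ≤ C ∧ ∀ t : ℝ, 0 < t → ∀ ψ : sector N m → ℝ, MemX N m γ ψ →
    MemX N m γ (heat N m t ψ) ∧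
      normX N m γ (heat N m t ψ) ≤ ENNReal.ofReal C * normX N m γ ψ

/-- `∫_0^T ‖Ψ(σ)‖_{L^∞(Ω)}^α dσ`. -/
def psiIntegral (N m : ℕ) (γ α T : ℝ) : ℝ≥0∞ :=
  ∫⁻ σ in Ioc 0 T, (eLpNorm (Psi N m γ σ) ∞ (leb N m)) ^ α

/-- `2 (α + 1) M^α ∫_0^T ‖Ψ(σ)‖_{L^∞(Ω)}^α dσ`. -/
def contractionFactor (N m : ℕ) (γ α M T : ℝ) : ℝ≥0∞ :=
  ENNReal.ofReal (2 * (α + 1) * M ^ α) * psiIntegral N m γ α T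

/-- The norm `|||u|||_{X_T} = sup_{0 < t ≤ T, x ∈ Ω} |u(t, x)| / Ψ(t, x)`, as an extended
nonnegative number. -/
def normXT (N m : ℕ) (γ T : ℝ) (u : ℝ → sector N m → ℝ) : ℝ≥0∞ :=
  ⨆ t ∈ Ioc (0 : ℝ) T, ⨆ x : sector N m, ENNReal.ofReal (|u t x| / Psi N m γ t x)

/-- `u ∈ X_T`: `u ∈ C((0, T]; C_0(Ω))` and `|u(t, x)| ≤ M Ψ(t, x)` for some `M > 0`. Only the
values `u t` with `0 < t ≤ T` matter. The space `C₀(Ω, ℝ)` of continuous functions on `Ω` that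
vanish at infinity of the locally compact space `Ω`, with the sup norm, is the space of
continuous functions on the closure of `Ω` that vanish on `∂Ω` and tend to `0` as `|x| → ∞`. -/
def MemXT (N m : ℕ) (γ T : ℝ) (u : ℝ → C₀(sector N m, ℝ)) : Prop :=
  ContinuousOn u (Ioc 0 T) ∧
    ∃ M : ℝ, 0 < M ∧ ∀ t ∈ Ioc (0 : ℝ) T, ∀ x, |u t x| ≤ M * Psi N m γ t x

/-- The nonlinearity `|f|^α f`. -/
def nonlin (N m : ℕ) (α : ℝ) (f : sector N m → ℝ) (x : sector N m) : ℝ :=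
  |f x| ^ α * f x

/-- `u` satisfies
`u(t) = e^{tΔ_Ω} ψ + a ∫_0^t e^{(t-σ)Δ_Ω} (|u(σ)|^α u(σ)) dσ` on `Ω` for `0 < t ≤ T`. -/
def IntegralEq (N m : ℕ) (α a T : ℝ) (ψ : sector N m → ℝ)
    (u : ℝ → C₀(sector N m, ℝ)) : Prop :=
  ∀ t ∈ Ioc (0 : ℝ) T, ∀ x,
    u t x = heat N m t ψ x + a * ∫ σ in (0 : ℝ)..t, heat N m (t - σ) (nonlin N m α (u σ)) x

/-- `u ∈ X_T` solves the integral equation with initial value `ψ`, and `|||u|||_{X_T} ≤ M`. -/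
def IsSolution (N m : ℕ) (γ α a M T : ℝ) (ψ : sector N m → ℝ)
    (u : ℝ → C₀(sector N m, ℝ)) : Prop :=
  MemXT N m γ T u ∧ normXT N m γ T (fun t => u t) ≤ ENNReal.ofReal M ∧
    IntegralEq N m α a T ψ u

/-- The integral in the integral equation converges absolutely in `C_0(Ω)`, as a Bochner
integral, and the equation holds in `C_0(Ω)`. -/
def ConvergesInC0 (N m : ℕ) (α a T : ℝ) (ψ : sector N m → ℝ)
    (u : ℝ → C₀(sector N m, ℝ)) : Prop :=
  ∀ t ∈ Ioc (0 : ℝ) T, ∃ (L : C₀(sector N m, ℝ)) (F : ℝ → C₀(sector N m, ℝ)),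
    (∀ x, L x = heat N m t ψ x) ∧
    (∀ σ ∈ Ioo (0 : ℝ) t, ∀ x, F σ x = heat N m (t - σ) (nonlin N m α (u σ)) x) ∧
    IntervalIntegrable F volume 0 t ∧
    u t = L + a • ∫ σ in (0 : ℝ)..t, F σ

end

end SectorHeat


namespace SectorHeat

noncomputable section

/-! ### One-dimensional Gaussian kernels -/

/-- The one-dimensional Gaussian heat kernel. -/
def gauss (t z : ℝ) : ℝ := (4 * Real.pi * t) ^ (-(1 : ℝ) / 2) * Real.exp (-z ^ 2 / (4 * t))

lemma gauss_pos {t : ℝ} (ht : 0 < t) (z : ℝ) : 0 < gauss t z := by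
  unfold gauss; positivity

lemma gauss_neg (t z : ℝ) : gauss t (-z) = gauss t z := by
  simp [gauss]

lemma gauss_eq_exp (t z : ℝ) :
    gauss t z = (4 * Real.pi * t) ^ (-(1 : ℝ) / 2) * Real.exp (-(1 / (4 * t)) * z ^ 2) := by
  unfold gauss; congr 2; ring

lemma integrable_gauss {t : ℝ} (ht : 0 < t) : Integrable (gauss t) := by
  have := (integrable_exp_neg_mul_sq (b := 1 / (4 * t)) (by positivity)).const_mul
    ((4 * Real.pi * t) ^ (-(1 : ℝ) / 2))
  exact this.congr (Eventually.of_forall fun z => (gauss_eq_exp t z).symm)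

lemma integrable_mul_gauss {t : ℝ} (ht : 0 < t) : Integrable (fun z => z * gauss t z) := by
  have := (integrable_mul_exp_neg_mul_sq (b := 1 / (4 * t)) (by positivity)).const_mul
    ((4 * Real.pi * t) ^ (-(1 : ℝ) / 2))
  refine this.congr (Eventually.of_forall fun z => ?_)
  simp only [gauss_eq_exp]; ring

lemma integral_gauss {t : ℝ} (ht : 0 < t) : ∫ z, gauss t z = 1 := by
  have hpos : (0 : ℝ) < 4 * Real.pi * t := by positivity
  simp only [gauss_eq_exp]
  rw [integral_const_mul, integral_gaussian, Real.sqrt_eq_rpow,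
    show Real.pi / (1 / (4 * t)) = 4 * Real.pi * t by field_simp, ← Real.rpow_add hpos]
  norm_num

lemma integral_mul_gauss (t : ℝ) : ∫ z, z * gauss t z = 0 := by
  have h := integral_neg_eq_self (fun z : ℝ => z * gauss t z) volume
  simp only [gauss_neg, neg_mul, integral_neg] at h
  linarith

/-- Completing the square in a product of two Gaussians. -/
lemma gauss_mul_gauss {t s : ℝ} (ht : 0 < t) (hs : 0 < s) (a b z : ℝ) :
    gauss t (a - z) * gauss s (z - b)
      = gauss (t + s) (a - b) * gauss (t * s / (t + s)) (z - (s * a + t * b) / (t + s)) := by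
  have h1 : (4 * Real.pi * t) ^ (-(1 : ℝ) / 2) * (4 * Real.pi * s) ^ (-(1 : ℝ) / 2)
      = (4 * Real.pi * (t + s)) ^ (-(1 : ℝ) / 2)
        * (4 * Real.pi * (t * s / (t + s))) ^ (-(1 : ℝ) / 2) := by
    rw [← Real.mul_rpow (by positivity) (by positivity),
      ← Real.mul_rpow (by positivity) (by positivity)]
    congr 1; field_simp
  have h2 : Real.exp (-(a - z) ^ 2 / (4 * t)) * Real.exp (-(z - b) ^ 2 / (4 * s))
      = Real.exp (-(a - b) ^ 2 / (4 * (t + s)))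
        * Real.exp (-(z - (s * a + t * b) / (t + s)) ^ 2 / (4 * (t * s / (t + s)))) := by
    rw [← Real.exp_add, ← Real.exp_add]
    congr 1; field_simp; ring
  unfold gauss
  calc _ = ((4 * Real.pi * t) ^ (-(1 : ℝ) / 2) * (4 * Real.pi * s) ^ (-(1 : ℝ) / 2)) *
        (Real.exp (-(a - z) ^ 2 / (4 * t)) * Real.exp (-(z - b) ^ 2 / (4 * s))) := by ring
    _ = _ := by rw [h1, h2]; ring

lemma integrable_gauss_mul_gauss {t s : ℝ} (ht : 0 < t) (hs : 0 < s) (a b : ℝ) :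
    Integrable (fun z => gauss t (a - z) * gauss s (z - b)) := by
  simp only [gauss_mul_gauss ht hs]
  exact ((integrable_gauss (by positivity)).comp_sub_right _).const_mul _

lemma integral_gauss_mul_gauss {t s : ℝ} (ht : 0 < t) (hs : 0 < s) (a b : ℝ) :
    ∫ z, gauss t (a - z) * gauss s (z - b) = gauss (t + s) (a - b) := by
  simp only [gauss_mul_gauss ht hs]
  rw [integral_const_mul, integral_sub_right_eq_self (gauss (t * s / (t + s))),
    integral_gauss (by positivity), mul_one]

lemma integrable_gauss_mul_id_mul_gauss {t s : ℝ} (ht : 0 < t) (hs : 0 < s) (a : ℝ) :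
    Integrable (fun z => gauss t (a - z) * (z * gauss s z)) := by
  have key : ∀ z, gauss t (a - z) * (z * gauss s z) = gauss (t + s) a *
      ((z - s * a / (t + s)) * gauss (t * s / (t + s)) (z - s * a / (t + s))
        + s * a / (t + s) * gauss (t * s / (t + s)) (z - s * a / (t + s))) := fun z => by
    have := gauss_mul_gauss ht hs a 0 z
    simp only [sub_zero, mul_zero, add_zero] at this
    linear_combination z * this
  simp only [key]
  exact ((((integrable_mul_gauss (t := t * s / (t + s)) (by positivity)).comp_sub_right
    (s * a / (t + s)))).add (((integrable_gauss (t := t * s / (t + s))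
      (by positivity)).comp_sub_right (s * a / (t + s))).const_mul _)).const_mul _

lemma integral_gauss_mul_id_mul_gauss {t s : ℝ} (ht : 0 < t) (hs : 0 < s) (a : ℝ) :
    ∫ z, gauss t (a - z) * (z * gauss s z) = s * a / (t + s) * gauss (t + s) a := by
  have key : ∀ z, gauss t (a - z) * (z * gauss s z) = gauss (t + s) a *
      ((z - s * a / (t + s)) * gauss (t * s / (t + s)) (z - s * a / (t + s))
        + s * a / (t + s) * gauss (t * s / (t + s)) (z - s * a / (t + s))) := fun z => by
    have := gauss_mul_gauss ht hs a 0 z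
    simp only [sub_zero, mul_zero, add_zero] at this
    linear_combination z * this
  simp only [key]
  rw [integral_const_mul, integral_add
    ((integrable_mul_gauss (t := t * s / (t + s)) (by positivity)).comp_sub_right
    (s * a / (t + s))) (((integrable_gauss (t := t * s / (t + s))
      (by positivity)).comp_sub_right (s * a / (t + s))).const_mul _),
    integral_sub_right_eq_self (fun z => z * gauss (t * s / (t + s)) z), integral_mul_gauss,
    integral_const_mul, integral_sub_right_eq_self (gauss (t * s / (t + s))),
    integral_gauss (by positivity)]
  ring

lemma setIntegral_Ioi_of_even {f : ℝ → ℝ} (hf : ∀ z, f (-z) = f z) :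
    ∫ z in Ioi 0, f z = (∫ z, f z) / 2 := by
  have h := integral_comp_abs (f := f)
  have h2 : ∀ z, f |z| = f z := fun z => by
    rcases abs_choice z with h | h <;> rw [h]
    exact hf z
  simp only [h2] at h
  linarith

/-- The Dirichlet heat kernel of the half-line. -/
def halfKernel (t a b : ℝ) : ℝ := gauss t (a - b) - gauss t (a + b)

lemma gauss_add (t a b : ℝ) : gauss t (a + b) = gauss t (-a - b) := by
  rw [← gauss_neg]; congr 1; ring

lemma halfKernel_eq_mul {t : ℝ} (ht : 0 < t) (a b : ℝ) :
    halfKernel t a b = gauss t (a - b) * (1 - Real.exp (-(a * b / t))) := by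
  unfold halfKernel gauss
  have : Real.exp (-(a + b) ^ 2 / (4 * t))
      = Real.exp (-(a - b) ^ 2 / (4 * t)) * Real.exp (-(a * b / t)) := by
    rw [← Real.exp_add]; congr 1; field_simp; ring
  rw [this]; ring

lemma integrable_halfKernel_mul {t s : ℝ} (ht : 0 < t) (hs : 0 < s) (a b : ℝ) :
    Integrable (fun z => halfKernel t a z * halfKernel s z b) := by
  have h : (fun z => halfKernel t a z * halfKernel s z b) =
      fun z => (gauss t (a - z) * gauss s (z - b) - gauss t (a - z) * gauss s (z - -b))
        - (gauss t (-a - z) * gauss s (z - b) - gauss t (-a - z) * gauss s (z - -b)) := by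
    funext z
    unfold halfKernel
    rw [gauss_add t a z, sub_neg_eq_add]; ring
  rw [h]
  exact ((integrable_gauss_mul_gauss ht hs _ _).sub (integrable_gauss_mul_gauss ht hs _ _)).sub
    ((integrable_gauss_mul_gauss ht hs _ _).sub (integrable_gauss_mul_gauss ht hs _ _))

lemma integral_halfKernel_mul {t s : ℝ} (ht : 0 < t) (hs : 0 < s) (a b : ℝ) :
    ∫ z in Ioi 0, halfKernel t a z * halfKernel s z b = halfKernel (t + s) a b := by
  rw [setIntegral_Ioi_of_even]
  · have h : (fun z => halfKernel t a z * halfKernel s z b) =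
        fun z => (gauss t (a - z) * gauss s (z - b) - gauss t (a - z) * gauss s (z - -b))
          - (gauss t (-a - z) * gauss s (z - b) - gauss t (-a - z) * gauss s (z - -b)) := by
      funext z
      unfold halfKernel
      rw [gauss_add t a z, sub_neg_eq_add]; ring
    have hi := fun a b => integrable_gauss_mul_gauss ht hs a b
    have hi2 : ∀ a, Integrable (fun z => gauss t (a - z) * gauss s (z - b)
        - gauss t (a - z) * gauss s (z - -b)) := fun a => (hi _ _).sub (hi _ _)
    rw [h, integral_sub (hi2 _) (hi2 _),
      integral_sub (hi _ _) (hi _ _), integral_sub (hi _ _) (hi _ _)]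
    simp only [integral_gauss_mul_gauss ht hs]
    unfold halfKernel
    rw [← gauss_add, sub_neg_eq_add, show -a - -b = -(a - b) by ring, gauss_neg]; ring
  · intro z
    unfold halfKernel
    rw [show -z - b = -(z + b) by ring, show -z + b = -(z - b) by ring, gauss_neg, gauss_neg,
      sub_neg_eq_add, ← sub_eq_add_neg]
    ring

lemma integrable_halfKernel_mul_id_mul_gauss {t s : ℝ} (ht : 0 < t) (hs : 0 < s) (a : ℝ) :
    Integrable (fun z => halfKernel t a z * (z * gauss s z)) := by
  have h : (fun z => halfKernel t a z * (z * gauss s z)) =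
      fun z => gauss t (a - z) * (z * gauss s z) - gauss t (-a - z) * (z * gauss s z) := by
    funext z; unfold halfKernel; rw [gauss_add]; ring
  rw [h]
  exact (integrable_gauss_mul_id_mul_gauss ht hs _).sub (integrable_gauss_mul_id_mul_gauss ht hs _)

lemma integral_halfKernel_mul_id_mul_gauss {t s : ℝ} (ht : 0 < t) (hs : 0 < s) (a : ℝ) :
    ∫ z in Ioi 0, halfKernel t a z * (z * gauss s z) = s * a / (t + s) * gauss (t + s) a := by
  rw [setIntegral_Ioi_of_even]
  · have h : (fun z => halfKernel t a z * (z * gauss s z)) =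
        fun z => gauss t (a - z) * (z * gauss s z) - gauss t (-a - z) * (z * gauss s z) := by
      funext z; unfold halfKernel; rw [gauss_add]; ring
    rw [h, integral_sub (integrable_gauss_mul_id_mul_gauss ht hs _)
      (integrable_gauss_mul_id_mul_gauss ht hs _), integral_gauss_mul_id_mul_gauss ht hs,
      integral_gauss_mul_id_mul_gauss ht hs, gauss_neg]
    ring
  · intro z
    unfold halfKernel
    rw [gauss_neg, sub_neg_eq_add, ← sub_eq_add_neg]; ring

/-! ### Integrals of products over the sector -/

variable {N m : ℕ}

instance : LocallyCompactSpace (sector N m) := (sector N m).isOpen.locallyCompactSpace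

instance : IsLocallyFiniteMeasure (leb N m) := by
  refine ⟨fun x => ?_⟩
  obtain ⟨s, hs, hs'⟩ := (volume : Measure (EuclideanSpace ℝ (Fin N))).finiteAt_nhds x.1
  refine ⟨Subtype.val ⁻¹' s, continuous_subtype_val.continuousAt.preimage_mem_nhds hs, ?_⟩
  exact ((MeasurableEmbedding.subtype_coe (sector N m).isOpen.measurableSet).comap_apply _
    _).trans_lt ((measure_mono (image_preimage_subset _ _)).trans_lt hs')

instance : SigmaFinite (leb N m) := inferInstance

instance : (leb N m).Regular := inferInstance

lemma integral_leb (f : EuclideanSpace ℝ (Fin N) → ℝ) :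
    ∫ y, f y.1 ∂(leb N m) = ∫ y in (sector N m : Set (EuclideanSpace ℝ (Fin N))), f y :=
  integral_subtype_comap (sector N m).isOpen.measurableSet f

lemma integrable_leb_iff (f : EuclideanSpace ℝ (Fin N) → ℝ) :
    Integrable (fun y : sector N m => f y.1) (leb N m)
      ↔ IntegrableOn f (sector N m : Set (EuclideanSpace ℝ (Fin N))) :=
  (integrableOn_iff_comap_subtypeVal (sector N m).isOpen.measurableSet).symm

/-- The range of the `i`-th coordinate on the sector. -/
def coordRange (m : ℕ) {N : ℕ} (i : Fin N) : Set ℝ := if (i : ℕ) < m then Ioi 0 else univ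

lemma measurableSet_coordRange (i : Fin N) : MeasurableSet (coordRange m i) := by
  unfold coordRange; split_ifs <;> measurability

lemma mem_sector_iff {y : EuclideanSpace ℝ (Fin N)} :
    y ∈ (sector N m : Set (EuclideanSpace ℝ (Fin N))) ↔ ∀ i, y i ∈ coordRange m i := by
  change (∀ i : Fin N, (i : ℕ) < m → 0 < y i) ↔ _
  refine forall_congr' fun i => ?_
  unfold coordRange
  split_ifs with h <;> simp [h]

lemma indicator_sector_prod (f : Fin N → ℝ → ℝ) (y : EuclideanSpace ℝ (Fin N)) :
    (sector N m : Set (EuclideanSpace ℝ (Fin N))).indicator (fun y => ∏ i, f i (y i)) y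
      = ∏ i, (coordRange m i).indicator (f i) (y i) := by
  by_cases h : y ∈ (sector N m : Set (EuclideanSpace ℝ (Fin N)))
  · rw [indicator_of_mem h]
    exact Finset.prod_congr rfl fun i _ => (indicator_of_mem (mem_sector_iff.1 h i) _).symm
  · rw [indicator_of_notMem h]
    rw [mem_sector_iff] at h
    push Not at h
    obtain ⟨i, hi⟩ := h
    exact (Finset.prod_eq_zero (Finset.mem_univ i) (indicator_of_notMem hi _)).symm

lemma integral_leb_prod (f : Fin N → ℝ → ℝ) :
    ∫ y, ∏ i, f i (y.1 i) ∂(leb N m) = ∏ i, ∫ z in coordRange m i, f i z := by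
  rw [integral_leb (fun y => ∏ i, f i (y i)),
    ← integral_indicator (sector N m).isOpen.measurableSet]
  simp_rw [indicator_sector_prod, ← integral_indicator (measurableSet_coordRange _)]
  rw [← integral_fintype_prod_volume_eq_prod, ← (PiLp.volume_preserving_toLp (Fin N)).integral_comp
    (MeasurableEquiv.toLp 2 _).measurableEmbedding]

lemma integrable_leb_prod {f : Fin N → ℝ → ℝ}
    (hf : ∀ i, IntegrableOn (f i) (coordRange m i)) :
    Integrable (fun y : sector N m => ∏ i, f i (y.1 i)) (leb N m) := by
  rw [integrable_leb_iff (fun y => ∏ i, f i (y i)),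
    ← integrable_indicator_iff (sector N m).isOpen.measurableSet]
  simp_rw [funext (indicator_sector_prod (m := m) f)]
  rw [← (PiLp.volume_preserving_toLp (Fin N)).integrable_comp_emb
    (MeasurableEquiv.toLp 2 _).measurableEmbedding]
  exact Integrable.fintype_prod (f := fun i => (coordRange m i).indicator (f i)) fun i =>
    (hf i).integrable_indicator (measurableSet_coordRange i)

/-! ### The heat kernel of the sector -/

/-- The one-dimensional factor of the heat kernel in the `i`-th coordinate. -/
def coordKernel (m : ℕ) {N : ℕ} (i : Fin N) (t a b : ℝ) : ℝ :=
  if (i : ℕ) < m then halfKernel t a b else gauss t (a - b)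

lemma kernel_eq_prod {t : ℝ} (ht : 0 < t) (x y : sector N m) :
    kernel N m t x y = ∏ i, coordKernel m i t (x.1 i) (y.1 i) := by
  have h1 : (4 * Real.pi * t) ^ (-(N : ℝ) / 2)
      = ∏ _i : Fin N, (4 * Real.pi * t) ^ (-(1 : ℝ) / 2) := by
    rw [Finset.prod_const, Finset.card_univ, Fintype.card_fin, ← Real.rpow_natCast,
      ← Real.rpow_mul (by positivity)]
    congr 1; ring
  unfold kernel
  rw [h1, Finset.prod_filter, Finset.prod_filter, ← Finset.prod_mul_distrib,
    ← Finset.prod_mul_distrib]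
  refine Finset.prod_congr rfl fun i _ => ?_
  unfold coordKernel halfKernel gauss
  by_cases h : (i : ℕ) < m
  · simp [h, not_le.2 h, sq_abs]; ring
  · simp [h, not_lt.1 h, sq_abs]

lemma coord_pos (x : sector N m) {i : Fin N} (hi : (i : ℕ) < m) : 0 < x.1 i := x.2 i hi

lemma halfKernel_pos {t a b : ℝ} (ht : 0 < t) (ha : 0 < a) (hb : 0 < b) :
    0 < halfKernel t a b := by
  rw [halfKernel_eq_mul ht]
  refine mul_pos (gauss_pos ht _) (sub_pos.2 (Real.exp_lt_one_iff.2 ?_))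
  have : 0 < a * b / t := by positivity
  linarith

lemma coordKernel_pos {t : ℝ} (ht : 0 < t) (x y : sector N m) (i : Fin N) :
    0 < coordKernel m i t (x.1 i) (y.1 i) := by
  unfold coordKernel
  split_ifs with h
  · exact halfKernel_pos ht (coord_pos x h) (coord_pos y h)
  · exact gauss_pos ht _

lemma kernel_pos {t : ℝ} (ht : 0 < t) (x y : sector N m) : 0 < kernel N m t x y := by
  rw [kernel_eq_prod ht]
  exact Finset.prod_pos fun i _ => coordKernel_pos ht x y i

lemma kernel_symm (t : ℝ) (x y : sector N m) : kernel N m t x y = kernel N m t y x := by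
  unfold kernel
  simp only [abs_sub_comm (x.1 _), add_comm (x.1 _)]

lemma coordKernel_le {t : ℝ} (ht : 0 < t) (x y : sector N m) (i : Fin N) :
    coordKernel m i t (x.1 i) (y.1 i) ≤ gauss t (x.1 i - y.1 i) := by
  unfold coordKernel
  split_ifs with h
  · unfold halfKernel
    linarith [gauss_pos ht (x.1 i + y.1 i)]
  · exact le_rfl

lemma prod_gauss {t : ℝ} (ht : 0 < t) (z : EuclideanSpace ℝ (Fin N)) :
    ∏ i, gauss t (z i) = (4 * Real.pi * t) ^ (-(N : ℝ) / 2) * Real.exp (-‖z‖ ^ 2 / (4 * t)) := by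
  unfold gauss
  rw [Finset.prod_mul_distrib, Finset.prod_const, Finset.card_univ, Fintype.card_fin,
    ← Real.rpow_natCast, ← Real.rpow_mul (by positivity), ← Real.exp_sum, EuclideanSpace.norm_sq_eq]
  congr 2
  · ring
  · simp [neg_div, Finset.sum_div]

lemma kernel_le {t : ℝ} (ht : 0 < t) (x y : sector N m) :
    kernel N m t x y
      ≤ (4 * Real.pi * t) ^ (-(N : ℝ) / 2) * Real.exp (-‖x.1 - y.1‖ ^ 2 / (4 * t)) := by
  rw [kernel_eq_prod ht, ← prod_gauss ht]
  exact Finset.prod_le_prod (fun i _ => (coordKernel_pos ht x y i).le)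
    fun i _ => coordKernel_le ht x y i

lemma integrableOn_coordKernel_mul {t s : ℝ} (ht : 0 < t) (hs : 0 < s) (i : Fin N) (a b : ℝ) :
    IntegrableOn (fun z => coordKernel m i t a z * coordKernel m i s z b) (coordRange m i) := by
  unfold coordKernel coordRange
  split_ifs with h
  · exact (integrable_halfKernel_mul ht hs a b).integrableOn
  · exact (integrable_gauss_mul_gauss ht hs a b).integrableOn

lemma integral_coordKernel_mul {t s : ℝ} (ht : 0 < t) (hs : 0 < s) (i : Fin N) (a b : ℝ) :
    ∫ z in coordRange m i, coordKernel m i t a z * coordKernel m i s z b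
      = coordKernel m i (t + s) a b := by
  unfold coordKernel coordRange
  split_ifs with h
  · exact integral_halfKernel_mul ht hs a b
  · rw [setIntegral_univ]; exact integral_gauss_mul_gauss ht hs a b

lemma integrable_kernel_mul_kernel {t s : ℝ} (ht : 0 < t) (hs : 0 < s) (x y : sector N m) :
    Integrable (fun z => kernel N m t x z * kernel N m s z y) (leb N m) := by
  simp only [kernel_eq_prod ht, kernel_eq_prod hs, ← Finset.prod_mul_distrib]
  exact integrable_leb_prod fun i => integrableOn_coordKernel_mul ht hs i (x.1 i) (y.1 i)

/-- The Chapman–Kolmogorov identity. -/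
lemma integral_kernel_mul_kernel {t s : ℝ} (ht : 0 < t) (hs : 0 < s) (x y : sector N m) :
    ∫ z, kernel N m t x z * kernel N m s z y ∂(leb N m) = kernel N m (t + s) x y := by
  simp only [kernel_eq_prod ht, kernel_eq_prod hs, kernel_eq_prod (add_pos ht hs),
    ← Finset.prod_mul_distrib]
  rw [integral_leb_prod (fun i z => coordKernel m i t (x.1 i) z * coordKernel m i s z (y.1 i))]
  exact Finset.prod_congr rfl fun i _ => integral_coordKernel_mul ht hs i _ _

/-- The product of the constrained coordinates. -/
def coordProd (x : sector N m) : ℝ := ∏ i ∈ Finset.univ.filter (fun k : Fin N => k.val < m), x.1 i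

lemma coordProd_pos (x : sector N m) : 0 < coordProd x :=
  Finset.prod_pos fun _ hi => coord_pos x (Finset.mem_filter.1 hi).2

@[fun_prop]
lemma continuous_coordProd : Continuous (coordProd : sector N m → ℝ) := by
  unfold coordProd; fun_prop

/-- The function `x₁ ⋯ x_m e^{-s|x|²}`. -/
def gaussProd (s : ℝ) (x : sector N m) : ℝ := coordProd x * Real.exp (-s * ‖x.1‖ ^ 2)

lemma gaussProd_pos (s : ℝ) (x : sector N m) : 0 < gaussProd s x :=
  mul_pos (coordProd_pos x) (Real.exp_pos _)

@[fun_prop]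
lemma continuous_gaussProd (s : ℝ) : Continuous (gaussProd s : sector N m → ℝ) := by
  unfold gaussProd; fun_prop

lemma gaussProd_eq_prod {s : ℝ} (hs : 0 < s) (x : sector N m) :
    gaussProd s x = (Real.pi / s) ^ ((N : ℝ) / 2) *
      ∏ i : Fin N, ((if (i : ℕ) < m then x.1 i else 1) * gauss (1 / (4 * s)) (x.1 i)) := by
  rw [Finset.prod_mul_distrib, prod_gauss (by positivity), ← Finset.prod_filter, gaussProd,
    coordProd, show 4 * Real.pi * (1 / (4 * s)) = Real.pi / s by field_simp,
    show -‖x.1‖ ^ 2 / (4 * (1 / (4 * s))) = -s * ‖x.1‖ ^ 2 by field_simp, neg_div,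
    Real.rpow_neg (by positivity)]
  have : (Real.pi / s) ^ ((N : ℝ) / 2) ≠ 0 := by positivity
  field_simp

lemma kernel_mul_gaussProd {t s : ℝ} (ht : 0 < t) (hs : 0 < s) (x y : sector N m) :
    kernel N m t x y * gaussProd s y = (Real.pi / s) ^ ((N : ℝ) / 2) *
      ∏ i : Fin N, (coordKernel m i t (x.1 i) (y.1 i) *
        ((if (i : ℕ) < m then y.1 i else 1) * gauss (1 / (4 * s)) (y.1 i))) := by
  rw [gaussProd_eq_prod hs, kernel_eq_prod ht]
  conv_rhs => rw [Finset.prod_mul_distrib]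
  ring

lemma integrable_kernel_mul_gaussProd {t s : ℝ} (ht : 0 < t) (hs : 0 < s) (x : sector N m) :
    Integrable (fun y => kernel N m t x y * gaussProd s y) (leb N m) := by
  simp only [kernel_mul_gaussProd ht hs]
  refine (integrable_leb_prod (f := fun i z => coordKernel m i t (x.1 i) z *
        ((if (i : ℕ) < m then z else 1) * gauss (1 / (4 * s)) z)) fun i => ?_).const_mul _
  unfold coordKernel coordRange
  split_ifs with h
  · exact (integrable_halfKernel_mul_id_mul_gauss ht (by positivity) _).integrableOn
  · have := integrable_gauss_mul_gauss ht (show 0 < 1 / (4 * s) by positivity) (x.1 i) 0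
    simp only [sub_zero] at this
    simpa only [one_mul] using this.integrableOn

lemma heat_gaussProd {t s : ℝ} (ht : 0 < t) (hs : 0 < s) (x : sector N m) (hm : m ≤ N) :
    heat N m t (gaussProd s) x
      = (1 + 4 * s * t) ^ (-(m + (N : ℝ) / 2)) * gaussProd (s / (1 + 4 * s * t)) x := by
  have hp : 0 < 1 + 4 * s * t := by positivity
  have h1 : ∀ i : Fin N, ∫ z in coordRange m i, coordKernel m i t (x.1 i) z *
        ((if (i : ℕ) < m then z else 1) * gauss (1 / (4 * s)) z)
      = (if (i : ℕ) < m then (1 + 4 * s * t)⁻¹ else 1) * ((if (i : ℕ) < m then x.1 i else 1)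
        * gauss (1 / (4 * (s / (1 + 4 * s * t)))) (x.1 i)) := fun i => by
    have e : t + 1 / (4 * s) = 1 / (4 * (s / (1 + 4 * s * t))) := by field_simp; ring
    unfold coordKernel coordRange
    split_ifs with h
    · rw [integral_halfKernel_mul_id_mul_gauss ht (by positivity), ← e]
      field_simp
      ring
    · have := integral_gauss_mul_gauss ht (show 0 < 1 / (4 * s) by positivity) (x.1 i) 0
      simp only [sub_zero] at this
      rw [setIntegral_univ]
      simp only [one_mul]
      rw [this, e]
  unfold heat
  simp only [kernel_mul_gaussProd ht hs]
  rw [integral_const_mul, integral_leb_prod (fun i z => coordKernel m i t (x.1 i) z *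
        ((if (i : ℕ) < m then z else 1) * gauss (1 / (4 * s)) z)), gaussProd_eq_prod (by positivity),
    Finset.prod_congr rfl fun i _ => h1 i]
  rw [Finset.prod_mul_distrib, ← Finset.prod_filter, Finset.prod_const]
  have hc : (Finset.univ.filter (fun k : Fin N => k.val < m)).card = m := by
    have h := Fin.card_filter_val_lt (n := N) (m := m)
    rw [min_eq_right hm] at h
    exact h
  rw [hc, show Real.pi / (s / (1 + 4 * s * t)) = Real.pi / s * (1 + 4 * s * t) by field_simp,
    Real.mul_rpow (by positivity) hp.le, neg_add, Real.rpow_add hp, Real.rpow_neg hp.le (m : ℝ),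
    Real.rpow_natCast, Real.rpow_neg hp.le, inv_pow]
  have : (1 + 4 * s * t) ^ ((N : ℝ) / 2) ≠ 0 := by positivity
  field_simp

end

end SectorHeat

namespace SectorHeat

noncomputable section

/-! ### Power integrals -/

lemma lintegral_Ioc_rpow {κ r : ℝ} (hκ : 0 < κ) (hr : 0 < r) :
    ∫⁻ s in Ioc 0 r, ENNReal.ofReal (s ^ (κ - 1)) = ENNReal.ofReal (r ^ κ / κ) := by
  have hi : IntegrableOn (fun s : ℝ => s ^ (κ - 1)) (Ioc 0 r) :=
    (intervalIntegrable_iff_integrableOn_Ioc_of_le hr.le).1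
      (intervalIntegral.intervalIntegrable_rpow' (by linarith))
  rw [← ofReal_integral_eq_lintegral_ofReal hi
    ((ae_restrict_mem measurableSet_Ioc).mono fun s hs => Real.rpow_nonneg hs.1.le _),
    ← intervalIntegral.integral_of_le hr.le, integral_rpow (Or.inl (by linarith))]
  simp [hκ.ne']

lemma lintegral_Ioi_rpow {q r : ℝ} (hq : 0 < q) (hr : 0 < r) :
    ∫⁻ s in Ioi r, ENNReal.ofReal (s ^ (-q - 1)) = ENNReal.ofReal (r ^ (-q) / q) := by
  have hi : IntegrableOn (fun s : ℝ => s ^ (-q - 1)) (Ioi r) :=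
    integrableOn_Ioi_rpow_of_lt (by linarith) hr
  rw [← ofReal_integral_eq_lintegral_ofReal hi
    ((ae_restrict_mem measurableSet_Ioi).mono fun s hs => Real.rpow_nonneg (hr.trans hs).le _),
    integral_Ioi_rpow_of_lt (by linarith) hr]
  simp [div_neg, neg_div]

lemma lintegral_rpow_mul_exp {κ b : ℝ} (hκ : 0 < κ) (hb : 0 < b) :
    ∫⁻ s in Ioi 0, ENNReal.ofReal (s ^ (κ - 1) * Real.exp (-(b * s)))
      = ENNReal.ofReal (Real.Gamma κ * b ^ (-κ)) := by
  have hintegrable := Real.integral_rpow_mul_exp_neg_mul_Ioi hκ hb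
  have hpos : 0 < (1 / b) ^ κ * Real.Gamma κ := by
    have := Real.Gamma_pos_of_pos hκ
    positivity
  have hi : IntegrableOn (fun s : ℝ => s ^ (κ - 1) * Real.exp (-(b * s))) (Ioi 0) := by
    by_contra h
    have := integral_undef h
    rw [this] at hintegrable
    linarith
  rw [← ofReal_integral_eq_lintegral_ofReal hi
    ((ae_restrict_mem measurableSet_Ioi).mono fun s hs =>
      mul_nonneg (Real.rpow_nonneg (mem_Ioi.1 hs).le _) (Real.exp_pos _).le), hintegrable, one_div,
      Real.inv_rpow hb.le, Real.rpow_neg hb.le, mul_comm]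

/-! ### The function `ψ₀` and its evolution -/

/-- The standing conditions on the dimension, the number of constraints and the exponent. -/
structure Params (N m : ℕ) (γ : ℝ) : Prop where
  hm : m ≤ N
  hγ : 0 < γ
  hγN : γ < N

variable {N m : ℕ} {γ : ℝ}

/-- The constant `c_{m,γ}`. -/
def psiConst (m : ℕ) (γ : ℝ) : ℝ := ∏ k ∈ Finset.range m, (γ + 2 * (k : ℝ))

lemma Params.psiConst_pos (hp : Params N m γ) : 0 < psiConst m γ :=
  Finset.prod_pos fun k _ => by have := hp.hγ; positivity

lemma Params.N_pos (hp : Params N m γ) : 0 < N := by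
  have := hp.hγ.trans hp.hγN
  exact_mod_cast this

lemma psi0_eq (x : sector N m) :
    psi0 N m γ x = psiConst m γ * coordProd x * ‖x.1‖ ^ (-γ - 2 * (m : ℝ)) := rfl

lemma Params.psi0_nonneg (hp : Params N m γ) (x : sector N m) : 0 ≤ psi0 N m γ x := by
  rw [psi0_eq]
  have := hp.psiConst_pos
  have := coordProd_pos x
  positivity

lemma Params.psi0_pos (hp : Params N m γ) {x : sector N m} (hx : x.1 ≠ 0) :
    0 < psi0 N m γ x := by
  rw [psi0_eq]
  have := hp.psiConst_pos
  have := coordProd_pos x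
  have := norm_pos_iff.2 hx
  positivity

lemma measurable_psi0 : Measurable (psi0 N m γ) := by
  unfold psi0
  fun_prop

lemma Params.ae_ne_zero (hp : Params N m γ) : ∀ᵐ x ∂(leb N m), x.1 ≠ 0 := by
  have : Nonempty (Fin N) := ⟨⟨0, hp.N_pos⟩⟩
  rw [ae_iff]
  refine ((MeasurableEmbedding.subtype_coe (sector N m).isOpen.measurableSet).comap_apply _
    _).trans ?_
  refine measure_mono_null (t := {0}) ?_ (measure_singleton _)
  rintro _ ⟨y, hy, rfl⟩
  simpa using hy

lemma Params.ae_psi0_pos (hp : Params N m γ) : ∀ᵐ x ∂(leb N m), 0 < psi0 N m γ x :=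
  hp.ae_ne_zero.mono fun _ hx => hp.psi0_pos hx

lemma Params.exponent_pos (hp : Params N m γ) : 0 < γ / 2 + m := by
  have := hp.hγ; positivity

lemma Params.exponent_lt (hp : Params N m γ) : γ / 2 + m < m + (N : ℝ) / 2 := by
  linarith [hp.hγN]

lemma gaussProd_rpow_mul (κ b c s : ℝ) (x : sector N m) :
    c * s ^ (κ - 1) * gaussProd (b * s) x
      = c * coordProd x * (s ^ (κ - 1) * Real.exp (-(b * ‖x.1‖ ^ 2 * s))) := by
  unfold gaussProd
  rw [show -(b * s) * ‖x.1‖ ^ 2 = -(b * ‖x.1‖ ^ 2 * s) by ring]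
  ring

lemma Params.lintegral_gaussProd (hp : Params N m γ) {b : ℝ} (hb : 0 < b) {x : sector N m}
    (hx : x.1 ≠ 0) :
    ∫⁻ s in Ioi 0, ENNReal.ofReal (psiConst m γ / Real.Gamma (γ / 2 + m) * s ^ (γ / 2 + m - 1)
        * gaussProd (b * s) x) = ENNReal.ofReal (b ^ (-(γ / 2 + m)) * psi0 N m γ x) := by
  have hG := Real.Gamma_pos_of_pos hp.exponent_pos
  have hx' := norm_pos_iff.2 hx
  have hc := hp.psiConst_pos
  have hx2 := coordProd_pos x
  simp only [gaussProd_rpow_mul]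
  simp_rw [ENNReal.ofReal_mul (show 0 ≤ psiConst m γ / Real.Gamma (γ / 2 + m) * coordProd x
    by positivity)]
  rw [lintegral_const_mul' _ _ ENNReal.ofReal_ne_top, lintegral_rpow_mul_exp hp.exponent_pos
    (by positivity), ← ENNReal.ofReal_mul (by positivity)]
  congr 1
  rw [psi0_eq, Real.mul_rpow hb.le (by positivity), ← Real.rpow_natCast, ← Real.rpow_mul hx'.le,
    show ((2 : ℕ) : ℝ) * -(γ / 2 + m) = -γ - 2 * m by push_cast; ring]
  generalize Real.Gamma (γ / 2 + m) = g at *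
  field_simp

lemma Params.ofReal_psi0 (hp : Params N m γ) {x : sector N m} (hx : x.1 ≠ 0) :
    ENNReal.ofReal (psi0 N m γ x) = ∫⁻ s in Ioi 0, ENNReal.ofReal
      (psiConst m γ / Real.Gamma (γ / 2 + m) * s ^ (γ / 2 + m - 1) * gaussProd s x) := by
  have := hp.lintegral_gaussProd one_pos hx
  simp only [one_mul, Real.one_rpow] at this
  exact this.symm

lemma measurable_kernel (t : ℝ) : Measurable (fun p : sector N m × sector N m =>
    kernel N m t p.1 p.2) := by
  refine Continuous.measurable ?_
  unfold kernel; fun_prop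

lemma continuous_kernel_right (t : ℝ) (x : sector N m) : Continuous (kernel N m t x) := by
  unfold kernel; fun_prop

lemma Params.lintegral_kernel_mul_psi0 (hp : Params N m γ) {t : ℝ} (ht : 0 < t) (x : sector N m) :
    ∫⁻ y, ENNReal.ofReal (kernel N m t x y * psi0 N m γ y) ∂(leb N m)
      = ∫⁻ s in Ioi 0, ENNReal.ofReal (psiConst m γ / Real.Gamma (γ / 2 + m) * s ^ (γ / 2 + m - 1)
        * ((1 + 4 * s * t) ^ (-(m + (N : ℝ) / 2)) * gaussProd (s / (1 + 4 * s * t)) x)) := by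
  have hG := Real.Gamma_pos_of_pos hp.exponent_pos
  have hc := hp.psiConst_pos
  have h1 : ∫⁻ y, ENNReal.ofReal (kernel N m t x y * psi0 N m γ y) ∂(leb N m)
      = ∫⁻ y, (∫⁻ s in Ioi (0 : ℝ), ENNReal.ofReal (psiConst m γ / Real.Gamma (γ / 2 + m)
        * s ^ (γ / 2 + m - 1) * (kernel N m t x y * gaussProd s y))) ∂(leb N m) := by
    refine lintegral_congr_ae (hp.ae_ne_zero.mono fun y hy => ?_)
    simp only
    rw [ENNReal.ofReal_mul (kernel_pos ht x y).le, hp.ofReal_psi0 hy,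
      ← lintegral_const_mul' _ _ ENNReal.ofReal_ne_top]
    refine lintegral_congr fun s => ?_
    rw [← ENNReal.ofReal_mul (kernel_pos ht x y).le]
    congr 1; ring
  rw [h1, lintegral_lintegral_swap]
  · refine setLIntegral_congr_fun measurableSet_Ioi fun s hs => ?_
    have hs : 0 < s := hs
    have hcs : 0 ≤ psiConst m γ / Real.Gamma (γ / 2 + m) * s ^ (γ / 2 + m - 1) := by positivity
    simp_rw [ENNReal.ofReal_mul hcs]
    rw [lintegral_const_mul' _ _ ENNReal.ofReal_ne_top,
      ← ofReal_integral_eq_lintegral_ofReal (integrable_kernel_mul_gaussProd ht hs x)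
      (Eventually.of_forall fun y => (mul_pos (kernel_pos ht x y) (gaussProd_pos s y)).le)]
    congr 2
    exact heat_gaussProd ht hs x hp.hm
  · refine Measurable.aemeasurable (ENNReal.measurable_ofReal.comp ?_)
    have : Measurable (fun p : sector N m × ℝ => kernel N m t x p.1) :=
      (continuous_kernel_right t x).measurable.comp measurable_fst
    have h2 : Measurable (fun p : sector N m × ℝ => gaussProd p.2 p.1) := by
      refine Continuous.measurable ?_
      unfold gaussProd; fun_prop
    have h3 : Measurable (fun p : sector N m × ℝ => p.2 ^ (γ / 2 + m - 1)) := by fun_prop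
    exact (measurable_const.mul h3).mul (this.mul h2)

lemma lintegral_rpow_mul_one_add_le {κ ν t : ℝ} (hκ : 0 < κ) (hν : κ < ν) (ht : 0 < t) :
    ∫⁻ s in Ioi (1 / (4 * t)), ENNReal.ofReal (s ^ (κ - 1) * (1 + 4 * s * t) ^ (-ν))
      ≤ ENNReal.ofReal ((1 / (4 * t)) ^ κ / (ν - κ)) := by
  have hr : 0 < 1 / (4 * t) := by positivity
  have hq : 0 < ν - κ := sub_pos.2 hν
  calc ∫⁻ s in Ioi (1 / (4 * t)), ENNReal.ofReal (s ^ (κ - 1) * (1 + 4 * s * t) ^ (-ν))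
      ≤ ∫⁻ s in Ioi (1 / (4 * t)), ENNReal.ofReal ((1 / (4 * t)) ^ ν)
          * ENNReal.ofReal (s ^ (-(ν - κ) - 1)) := by
        refine setLIntegral_mono' measurableSet_Ioi fun s hs => ?_
        have hs0 : 0 < s := hr.trans hs
        rw [← ENNReal.ofReal_mul (by positivity)]
        refine ENNReal.ofReal_le_ofReal ?_
        have h1 : (1 + 4 * s * t) ^ (-ν) ≤ (s * (4 * t)) ^ (-ν) :=
          Real.rpow_le_rpow_of_nonpos (by positivity) (by linarith) (by linarith)
        rw [Real.mul_rpow hs0.le (by positivity)] at h1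
        have h2 : (4 * t) ^ (-ν) = (1 / (4 * t)) ^ ν := by
          rw [Real.rpow_neg (by positivity), one_div, Real.inv_rpow (by positivity)]
        rw [h2] at h1
        calc s ^ (κ - 1) * (1 + 4 * s * t) ^ (-ν)
            ≤ s ^ (κ - 1) * (s ^ (-ν) * (1 / (4 * t)) ^ ν) := by gcongr
          _ = (1 / (4 * t)) ^ ν * s ^ (-(ν - κ) - 1) := by
            rw [show -(ν - κ) - 1 = (κ - 1) + -ν by ring, Real.rpow_add hs0]; ring
    _ = ENNReal.ofReal ((1 / (4 * t)) ^ κ / (ν - κ)) := by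
        rw [lintegral_const_mul' _ _ ENNReal.ofReal_ne_top, lintegral_Ioi_rpow hq hr,
          ← ENNReal.ofReal_mul (by positivity), ← mul_div_assoc, ← Real.rpow_add hr]
        congr 3; ring

lemma Ioi_zero_eq_union {r : ℝ} (hr : 0 < r) : Ioi (0 : ℝ) = Ioc 0 r ∪ Ioi r := by
  rw [Ioc_union_Ioi_eq_Ioi hr.le]

lemma gaussProd_le_coordProd {s : ℝ} (hs : 0 ≤ s) (x : sector N m) :
    gaussProd s x ≤ coordProd x := by
  unfold gaussProd
  refine mul_le_of_le_one_right (coordProd_pos x).le (Real.exp_le_one_iff.2 ?_)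
  nlinarith [sq_nonneg ‖x.1‖]

lemma gaussProd_anti {s s' : ℝ} (h : s ≤ s') (x : sector N m) :
    gaussProd s' x ≤ gaussProd s x := by
  unfold gaussProd
  have := coordProd_pos x
  gcongr

lemma Params.lintegral_kernel_mul_psi0_le_coordProd (hp : Params N m γ) :
    ∃ C, 0 < C ∧ ∀ t, 0 < t → ∀ x : sector N m,
      ∫⁻ y, ENNReal.ofReal (kernel N m t x y * psi0 N m γ y) ∂(leb N m)
        ≤ ENNReal.ofReal (C * t ^ (-(γ / 2 + m)) * coordProd x) := by
  have hG := Real.Gamma_pos_of_pos hp.exponent_pos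
  have hc := hp.psiConst_pos
  have hκ := hp.exponent_pos
  have hν := hp.exponent_lt
  set κ := γ / 2 + (m : ℝ) with hκd
  set ν := (m : ℝ) + (N : ℝ) / 2 with hνd
  have hq : 0 < ν - κ := sub_pos.2 hν
  refine ⟨psiConst m γ / Real.Gamma κ * (4 ^ (-κ) * (1 / κ + 1 / (ν - κ))), by positivity,
    fun t ht x => ?_⟩
  have hr : 0 < 1 / (4 * t) := by positivity
  have hx := coordProd_pos x
  rw [hp.lintegral_kernel_mul_psi0 ht]
  calc _ ≤ ∫⁻ s in Ioi 0, ENNReal.ofReal (psiConst m γ / Real.Gamma κ * coordProd x)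
          * ENNReal.ofReal (s ^ (κ - 1) * (1 + 4 * s * t) ^ (-ν)) := by
        refine setLIntegral_mono' measurableSet_Ioi fun s hs => ?_
        have hs0 : 0 < s := hs
        rw [← ENNReal.ofReal_mul (by positivity)]
        refine ENNReal.ofReal_le_ofReal ?_
        calc _ ≤ psiConst m γ / Real.Gamma κ * s ^ (κ - 1)
              * ((1 + 4 * s * t) ^ (-ν) * coordProd x) := by
              gcongr
              exact gaussProd_le_coordProd (by positivity) x
          _ = _ := by ring
    _ ≤ ENNReal.ofReal (psiConst m γ / Real.Gamma κ * coordProd x) *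
        (ENNReal.ofReal ((1 / (4 * t)) ^ κ / κ) + ENNReal.ofReal ((1 / (4 * t)) ^ κ / (ν - κ))) := by
        rw [lintegral_const_mul' _ _ ENNReal.ofReal_ne_top, Ioi_zero_eq_union hr,
          lintegral_union measurableSet_Ioi
          (Set.disjoint_left.2 fun s h h' => not_lt.2 h.2 h')]
        gcongr
        · rw [← lintegral_Ioc_rpow hκ hr]
          refine setLIntegral_mono' measurableSet_Ioc fun s hs => ENNReal.ofReal_le_ofReal ?_
          have hs0 : 0 < s := hs.1
          refine mul_le_of_le_one_right (by positivity) ?_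
          exact Real.rpow_le_one_of_one_le_of_nonpos (le_add_of_nonneg_right (by positivity))
            (by linarith)
        · exact lintegral_rpow_mul_one_add_le hκ hν ht
    _ = _ := by
        rw [← ENNReal.ofReal_add (by positivity) (by positivity),
          ← ENNReal.ofReal_mul (by positivity)]
        congr 1
        rw [one_div, Real.inv_rpow (by positivity), Real.mul_rpow (by positivity) ht.le, mul_inv,
          ← Real.rpow_neg (by positivity), ← Real.rpow_neg ht.le]
        ring

lemma Params.integrable_kernel_mul_psi0 (hp : Params N m γ) {t : ℝ} (ht : 0 < t)
    (x : sector N m) : Integrable (fun y => kernel N m t x y * psi0 N m γ y) (leb N m) := by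
  obtain ⟨C, -, hC⟩ := hp.lintegral_kernel_mul_psi0_le_coordProd
  refine ⟨((continuous_kernel_right t x).measurable.mul
    measurable_psi0).aestronglyMeasurable, ?_⟩
  rw [hasFiniteIntegral_iff_ofReal (Eventually.of_forall fun y =>
    mul_nonneg (kernel_pos ht x y).le (hp.psi0_nonneg y))]
  exact (hC t ht x).trans_lt ENNReal.ofReal_lt_top

lemma Params.ofReal_Psi (hp : Params N m γ) {t : ℝ} (ht : 0 < t) (x : sector N m) :
    ENNReal.ofReal (Psi N m γ t x)
      = ∫⁻ y, ENNReal.ofReal (kernel N m t x y * psi0 N m γ y) ∂(leb N m) :=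
  ofReal_integral_eq_lintegral_ofReal (hp.integrable_kernel_mul_psi0 ht x)
    (Eventually.of_forall fun y => mul_nonneg (kernel_pos ht x y).le (hp.psi0_nonneg y))

lemma Params.Psi_le_coordProd (hp : Params N m γ) :
    ∃ C, 0 < C ∧ ∀ t, 0 < t → ∀ x : sector N m,
      Psi N m γ t x ≤ C * t ^ (-(γ / 2 + m)) * coordProd x := by
  obtain ⟨C, hC0, hC⟩ := hp.lintegral_kernel_mul_psi0_le_coordProd
  refine ⟨C, hC0, fun t ht x => ?_⟩
  have hx := coordProd_pos x
  exact (ENNReal.ofReal_le_ofReal_iff (by positivity)).1 ((hp.ofReal_Psi ht x).trans_le (hC t ht x))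

instance : Nonempty (sector N m) := by
  refine ⟨⟨WithLp.toLp 2 (fun _ => 1), fun i _ => ?_⟩⟩
  simp

lemma leb_ne_zero : leb N m ≠ 0 := by
  intro h
  obtain ⟨x⟩ := (inferInstance : Nonempty (sector N m))
  have h1 : leb N m univ = volume (Subtype.val '' (univ : Set (sector N m))) :=
    (MeasurableEmbedding.subtype_coe (sector N m).isOpen.measurableSet).comap_apply _ _
  rw [h, image_univ, Subtype.range_coe] at h1
  exact ((sector N m).isOpen.measure_pos volume ⟨x.1, x.2⟩).ne h1

lemma Params.Psi_pos (hp : Params N m γ) {t : ℝ} (ht : 0 < t) (x : sector N m) :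
    0 < Psi N m γ t x := by
  have : NeZero (leb N m) := ⟨leb_ne_zero⟩
  unfold Psi heat
  rw [integral_pos_iff_support_of_nonneg_ae (Eventually.of_forall fun y =>
    mul_nonneg (kernel_pos ht x y).le (hp.psi0_nonneg y)) (hp.integrable_kernel_mul_psi0 ht x)]
  rw [pos_iff_ne_zero, Ne, measure_eq_zero_iff_ae_notMem]
  intro h
  obtain ⟨y, hy, hy'⟩ := (h.and hp.ae_psi0_pos).exists
  exact hy (mul_pos (kernel_pos ht x y) hy').ne'

lemma Params.Psi_le_psi0 (hp : Params N m γ) :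
    ∃ C, 1 ≤ C ∧ ∀ t, 0 < t → ∀ x : sector N m, x.1 ≠ 0 → Psi N m γ t x ≤ C * psi0 N m γ x := by
  have hG := Real.Gamma_pos_of_pos hp.exponent_pos
  have hc := hp.psiConst_pos
  have hκ := hp.exponent_pos
  have hν := hp.exponent_lt
  have hL := fun (b : ℝ) (hb : 0 < b) (x : sector N m) hx => hp.lintegral_gaussProd hb (x := x) hx
  set κ := γ / 2 + (m : ℝ) with hκd
  set ν := (m : ℝ) + (N : ℝ) / 2 with hνd
  have hq : 0 < ν - κ := sub_pos.2 hν
  have h2κ : (1 : ℝ) ≤ (1 / 2) ^ (-κ) := by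
    rw [one_div, Real.inv_rpow (by norm_num), Real.rpow_neg (by norm_num), inv_inv]
    exact Real.one_le_rpow (by norm_num) hκ.le
  have hone : 1 ≤ 1 + κ / (ν - κ) := le_add_of_nonneg_right (by positivity)
  refine ⟨(1 / 2) ^ (-κ) * (1 + κ / (ν - κ)), one_le_mul_of_one_le_of_one_le h2κ hone,
    fun t ht x hx => ?_⟩
  have hr : 0 < 1 / (4 * t) := by positivity
  have hxp := coordProd_pos x
  have hψ := hp.psi0_pos hx
  refine (ENNReal.ofReal_le_ofReal_iff (by positivity)).1 ?_
  rw [hp.ofReal_Psi ht, hp.lintegral_kernel_mul_psi0 ht, Ioi_zero_eq_union hr,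
      lintegral_union measurableSet_Ioi (Set.disjoint_left.2 fun s h h' => not_lt.2 h.2 h'),
      mul_add, add_mul, mul_one, ENNReal.ofReal_add (by positivity) (by positivity)]
  gcongr ?_ + ?_
  · rw [← hL (1 / 2) (by norm_num) x hx]
    refine (setLIntegral_mono' measurableSet_Ioc fun s hs => ENNReal.ofReal_le_ofReal ?_).trans
      (lintegral_mono_set Ioc_subset_Ioi_self)
    have hs0 : 0 < s := hs.1
    have hst : 4 * s * t ≤ 1 := by
      have := (le_div_iff₀ (by positivity)).1 hs.2
      linarith
    have h1 : (1 + 4 * s * t) ^ (-ν) ≤ 1 :=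
      Real.rpow_le_one_of_one_le_of_nonpos (le_add_of_nonneg_right (by positivity)) (by linarith)
    have h2 : gaussProd (s / (1 + 4 * s * t)) x ≤ gaussProd (1 / 2 * s) x := by
      refine gaussProd_anti ?_ x
      rw [le_div_iff₀ (by positivity)]
      nlinarith
    have h3 := gaussProd_pos (s / (1 + 4 * s * t)) x
    gcongr
    exact (mul_le_of_le_one_left h3.le h1).trans h2
  · calc _ ≤ ∫⁻ s in Ioi (1 / (4 * t)), ENNReal.ofReal (psiConst m γ / Real.Gamma κ *
            gaussProd (1 / 2 * (1 / (4 * t))) x) *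
            ENNReal.ofReal (s ^ (κ - 1) * (1 + 4 * s * t) ^ (-ν)) := by
          refine setLIntegral_mono' measurableSet_Ioi fun s hs => ?_
          have hs0 : 0 < s := hr.trans hs
          have hst : 1 ≤ 4 * s * t := by
            have := (div_le_iff₀ (by positivity)).1 (mem_Ioi.1 hs).le
            linarith
          have h2 : gaussProd (s / (1 + 4 * s * t)) x ≤ gaussProd (1 / 2 * (1 / (4 * t))) x := by
            refine gaussProd_anti ?_ x
            rw [le_div_iff₀ (by positivity)]
            field_simp
            linarith
          have h3 := gaussProd_pos (1 / 2 * (1 / (4 * t))) x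
          rw [← ENNReal.ofReal_mul (by positivity)]
          refine ENNReal.ofReal_le_ofReal ?_
          calc _ ≤ psiConst m γ / Real.Gamma κ * s ^ (κ - 1) *
                ((1 + 4 * s * t) ^ (-ν) * gaussProd (1 / 2 * (1 / (4 * t))) x) := by gcongr
            _ = _ := by ring
      _ ≤ ENNReal.ofReal (κ / (ν - κ)) * (ENNReal.ofReal (psiConst m γ / Real.Gamma κ *
            gaussProd (1 / 2 * (1 / (4 * t))) x) * ENNReal.ofReal ((1 / (4 * t)) ^ κ / κ)) := by
          have h3 := gaussProd_pos (1 / 2 * (1 / (4 * t))) x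
          rw [lintegral_const_mul' _ _ ENNReal.ofReal_ne_top]
          grw [lintegral_rpow_mul_one_add_le hκ hν ht]
          rw [← ENNReal.ofReal_mul (by positivity), ← ENNReal.ofReal_mul (by positivity),
            ← ENNReal.ofReal_mul (by positivity)]
          refine ENNReal.ofReal_le_ofReal (le_of_eq ?_)
          field_simp
      _ ≤ ENNReal.ofReal (κ / (ν - κ)) * ENNReal.ofReal ((1 / 2) ^ (-κ) * psi0 N m γ x) := by
          gcongr
          rw [← hL (1 / 2) (by norm_num) x hx, ← lintegral_Ioc_rpow hκ hr,
            ← lintegral_const_mul' _ _ ENNReal.ofReal_ne_top]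
          refine (setLIntegral_mono' measurableSet_Ioc fun s hs => ?_).trans
            (lintegral_mono_set Ioc_subset_Ioi_self)
          have hs0 : 0 < s := hs.1
          have h3 := gaussProd_pos (1 / 2 * (1 / (4 * t))) x
          rw [← ENNReal.ofReal_mul (by positivity)]
          refine ENNReal.ofReal_le_ofReal ?_
          have h2 : gaussProd (1 / 2 * (1 / (4 * t))) x ≤ gaussProd (1 / 2 * s) x := by
            refine gaussProd_anti ?_ x
            have := hs.2
            gcongr
          calc _ = psiConst m γ / Real.Gamma κ * s ^ (κ - 1)
                * gaussProd (1 / 2 * (1 / (4 * t))) x := by ring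
            _ ≤ _ := by gcongr
      _ = _ := by
          rw [← ENNReal.ofReal_mul (by positivity)]
          congr 1; ring

lemma coordProd_le_pow (hm : m ≤ N) (x : sector N m) : coordProd x ≤ ‖x.1‖ ^ m := by
  have hc : (Finset.univ.filter (fun k : Fin N => k.val < m)).card = m := by
    have h := Fin.card_filter_val_lt (n := N) (m := m)
    rw [min_eq_right hm] at h
    exact h
  unfold coordProd
  calc _ ≤ ∏ i ∈ Finset.univ.filter (fun k : Fin N => k.val < m), ‖x.1‖ :=
        Finset.prod_le_prod (fun i hi => (coord_pos x (Finset.mem_filter.1 hi).2).le)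
          fun i _ => (le_abs_self _).trans (PiLp.norm_apply_le x.1 i)
    _ = _ := by rw [Finset.prod_const, hc]

lemma Params.psi0_le_rpow (hp : Params N m γ) {x : sector N m} (hx : x.1 ≠ 0) :
    psi0 N m γ x ≤ psiConst m γ * ‖x.1‖ ^ (-(γ + m)) := by
  have hx' := norm_pos_iff.2 hx
  have hc := hp.psiConst_pos
  rw [psi0_eq, mul_assoc]
  gcongr
  calc coordProd x * ‖x.1‖ ^ (-γ - 2 * (m : ℝ)) ≤ ‖x.1‖ ^ m * ‖x.1‖ ^ (-γ - 2 * (m : ℝ)) := by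
        gcongr; exact coordProd_le_pow hp.hm x
    _ = ‖x.1‖ ^ (-(γ + m)) := by
        rw [← Real.rpow_natCast, ← Real.rpow_add hx']; congr 1; ring

lemma Params.Psi_le_rpow (hp : Params N m γ) :
    ∃ C, 0 < C ∧ ∀ t, 0 < t → ∀ x : sector N m, Psi N m γ t x ≤ C * t ^ (-((γ + m) / 2)) := by
  obtain ⟨C₁, hC₁, h₁⟩ := hp.Psi_le_coordProd
  obtain ⟨C₂, hC₂, h₂⟩ := hp.Psi_le_psi0
  have hc := hp.psiConst_pos
  have hγ := hp.hγ
  refine ⟨C₁ + C₂ * psiConst m γ, by positivity, fun t ht x => ?_⟩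
  have hts : 0 < Real.sqrt t := Real.sqrt_pos.2 ht
  rcases le_total ‖x.1‖ (Real.sqrt t) with hx | hx
  · calc Psi N m γ t x ≤ C₁ * t ^ (-(γ / 2 + m)) * Real.sqrt t ^ m := by
          refine (h₁ t ht x).trans ?_
          gcongr
          exact (coordProd_le_pow hp.hm x).trans (by gcongr)
      _ = C₁ * t ^ (-((γ + m) / 2)) := by
          rw [Real.sqrt_eq_rpow, ← Real.rpow_natCast, ← Real.rpow_mul ht.le, mul_assoc,
            ← Real.rpow_add ht]
          congr 2; ring
      _ ≤ _ := by
          gcongr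
          exact le_add_of_nonneg_right (by positivity)
  · have hx0 : x.1 ≠ 0 := norm_pos_iff.1 (hts.trans_le hx)
    calc Psi N m γ t x ≤ C₂ * (psiConst m γ * ‖x.1‖ ^ (-(γ + m))) :=
          (h₂ t ht x hx0).trans (by gcongr; exact hp.psi0_le_rpow hx0)
      _ ≤ C₂ * (psiConst m γ * Real.sqrt t ^ (-(γ + m))) := by
          have := Real.rpow_le_rpow_of_nonpos hts hx
            (show -(γ + (m : ℝ)) ≤ 0 by
              have : (0 : ℝ) ≤ m := by positivity
              linarith)
          gcongr
      _ = C₂ * psiConst m γ * t ^ (-((γ + m) / 2)) := by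
          rw [Real.sqrt_eq_rpow, ← Real.rpow_mul ht.le, mul_assoc]
          congr 3; ring
      _ ≤ _ := by
          gcongr
          exact le_add_of_nonneg_left (by positivity)

end

end SectorHeat

namespace SectorHeat

noncomputable section

variable {N m : ℕ} {γ : ℝ}

/-! ### The semigroup -/

lemma integrable_prod_gauss {t : ℝ} (ht : 0 < t) (x : EuclideanSpace ℝ (Fin N)) :
    Integrable (fun y : sector N m => ∏ i, gauss t ((x - y.1) i)) (leb N m) := by
  refine integrable_leb_prod (f := fun i z => gauss t (x i - z)) fun i => ?_
  exact ((integrable_gauss ht).comp_sub_left (x i)).integrableOn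

lemma integrable_kernel {t : ℝ} (ht : 0 < t) (x : sector N m) :
    Integrable (kernel N m t x) (leb N m) := by
  refine (integrable_prod_gauss ht x.1).mono
    (continuous_kernel_right t x).measurable.aestronglyMeasurable (Eventually.of_forall fun y => ?_)
  rw [Real.norm_of_nonneg (kernel_pos ht x y).le]
  refine le_trans ?_ (Real.le_norm_self _)
  rw [prod_gauss ht]
  exact kernel_le ht x y

lemma integral_kernel_le_one {t : ℝ} (ht : 0 < t) (x : sector N m) :
    ∫ y, kernel N m t x y ∂(leb N m) ≤ 1 := by
  calc ∫ y, kernel N m t x y ∂(leb N m)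
      ≤ ∫ y : sector N m, ∏ i, gauss t (x.1 i - y.1 i) ∂(leb N m) := by
        refine integral_mono (integrable_kernel ht x) (integrable_prod_gauss ht x.1) fun y => ?_
        have := kernel_le ht x y
        rw [← prod_gauss ht] at this
        exact this
    _ = ∏ i, ∫ z in coordRange m i, gauss t (x.1 i - z) :=
        integral_leb_prod (fun i z => gauss t (x.1 i - z))
    _ ≤ 1 := by
        refine Finset.prod_le_one (fun i _ => integral_nonneg fun z => (gauss_pos ht _).le)
          fun i _ => ?_
        calc _ ≤ ∫ z, gauss t (x.1 i - z) :=
              setIntegral_le_integral ((integrable_gauss ht).comp_sub_left _)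
                (Eventually.of_forall fun z => (gauss_pos ht _).le)
          _ = 1 := by rw [integral_sub_left_eq_self (gauss t), integral_gauss ht]

lemma integrable_kernel_mul_of_bdd {t B : ℝ} (ht : 0 < t) (x : sector N m) {f : sector N m → ℝ}
    (hf : AEStronglyMeasurable f (leb N m)) (hB : ∀ᵐ y ∂(leb N m), |f y| ≤ B) :
    Integrable (fun y => kernel N m t x y * f y) (leb N m) :=
  (integrable_kernel ht x).mul_bdd hf hB

lemma heat_mono {t : ℝ} (ht : 0 < t) {x : sector N m} {f g : sector N m → ℝ}
    (hf : Integrable (fun y => kernel N m t x y * f y) (leb N m))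
    (hg : Integrable (fun y => kernel N m t x y * g y) (leb N m)) (hfg : f ≤ᵐ[leb N m] g) :
    heat N m t f x ≤ heat N m t g x :=
  integral_mono_ae hf hg (hfg.mono fun y hy => mul_le_mul_of_nonneg_left hy (kernel_pos ht x y).le)

lemma heat_const_mul (t c : ℝ) (f : sector N m → ℝ) (x : sector N m) :
    heat N m t (fun y => c * f y) x = c * heat N m t f x := by
  unfold heat
  rw [← integral_const_mul]
  congr 1; funext y; ring

lemma heat_sub {t : ℝ} {x : sector N m} {f g : sector N m → ℝ}
    (hf : Integrable (fun y => kernel N m t x y * f y) (leb N m))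
    (hg : Integrable (fun y => kernel N m t x y * g y) (leb N m)) :
    heat N m t (fun y => f y - g y) x = heat N m t f x - heat N m t g x := by
  unfold heat
  rw [← integral_sub hf hg]
  congr 1; funext y; ring

lemma heat_add {t : ℝ} {x : sector N m} {f g : sector N m → ℝ}
    (hf : Integrable (fun y => kernel N m t x y * f y) (leb N m))
    (hg : Integrable (fun y => kernel N m t x y * g y) (leb N m)) :
    heat N m t (fun y => f y + g y) x = heat N m t f x + heat N m t g x := by
  unfold heat
  rw [← integral_add hf hg]
  congr 1; funext y; ring

/-- If `|f| ≤ g` almost everywhere, then `|e^{tΔ} f| ≤ e^{tΔ} g`. -/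
lemma abs_heat_le {t : ℝ} (ht : 0 < t) {x : sector N m} {f g : sector N m → ℝ}
    (hg : Integrable (fun y => kernel N m t x y * g y) (leb N m))
    (hfg : ∀ᵐ y ∂(leb N m), |f y| ≤ g y) : |heat N m t f x| ≤ heat N m t g x := by
  refine norm_integral_le_of_norm_le (G := ℝ) hg (hfg.mono fun y hy => ?_)
  rw [norm_mul, Real.norm_of_nonneg (kernel_pos ht x y).le]
  exact mul_le_mul_of_nonneg_left hy (kernel_pos ht x y).le

lemma integrable_kernel_mul_of_le {t : ℝ} (ht : 0 < t) {x : sector N m} {f g : sector N m → ℝ}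
    (hf : AEStronglyMeasurable f (leb N m))
    (hg : Integrable (fun y => kernel N m t x y * g y) (leb N m))
    (hfg : ∀ᵐ y ∂(leb N m), |f y| ≤ g y) :
    Integrable (fun y => kernel N m t x y * f y) (leb N m) := by
  refine hg.mono' ((continuous_kernel_right t x).aestronglyMeasurable.mul hf)
    (hfg.mono fun y hy => ?_)
  rw [norm_mul, Real.norm_of_nonneg (kernel_pos ht x y).le]
  exact mul_le_mul_of_nonneg_left hy (kernel_pos ht x y).le

lemma aestronglyMeasurable_heat {t : ℝ} {f : sector N m → ℝ}
    (hf : AEStronglyMeasurable f (leb N m)) : AEStronglyMeasurable (heat N m t f) (leb N m) := by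
  have : AEStronglyMeasurable (fun p : sector N m × sector N m => kernel N m t p.1 p.2 * f p.2)
      ((leb N m).prod (leb N m)) :=
    (measurable_kernel t).aestronglyMeasurable.mul hf.comp_snd
  exact this.integral_prod_right'

/-- The semigroup property. -/
lemma heat_heat {t s : ℝ} (ht : 0 < t) (hs : 0 < s) {x : sector N m} {f : sector N m → ℝ}
    (hf : AEStronglyMeasurable f (leb N m))
    (hi : Integrable (fun y => kernel N m (t + s) x y * f y) (leb N m)) :
    heat N m t (heat N m s f) x = heat N m (t + s) f x := by
  have hprod : Integrable (fun p : sector N m × sector N m =>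
      kernel N m t x p.1 * (kernel N m s p.1 p.2 * f p.2)) ((leb N m).prod (leb N m)) := by
    rw [integrable_prod_iff']
    · refine ⟨Eventually.of_forall fun y => ?_, ?_⟩
      · have := (integrable_kernel_mul_kernel ht hs x y).mul_const (f y)
        simpa only [mul_assoc] using this
      · refine hi.norm.congr (Eventually.of_forall fun y => ?_)
        simp only [norm_mul, Real.norm_of_nonneg (kernel_pos ht _ _).le,
          Real.norm_of_nonneg (kernel_pos hs _ _).le,
          Real.norm_of_nonneg (kernel_pos (add_pos ht hs) _ _).le]
        rw [← integral_kernel_mul_kernel ht hs, ← integral_mul_const]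
        simp only [mul_assoc]
    · have h1 : AEStronglyMeasurable (fun p : sector N m × sector N m => kernel N m t x p.1)
          ((leb N m).prod (leb N m)) :=
        ((continuous_kernel_right t x).measurable.comp measurable_fst).aestronglyMeasurable
      exact h1.mul ((measurable_kernel s).aestronglyMeasurable.mul hf.comp_snd)
  unfold heat
  simp only [← integral_const_mul]
  rw [integral_integral_swap hprod]
  congr 1
  funext y
  rw [← integral_kernel_mul_kernel ht hs, ← integral_mul_const]
  simp only [mul_assoc]

/-! ### Functions dominated by `ψ₀` -/

/-- `ψ` is measurable and `|ψ| ≤ K ψ₀` almost everywhere. -/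
def Dominated (N m : ℕ) (γ K : ℝ) (ψ : sector N m → ℝ) : Prop :=
  AEStronglyMeasurable ψ (leb N m) ∧ ∀ᵐ x ∂(leb N m), |ψ x| ≤ K * psi0 N m γ x

lemma normX_le_iff (hp : Params N m γ) {K : ℝ} (hK : 0 ≤ K) {ψ : sector N m → ℝ} :
    normX N m γ ψ ≤ ENNReal.ofReal K ↔ ∀ᵐ x ∂(leb N m), |ψ x| ≤ K * psi0 N m γ x := by
  have key : ∀ x : sector N m, 0 < psi0 N m γ x →
      (‖ψ x / psi0 N m γ x‖ₑ ≤ ENNReal.ofReal K ↔ |ψ x| ≤ K * psi0 N m γ x) := fun x hx => by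
    rw [← ofReal_norm, ENNReal.ofReal_le_ofReal_iff hK, norm_div, Real.norm_of_nonneg hx.le,
      div_le_iff₀ hx, Real.norm_eq_abs]
  unfold normX
  rw [eLpNorm_exponent_top]
  constructor
  · intro h
    filter_upwards [hp.ae_psi0_pos, ae_le_eLpNormEssSup (f := fun x => ψ x / psi0 N m γ x)
      (μ := leb N m)] with x hx hx'
    exact (key x hx).1 (hx'.trans h)
  · intro h
    refine essSup_le_of_ae_le _ ?_
    filter_upwards [h, hp.ae_psi0_pos] with x hx hx'
    exact (key x hx').2 hx

lemma MemBall.dominated (hp : Params N m γ) {K : ℝ} (hK : 0 ≤ K) {ψ : sector N m → ℝ}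
    (h : MemBall N m γ K ψ) : Dominated N m γ K ψ :=
  ⟨h.1.1.aestronglyMeasurable, (normX_le_iff hp hK).1 h.2⟩

namespace Dominated

variable {K t s : ℝ} {ψ : sector N m → ℝ}

lemma integrable (h : Dominated N m γ K ψ) (hp : Params N m γ) (ht : 0 < t) (x : sector N m) :
    Integrable (fun y => kernel N m t x y * ψ y) (leb N m) := by
  refine integrable_kernel_mul_of_le ht h.1
    (((hp.integrable_kernel_mul_psi0 ht x).const_mul K).congr
    (Eventually.of_forall fun y => ?_)) h.2
  simp only; ring

lemma abs_heat_le (h : Dominated N m γ K ψ) (hp : Params N m γ) (ht : 0 < t) (x : sector N m) :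
    |heat N m t ψ x| ≤ K * Psi N m γ t x := by
  unfold Psi
  rw [← heat_const_mul]
  refine SectorHeat.abs_heat_le ht ?_ h.2
  refine ((hp.integrable_kernel_mul_psi0 ht x).const_mul K).congr (Eventually.of_forall fun y => ?_)
  simp only; ring

lemma heat_heat (h : Dominated N m γ K ψ) (hp : Params N m γ) (ht : 0 < t) (hs : 0 < s)
    (x : sector N m) : heat N m t (heat N m s ψ) x = heat N m (t + s) ψ x :=
  SectorHeat.heat_heat ht hs h.1 (h.integrable hp (add_pos ht hs) x)

lemma nonneg_bound (h : Dominated N m γ K ψ) (hp : Params N m γ) : 0 ≤ K := by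
  have : NeZero (leb N m) := ⟨leb_ne_zero⟩
  obtain ⟨x, hx, hx'⟩ := (h.2.and hp.ae_psi0_pos).exists
  exact nonneg_of_mul_nonneg_left ((abs_nonneg _).trans hx) hx'

lemma mono (h : Dominated N m γ K ψ) (hp : Params N m γ) {K' : ℝ} (hK : K ≤ K') :
    Dominated N m γ K' ψ :=
  ⟨h.1, h.2.mono fun x hx => hx.trans (mul_le_mul_of_nonneg_right hK (hp.psi0_nonneg x))⟩

lemma neg (h : Dominated N m γ K ψ) : Dominated N m γ K (fun x => -ψ x) :=
  ⟨h.1.neg, h.2.mono fun x hx => by rwa [abs_neg]⟩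

lemma sub (h : Dominated N m γ K ψ) {K' : ℝ} {φ : sector N m → ℝ} (h' : Dominated N m γ K' φ) :
    Dominated N m γ (K + K') (fun x => ψ x - φ x) := by
  refine ⟨h.1.sub h'.1, ?_⟩
  filter_upwards [h.2, h'.2] with x hx hx'
  rw [add_mul]
  exact (abs_sub _ _).trans (add_le_add hx hx')

end Dominated

lemma Params.dominated_psi0 (hp : Params N m γ) : Dominated N m γ 1 (psi0 N m γ) :=
  ⟨measurable_psi0.aestronglyMeasurable, Eventually.of_forall fun x => by
    rw [abs_of_nonneg (hp.psi0_nonneg x), one_mul]⟩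

lemma Params.heat_Psi (hp : Params N m γ) {t s : ℝ} (ht : 0 < t) (hs : 0 < s) (x : sector N m) :
    heat N m t (Psi N m γ s) x = Psi N m γ (t + s) x :=
  hp.dominated_psi0.heat_heat hp ht hs x

lemma Params.aestronglyMeasurable_Psi (s : ℝ) :
    AEStronglyMeasurable (Psi N m γ s) (leb N m) :=
  aestronglyMeasurable_heat measurable_psi0.aestronglyMeasurable

lemma Params.integrable_kernel_mul_Psi (hp : Params N m γ) {t s : ℝ} (ht : 0 < t) (hs : 0 < s)
    (x : sector N m) : Integrable (fun y => kernel N m t x y * Psi N m γ s y) (leb N m) := by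
  obtain ⟨C, hC, h⟩ := hp.Psi_le_rpow
  refine integrable_kernel_mul_of_bdd (B := C * s ^ (-((γ + m) / 2))) ht x
    (aestronglyMeasurable_Psi s) (Eventually.of_forall fun y => ?_)
  rw [abs_of_pos (hp.Psi_pos hs y)]
  exact h s hs y

lemma Params.abs_heat_le_Psi (hp : Params N m γ) {t s c : ℝ} (ht : 0 < t) (hs : 0 < s)
    {f : sector N m → ℝ} (hf : ∀ᵐ y ∂(leb N m), |f y| ≤ c * Psi N m γ s y) (x : sector N m) :
    |heat N m t f x| ≤ c * Psi N m γ (t + s) x := by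
  rw [← hp.heat_Psi ht hs, ← heat_const_mul]
  refine SectorHeat.abs_heat_le ht ?_ hf
  refine ((hp.integrable_kernel_mul_Psi ht hs x).const_mul c).congr
    (Eventually.of_forall fun y => ?_)
  simp only; ring

/-! ### Continuity of the semigroup -/

lemma continuousAt_kernel {t : ℝ} (ht : 0 < t) (x y : sector N m) :
    ContinuousAt (fun p : ℝ × sector N m => kernel N m p.1 p.2 y) (t, x) := by
  have h4 : (4 : ℝ) * t ≠ 0 := by positivity
  have hp : 4 * Real.pi * t ≠ 0 := by positivity
  have h1 : ∀ i, ContinuousAt (fun p : ℝ × sector N m =>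
      Real.exp (-|p.2.1 i - y.1 i| ^ 2 / (4 * p.1))) (t, x) := fun i =>
    ContinuousAt.rexp (ContinuousAt.div (by fun_prop) (by fun_prop) h4)
  have h2 : ∀ i, ContinuousAt (fun p : ℝ × sector N m =>
      Real.exp (-|p.2.1 i + y.1 i| ^ 2 / (4 * p.1))) (t, x) := fun i =>
    ContinuousAt.rexp (ContinuousAt.div (by fun_prop) (by fun_prop) h4)
  unfold kernel
  refine (ContinuousAt.mul ?_ ?_).mul ?_
  · exact ContinuousAt.rpow_const (by fun_prop) (Or.inl hp)
  · exact tendsto_finsetProd _ fun i _ => h1 i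
  · exact tendsto_finsetProd _ fun i _ => (h1 i).sub (h2 i)

/-- Locally in `(t, x)`, the kernel is dominated by a fixed Gaussian. -/
lemma kernel_le_of_near {t₀ : ℝ} (ht₀ : 0 < t₀) {t : ℝ} (h1 : t₀ / 2 ≤ t) (h2 : t ≤ 2 * t₀)
    {x₀ x : sector N m} (hx : dist x x₀ ≤ 1) (y : sector N m) :
    kernel N m t x y ≤ (2 * Real.pi * t₀) ^ (-(N : ℝ) / 2) * Real.exp (1 / (8 * t₀)) *
      Real.exp (-‖x₀.1 - y.1‖ ^ 2 / (16 * t₀)) := by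
  have ht : 0 < t := by linarith
  have hxx : ‖x.1 - x₀.1‖ ≤ 1 := by
    rw [← dist_eq_norm]; exact hx
  have htri : ‖x₀.1 - y.1‖ ^ 2 ≤ 2 + 2 * ‖x.1 - y.1‖ ^ 2 := by
    have h3 : ‖x₀.1 - y.1‖ ≤ ‖x.1 - x₀.1‖ + ‖x.1 - y.1‖ := by
      have := norm_sub_le (x.1 - y.1) (x.1 - x₀.1)
      rw [show x.1 - y.1 - (x.1 - x₀.1) = x₀.1 - y.1 by abel] at this
      linarith
    nlinarith [norm_nonneg (x₀.1 - y.1), norm_nonneg (x.1 - y.1), norm_nonneg (x.1 - x₀.1),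
      sq_nonneg (1 - ‖x.1 - y.1‖)]
  refine (kernel_le ht x y).trans ?_
  rw [mul_assoc _ (Real.exp _), ← Real.exp_add]
  gcongr ?_ * ?_
  · refine Real.rpow_le_rpow_of_nonpos (by positivity) ?_ ?_
    · nlinarith [Real.pi_pos]
    · have : (0 : ℝ) ≤ N := by positivity
      linarith
  · refine Real.exp_le_exp.2 ?_
    have h5 : ‖x.1 - y.1‖ ^ 2 / (8 * t₀) ≤ ‖x.1 - y.1‖ ^ 2 / (4 * t) :=
      div_le_div_of_nonneg_left (sq_nonneg _) (by positivity) (by linarith)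
    have h6 : ‖x₀.1 - y.1‖ ^ 2 / (16 * t₀) ≤ (2 + 2 * ‖x.1 - y.1‖ ^ 2) / (16 * t₀) := by
      gcongr
    have h7 : (2 + 2 * ‖x.1 - y.1‖ ^ 2) / (16 * t₀) = 1 / (8 * t₀) + ‖x.1 - y.1‖ ^ 2 / (8 * t₀) := by
      field_simp; ring
    rw [neg_div, neg_div]
    linarith

/-- Continuity of `(t, x, f) ↦ e^{tΔ} f (x)` under bounded pointwise convergence of `f`. -/
lemma tendsto_heat {ι : Type*} {l : Filter ι} [l.IsCountablyGenerated] {τ : ι → ℝ} {τ₀ : ℝ}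
    (hτ₀ : 0 < τ₀) (hτ : Tendsto τ l (𝓝 τ₀)) {x : ι → sector N m} {x₀ : sector N m}
    (hx : Tendsto x l (𝓝 x₀)) {f : ι → sector N m → ℝ} {f₀ : sector N m → ℝ} {B : ℝ}
    (hmeas : ∀ᶠ i in l, AEStronglyMeasurable (f i) (leb N m))
    (hB : ∀ᶠ i in l, ∀ᵐ y ∂(leb N m), |f i y| ≤ B)
    (hf : ∀ᵐ y ∂(leb N m), Tendsto (fun i => f i y) l (𝓝 (f₀ y))) :
    Tendsto (fun i => heat N m (τ i) (f i) (x i)) l (𝓝 (heat N m τ₀ f₀ x₀)) := by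
  have h1 : ∀ᶠ i in l, τ₀ / 2 ≤ τ i := hτ.eventually (eventually_ge_nhds (by linarith))
  have h2 : ∀ᶠ i in l, τ i ≤ 2 * τ₀ := hτ.eventually (eventually_le_nhds (by linarith))
  have h3 : ∀ᶠ i in l, dist (x i) x₀ ≤ 1 := hx.eventually (Metric.closedBall_mem_nhds x₀ one_pos)
  refine tendsto_integral_filter_of_dominated_convergence
    (fun y => (2 * Real.pi * τ₀) ^ (-(N : ℝ) / 2) * Real.exp (1 / (8 * τ₀)) *
      Real.exp (-‖x₀.1 - y.1‖ ^ 2 / (16 * τ₀)) * B) ?_ ?_ ?_ ?_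
  · filter_upwards [hmeas] with i hi
    exact (continuous_kernel_right _ _).aestronglyMeasurable.mul hi
  · filter_upwards [h1, h2, h3, hB] with i h1 h2 h3 hB
    filter_upwards [hB] with y hy
    rw [norm_mul, Real.norm_of_nonneg (kernel_pos (by linarith) _ _).le]
    have := kernel_le_of_near hτ₀ h1 h2 h3 y
    gcongr
    exact hy
  · refine Integrable.mul_const (Integrable.const_mul ?_ _) _
    have h16 : (0 : ℝ) < 4 * τ₀ := by positivity
    have := (integrable_prod_gauss (N := N) (m := m) h16 x₀.1)
    simp only [prod_gauss h16] at this
    have h := this.const_mul ((4 * Real.pi * (4 * τ₀)) ^ (-(N : ℝ) / 2))⁻¹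
    refine h.congr (Eventually.of_forall fun y => ?_)
    have hne : (4 * Real.pi * (4 * τ₀)) ^ (-(N : ℝ) / 2) ≠ 0 := by positivity
    simp only
    rw [← mul_assoc, inv_mul_cancel₀ hne, one_mul]
    congr 2; ring
  · filter_upwards [hf] with y hy
    have := (continuousAt_kernel hτ₀ x₀ y).tendsto.comp (hτ.prodMk_nhds hx)
    exact this.mul hy

lemma Dominated.tendsto_heat {K : ℝ} {ψ : sector N m → ℝ} (h : Dominated N m γ K ψ)
    (hp : Params N m γ) {t : ℝ} (ht : 0 < t) (x : sector N m) :
    ContinuousAt (fun p : ℝ × sector N m => heat N m p.1 ψ p.2) (t, x) := by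
  obtain ⟨C, hC, hb⟩ := hp.Psi_le_rpow
  have ht2 : 0 < t / 2 := by positivity
  have hK := h.nonneg_bound hp
  have key : Tendsto (fun p : ℝ × sector N m => heat N m (p.1 - t / 2) (heat N m (t / 2) ψ) p.2)
      (𝓝 (t, x)) (𝓝 (heat N m (t / 2) (heat N m (t / 2) ψ) x)) := by
    refine SectorHeat.tendsto_heat (B := K * (C * (t / 2) ^ (-((γ + m) / 2)))) ht2 ?_
      continuous_snd.continuousAt
      (Eventually.of_forall fun _ => aestronglyMeasurable_heat h.1)
      (Eventually.of_forall fun _ => Eventually.of_forall fun y =>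
        (h.abs_heat_le hp ht2 y).trans (by gcongr; exact hb _ ht2 y))
      (Eventually.of_forall fun y => tendsto_const_nhds)
    have : ContinuousAt (fun p : ℝ × sector N m => p.1 - t / 2) (t, x) := by fun_prop
    simpa [ContinuousAt, sub_half] using this
  unfold ContinuousAt
  have e : heat N m (t / 2) (heat N m (t / 2) ψ) x = heat N m t ψ x := by
    rw [h.heat_heat hp ht2 ht2, add_halves]
  simp only [e] at key
  refine key.congr' ?_
  have : ∀ᶠ p : ℝ × sector N m in 𝓝 (t, x), t / 2 < p.1 :=
    continuous_fst.continuousAt.eventually (lt_mem_nhds (by simpa using ht2))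
  filter_upwards [this] with p hp'
  rw [h.heat_heat hp (by linarith) ht2, sub_add_cancel]

lemma Dominated.continuous_heat {K : ℝ} {ψ : sector N m → ℝ} (h : Dominated N m γ K ψ)
    (hp : Params N m γ) {t : ℝ} (ht : 0 < t) : Continuous (heat N m t ψ) := by
  refine continuous_iff_continuousAt.2 fun x => ?_
  have h1 : ContinuousAt (fun x : sector N m => (t, x)) x := by fun_prop
  exact ContinuousAt.comp (f := fun x : sector N m => (t, x))
    (g := fun p : ℝ × sector N m => heat N m p.1 ψ p.2) (h.tendsto_heat hp ht x) h1

/-! ### Convergence in `C₀(Ω)` -/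

lemma isCompact_coordProd_norm {δ R : ℝ} (hδ : 0 < δ) :
    IsCompact {x : sector N m | δ ≤ coordProd x ∧ ‖x.1‖ ≤ R} := by
  rw [Subtype.isCompact_iff]
  have himg : (Subtype.val '' {x : sector N m | δ ≤ coordProd x ∧ ‖x.1‖ ≤ R})
      = {x : EuclideanSpace ℝ (Fin N) | (∀ i : Fin N, (i : ℕ) < m → 0 ≤ x i) ∧
        δ ≤ ∏ i ∈ Finset.univ.filter (fun k : Fin N => k.val < m), x i} ∩
        Metric.closedBall 0 R := by
    ext x
    constructor
    · rintro ⟨y, ⟨h1, h2⟩, rfl⟩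
      exact ⟨⟨fun i hi => (y.2 i hi).le, h1⟩, mem_closedBall_zero_iff.2 h2⟩
    · rintro ⟨⟨h1, h2⟩, h3⟩
      refine ⟨⟨x, fun i hi => lt_of_le_of_ne (h1 i hi) fun h => ?_⟩,
        ⟨h2, mem_closedBall_zero_iff.1 h3⟩, rfl⟩
      rw [Finset.prod_eq_zero (Finset.mem_filter.2 ⟨Finset.mem_univ i, hi⟩) h.symm] at h2
      linarith
  rw [himg]
  refine (isCompact_closedBall _ _).inter_left ?_
  have : {x : EuclideanSpace ℝ (Fin N) | (∀ i : Fin N, (i : ℕ) < m → 0 ≤ x i) ∧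
        δ ≤ ∏ i ∈ Finset.univ.filter (fun k : Fin N => k.val < m), x i}
      = (⋂ i : Fin N, ⋂ _ : (i : ℕ) < m, {x : EuclideanSpace ℝ (Fin N) | 0 ≤ x i}) ∩
        {x | δ ≤ ∏ i ∈ Finset.univ.filter (fun k : Fin N => k.val < m), x i} := by
    ext x; simp
  rw [this]
  exact (isClosed_iInter fun i => isClosed_iInter fun _ =>
    isClosed_le continuous_const (by fun_prop)).inter (isClosed_le continuous_const (by fun_prop))

lemma Params.Psi_lt_outside_compact (hp : Params N m γ) {t₀ ε : ℝ} (ht₀ : 0 < t₀) (hε : 0 < ε) :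
    ∃ B : Set (sector N m), IsCompact B ∧ ∀ t, t₀ ≤ t → ∀ x ∉ B, Psi N m γ t x < ε := by
  obtain ⟨C₁, hC₁, h₁⟩ := hp.Psi_le_coordProd
  obtain ⟨C₂, hC₂, h₂⟩ := hp.Psi_le_psi0
  have hc := hp.psiConst_pos
  have hγm : 0 < γ + m := by have := hp.hγ; positivity
  have hlim : Tendsto (fun R : ℝ => C₂ * (psiConst m γ * R ^ (-(γ + m)))) atTop (𝓝 0) := by
    have := ((tendsto_rpow_neg_atTop hγm).const_mul (psiConst m γ)).const_mul C₂
    simpa using this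
  obtain ⟨R, hR, hR0⟩ := ((hlim.eventually (gt_mem_nhds hε)).and (eventually_gt_atTop 0)).exists
  have hA : 0 < C₁ * t₀ ^ (-(γ / 2 + m)) := by positivity
  refine ⟨_, isCompact_coordProd_norm (δ := ε / (C₁ * t₀ ^ (-(γ / 2 + m)))) (R := R)
    (by positivity), fun t ht x hx => ?_⟩
  have ht0 : 0 < t := ht₀.trans_le ht
  have hxp := coordProd_pos x
  rcases lt_or_ge (coordProd x) (ε / (C₁ * t₀ ^ (-(γ / 2 + m)))) with h | h
  · calc Psi N m γ t x ≤ C₁ * t ^ (-(γ / 2 + m)) * coordProd x := h₁ t ht0 x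
      _ ≤ C₁ * t₀ ^ (-(γ / 2 + m)) * coordProd x := by
          have := Real.rpow_le_rpow_of_nonpos ht₀ ht
            (show -(γ / 2 + (m : ℝ)) ≤ 0 by linarith [hp.exponent_pos])
          gcongr
      _ < ε := by
          rw [lt_div_iff₀ hA] at h
          linarith
  · have hxR : R < ‖x.1‖ := by
      by_contra h'
      exact hx ⟨h, not_lt.1 h'⟩
    have hx0 : x.1 ≠ 0 := norm_pos_iff.1 (hR0.trans hxR)
    calc Psi N m γ t x ≤ C₂ * (psiConst m γ * ‖x.1‖ ^ (-(γ + m))) :=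
          (h₂ t ht0 x hx0).trans (by gcongr; exact hp.psi0_le_rpow hx0)
      _ ≤ C₂ * (psiConst m γ * R ^ (-(γ + m))) := by
          have := Real.rpow_le_rpow_of_nonpos hR0 hxR.le (show -(γ + (m : ℝ)) ≤ 0 by linarith)
          gcongr
      _ < ε := hR

lemma Params.tendsto_zero_cocompact (hp : Params N m γ) {t M : ℝ} (ht : 0 < t)
    {f : sector N m → ℝ} (hf : ∀ x, |f x| ≤ M * Psi N m γ t x) :
    Tendsto f (cocompact (sector N m)) (𝓝 0) := by
  rw [Metric.tendsto_nhds]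
  intro ε hε
  obtain ⟨B, hB, h⟩ := hp.Psi_lt_outside_compact ht (show 0 < ε / (|M| + 1) by positivity)
  filter_upwards [hB.compl_mem_cocompact] with x hx
  have h1 := h t le_rfl x hx
  have h2 := hp.Psi_pos ht x
  rw [lt_div_iff₀ (by positivity)] at h1
  rw [dist_zero_right, Real.norm_eq_abs]
  calc |f x| ≤ M * Psi N m γ t x := hf x
    _ ≤ (|M| + 1) * Psi N m γ t x := by gcongr; linarith [le_abs_self M]
    _ < ε := by linarith

open Classical in
/-- The element of `C₀(Ω)` with the same values as `f`, if there is one. -/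
def toC0 (f : sector N m → ℝ) : C₀(sector N m, ℝ) :=
  if h : Continuous f ∧ Tendsto f (cocompact (sector N m)) (𝓝 0) then ⟨⟨f, h.1⟩, h.2⟩ else 0

lemma toC0_apply {f : sector N m → ℝ} (h : Continuous f)
    (h' : Tendsto f (cocompact (sector N m)) (𝓝 0)) (x : sector N m) : toC0 f x = f x := by
  unfold toC0
  rw [dif_pos ⟨h, h'⟩]
  rfl

/-- Continuous convergence together with uniform smallness outside of compact sets gives uniform
convergence. -/
lemma tendstoUniformlyOn_of_continuous_convergence {ι Z : Type*} [TopologicalSpace Z]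
    {l : Filter ι} {F : ι → Z → ℝ} {f : Z → ℝ} {A : Set Z}
    (hconv : ∀ z ∈ A, Tendsto (fun q : ι × Z => F q.1 q.2) (l ×ˢ 𝓝[A] z) (𝓝 (f z)))
    (hf : ContinuousOn f A)
    (hsmall : ∀ ε > 0, ∃ B ⊆ A, IsCompact B ∧ (∀ᶠ i in l, ∀ z ∈ A \ B, |F i z| < ε) ∧
      ∀ z ∈ A \ B, |f z| < ε) : TendstoUniformlyOn F f l A := by
  rw [Metric.tendstoUniformlyOn_iff]
  intro ε hε
  obtain ⟨B, hBA, hB, h1, h2⟩ := hsmall (ε / 2) (by positivity)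
  have hloc : TendstoLocallyUniformlyOn F f l B := by
    rw [tendstoLocallyUniformlyOn_iff_filter]
    intro z hz
    rw [tendstoUniformlyOnFilter_iff_tendsto]
    have hle : 𝓝[B] z ≤ 𝓝[A] z := nhdsWithin_mono z hBA
    have t1 : Tendsto (fun q : ι × Z => f q.2) (l ×ˢ 𝓝[B] z) (𝓝 (f z)) :=
      ((hf z (hBA hz)).mono_left hle).comp tendsto_snd
    have t2 : Tendsto (fun q : ι × Z => F q.1 q.2) (l ×ˢ 𝓝[B] z) (𝓝 (f z)) :=
      (hconv z (hBA hz)).mono_left (prod_mono le_rfl hle)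
    exact (t1.prodMk_nhds t2).mono_right (nhds_le_uniformity _)
  rw [tendstoLocallyUniformlyOn_iff_tendstoUniformlyOn_of_compact hB,
    Metric.tendstoUniformlyOn_iff] at hloc
  filter_upwards [h1, hloc ε hε] with i hi1 hi2 z hz
  by_cases hzB : z ∈ B
  · exact hi2 z hzB
  · have a1 := hi1 z ⟨hz, hzB⟩
    have a2 := h2 z ⟨hz, hzB⟩
    rw [Real.dist_eq]
    calc |f z - F i z| ≤ |f z| + |F i z| := abs_sub _ _
      _ < ε := by linarith

lemma tendsto_zeroAtInfty_iff {ι : Type*} {l : Filter ι} {U : ι → C₀(sector N m, ℝ)}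
    {u : C₀(sector N m, ℝ)} :
    Tendsto U l (𝓝 u) ↔ TendstoUniformlyOn (fun i x => U i x) u l univ := by
  rw [tendstoUniformlyOn_univ]
  exact ZeroAtInftyContinuousMap.tendsto_iff_tendstoUniformly

/-- A jointly continuous function of `(t, x)` which is locally in `t` dominated by `Ψ` defines a
continuous curve in `C₀(Ω)`. -/
lemma Params.continuousOn_C0 (hp : Params N m γ) {S : Set ℝ} {F : ℝ → sector N m → ℝ}
    (hF : ContinuousOn (fun p : ℝ × sector N m => F p.1 p.2) (S ×ˢ univ))
    {U : ℝ → C₀(sector N m, ℝ)} (hU : ∀ t ∈ S, ∀ x, U t x = F t x) {τ : ℝ → ℝ}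
    (hmaj : ∀ t₀ ∈ S, ∃ M s, 0 < s ∧ ∀ᶠ t in 𝓝[S] t₀, s ≤ τ t ∧
      ∀ x, |F t x| ≤ M * Psi N m γ (τ t) x) : ContinuousOn U S := by
  intro t₀ ht₀
  unfold ContinuousWithinAt
  rw [tendsto_zeroAtInfty_iff]
  refine tendstoUniformlyOn_of_continuous_convergence (fun x _ => ?_)
    (map_continuous (U t₀)).continuousOn fun ε hε => ?_
  · rw [hU t₀ ht₀ x, nhdsWithin_univ]
    have h1 := hF (t₀, x) ⟨ht₀, mem_univ _⟩
    rw [ContinuousWithinAt, nhdsWithin_prod_eq, nhdsWithin_univ] at h1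
    refine h1.congr' ?_
    have : ∀ᶠ q : ℝ × sector N m in 𝓝[S] t₀ ×ˢ 𝓝 x, q.1 ∈ S :=
      tendsto_fst.eventually self_mem_nhdsWithin
    filter_upwards [this] with q hq
    exact (hU q.1 hq q.2).symm
  · obtain ⟨M, s, hs, hM⟩ := hmaj t₀ ht₀
    obtain ⟨B, hB, h⟩ := hp.Psi_lt_outside_compact hs (show 0 < ε / (|M| + 1) by positivity)
    have key : ∀ t ∈ S, (s ≤ τ t ∧ ∀ x, |F t x| ≤ M * Psi N m γ (τ t) x) →
        ∀ z ∈ univ \ B, |U t z| < ε := fun t ht hM z hz => by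
      have h1 := h _ hM.1 z hz.2
      have h2 := hp.Psi_pos (hs.trans_le hM.1) z
      rw [lt_div_iff₀ (by positivity)] at h1
      rw [hU t ht]
      calc |F t z| ≤ M * Psi N m γ (τ t) z := hM.2 z
        _ ≤ (|M| + 1) * Psi N m γ (τ t) z := by gcongr; linarith [le_abs_self M]
        _ < ε := by linarith
    refine ⟨B, subset_univ _, hB, ?_, key t₀ ht₀ (hM.self_of_nhdsWithin ht₀)⟩
    filter_upwards [hM, self_mem_nhdsWithin] with t h1 h2
    exact key t h2 h1

lemma continuousOn_uncurry_C0 {S : Set ℝ} {U : ℝ → C₀(sector N m, ℝ)} (hU : ContinuousOn U S) :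
    ContinuousOn (fun p : ℝ × sector N m => U p.1 p.2) (S ×ˢ univ) := by
  have h1 : ContinuousOn (fun t => (U t).toBCF) S :=
    (ZeroAtInftyContinuousMap.isometry_toBCF.continuous).comp_continuousOn hU
  have h2 : ContinuousOn (fun p : ℝ × sector N m => ((U p.1).toBCF, p.2)) (S ×ˢ univ) :=
    (h1.comp continuousOn_fst fun p hp => hp.1).prodMk continuousOn_snd
  exact (ContinuousEval.continuous_eval
    (F := BoundedContinuousFunction (sector N m) ℝ)).comp_continuousOn h2

end

end SectorHeat

namespace SectorHeat

noncomputable section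

variable {N m : ℕ} {γ : ℝ}

/-! ### The Duhamel integral -/

/-- The Duhamel integral `∫_0^t e^{(t-σ)Δ} f(σ) dσ`. -/
def duhamel (f : ℝ → sector N m → ℝ) (t : ℝ) (x : sector N m) : ℝ :=
  ∫ σ in (0 : ℝ)..t, heat N m (t - σ) (f σ) x

/-- A source term: jointly continuous on `(0, T] × Ω` and bounded by `A σ^{-β} Ψ(σ)`. -/
structure Source (N m : ℕ) (γ T A β : ℝ) (f : ℝ → sector N m → ℝ) : Prop where
  cont : ContinuousOn (fun p : ℝ × sector N m => f p.1 p.2) (Ioc 0 T ×ˢ univ)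
  bound : ∀ σ ∈ Ioc 0 T, ∀ y, |f σ y| ≤ A * σ ^ (-β) * Psi N m γ σ y

namespace Source

variable {T A β : ℝ} {f : ℝ → sector N m → ℝ}

lemma continuous (hf : Source N m γ T A β f) {σ : ℝ} (hσ : σ ∈ Ioc 0 T) : Continuous (f σ) := by
  have h : ContinuousOn (fun x : sector N m => (σ, x)) univ := by fun_prop
  have := hf.cont.comp (t := Ioc 0 T ×ˢ univ) h fun x _ => ⟨hσ, mem_univ _⟩
  exact continuousOn_univ.1 this

lemma nonneg_const (hf : Source N m γ T A β f) (hp : Params N m γ) (hT : 0 < T) : 0 ≤ A := by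
  obtain ⟨x⟩ := (inferInstance : Nonempty (sector N m))
  have h := (abs_nonneg _).trans (hf.bound T ⟨hT, le_rfl⟩ x)
  have h1 := hp.Psi_pos hT x
  have h2 : 0 < T ^ (-β) := by positivity
  exact nonneg_of_mul_nonneg_left (nonneg_of_mul_nonneg_left h h1) h2

lemma exists_bdd (hp : Params N m γ) (T A : ℝ) (hβ : 0 ≤ β) {s : ℝ} (hs : 0 < s) :
    ∃ B, ∀ f, Source N m γ T A β f → ∀ σ ∈ Ioc 0 T, s ≤ σ → ∀ y, |f σ y| ≤ B := by
  obtain ⟨C, hC, h⟩ := hp.Psi_le_rpow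
  refine ⟨A * s ^ (-β) * (C * s ^ (-((γ + m) / 2))), fun f hf σ hσ hsσ y => ?_⟩
  have hA := hf.nonneg_const hp (hσ.1.trans_le hσ.2)
  have hγm : 0 ≤ (γ + m) / 2 := by have := hp.hγ; positivity
  have hΨ := hp.Psi_pos hσ.1 y
  refine (hf.bound σ hσ y).trans ?_
  have h1 := Real.rpow_le_rpow_of_nonpos hs hsσ (neg_nonpos.2 hβ)
  have h2 := Real.rpow_le_rpow_of_nonpos hs hsσ (neg_nonpos.2 hγm)
  have h3 := h σ hσ.1 y
  gcongr
  exact h3.trans (by gcongr)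

lemma integrable (hf : Source N m γ T A β f) (hp : Params N m γ) {t σ : ℝ}
    (hσ : σ ∈ Ioc 0 T) (ht : 0 < t) (x : sector N m) :
    Integrable (fun y => kernel N m t x y * f σ y) (leb N m) := by
  refine integrable_kernel_mul_of_le ht (hf.continuous hσ).aestronglyMeasurable
    (((hp.integrable_kernel_mul_Psi ht hσ.1 x).const_mul (A * σ ^ (-β))).congr
      (Eventually.of_forall fun y => ?_)) (Eventually.of_forall (hf.bound σ hσ))
  simp only; ring

lemma abs_heat_le (hf : Source N m γ T A β f) (hp : Params N m γ) {t σ : ℝ}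
    (hσ : 0 < σ) (hσt : σ < t) (ht : t ≤ T) (x : sector N m) :
    |heat N m (t - σ) (f σ) x| ≤ A * σ ^ (-β) * Psi N m γ t x := by
  have := hp.abs_heat_le_Psi (sub_pos.2 hσt) hσ
    (Eventually.of_forall (hf.bound σ ⟨hσ, (hσt.trans_le ht).le⟩)) x
  rwa [sub_add_cancel] at this

lemma continuousOn_heat (hf : Source N m γ T A β f) (hp : Params N m γ) (hβ : 0 ≤ β) {t : ℝ}
    (ht : t ≤ T) : ContinuousOn (fun p : ℝ × sector N m => heat N m (t - p.1) (f p.1) p.2)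
      (Ioo 0 t ×ˢ univ) := by
  rintro ⟨σ, x⟩ ⟨hσ, -⟩
  have hσ1 : 0 < σ := hσ.1
  have hσ2 : σ < t := hσ.2
  obtain ⟨B, hB⟩ := exists_bdd hp T A hβ (half_pos hσ1)
  have hmem : ∀ᶠ p : ℝ × sector N m in 𝓝[Ioo 0 t ×ˢ univ] (σ, x), p.1 ∈ Ioc 0 T := by
    filter_upwards [self_mem_nhdsWithin] with p hp
    exact ⟨hp.1.1, hp.1.2.le.trans ht⟩
  have hge : ∀ᶠ p : ℝ × sector N m in 𝓝[Ioo 0 t ×ˢ univ] (σ, x), σ / 2 ≤ p.1 := by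
    refine nhdsWithin_le_nhds (continuous_fst.continuousAt.eventually (le_mem_nhds ?_))
    simpa using hσ1
  refine tendsto_heat (B := B) (sub_pos.2 hσ2) ?_ ?_ ?_ ?_ (Eventually.of_forall fun y => ?_)
  · have : ContinuousAt (fun p : ℝ × sector N m => t - p.1) (σ, x) := by fun_prop
    exact this.tendsto.mono_left nhdsWithin_le_nhds
  · exact continuous_snd.continuousAt.tendsto.mono_left nhdsWithin_le_nhds
  · filter_upwards [hmem] with p hp'
    exact (hf.continuous hp').aestronglyMeasurable
  · filter_upwards [hmem, hge] with p h1 h2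
    exact Eventually.of_forall (hB f hf p.1 h1 h2)
  · have h1 : ContinuousOn (fun p : ℝ × sector N m => f p.1 y) (Ioo 0 t ×ˢ univ) := by
      refine hf.cont.comp (t := Ioc 0 T ×ˢ univ) (f := fun p : ℝ × sector N m => (p.1, y))
        (by fun_prop) ?_
      rintro p ⟨hp', -⟩
      exact ⟨⟨hp'.1, hp'.2.le.trans ht⟩, mem_univ _⟩
    exact h1 (σ, x) ⟨hσ, mem_univ _⟩

lemma continuousOn_heat_left (hf : Source N m γ T A β f) (hp : Params N m γ) (hβ : 0 ≤ β) {t : ℝ}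
    (ht : t ≤ T) (x : sector N m) :
    ContinuousOn (fun σ => heat N m (t - σ) (f σ) x) (Ioo 0 t) :=
  (hf.continuousOn_heat hp hβ ht).comp (f := fun σ : ℝ => (σ, x)) (by fun_prop)
    fun _ hσ => ⟨hσ, mem_univ _⟩

lemma integrableOn_heat (hf : Source N m γ T A β f) (hp : Params N m γ) (hβ : 0 ≤ β) (hβ1 : β < 1)
    {t : ℝ} (ht0 : 0 < t) (ht : t ≤ T) (x : sector N m) :
    IntegrableOn (fun σ => heat N m (t - σ) (f σ) x) (Ioo 0 t) := by
  have h1 : IntegrableOn (fun σ : ℝ => A * σ ^ (-β) * Psi N m γ t x) (Ioo 0 t) := by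
    have : IntervalIntegrable (fun σ : ℝ => σ ^ (-β)) volume 0 t :=
      intervalIntegral.intervalIntegrable_rpow' (by linarith)
    exact (((intervalIntegrable_iff_integrableOn_Ioo_of_le ht0.le).1 this).const_mul A).mul_const _
  refine h1.mono' ((hf.continuousOn_heat_left hp hβ ht x).aestronglyMeasurable measurableSet_Ioo)
    ((ae_restrict_mem measurableSet_Ioo).mono fun σ hσ => ?_)
  exact hf.abs_heat_le hp hσ.1 hσ.2 ht x

lemma intervalIntegrable_heat (hf : Source N m γ T A β f) (hp : Params N m γ) (hβ : 0 ≤ β)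
    (hβ1 : β < 1) {t : ℝ} (ht0 : 0 < t) (ht : t ≤ T) (x : sector N m) :
    IntervalIntegrable (fun σ => heat N m (t - σ) (f σ) x) volume 0 t :=
  (intervalIntegrable_iff_integrableOn_Ioo_of_le ht0.le).2
    (hf.integrableOn_heat hp hβ hβ1 ht0 ht x)

end Source

lemma duhamel_eq_setIntegral (f : ℝ → sector N m → ℝ) {t : ℝ} (ht : 0 < t) (x : sector N m) :
    duhamel f t x = ∫ σ in Ioo 0 t, heat N m (t - σ) (f σ) x := by
  unfold duhamel
  rw [intervalIntegral.integral_of_le ht.le, integral_Ioc_eq_integral_Ioo]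

lemma duhamel_eq_indicator (f : ℝ → sector N m → ℝ) {t T : ℝ} (ht : 0 < t) (htT : t ≤ T)
    (x : sector N m) :
    duhamel f t x
      = ∫ σ in Ioc 0 T, (Iio t).indicator (fun σ => heat N m (t - σ) (f σ) x) σ := by
  rw [duhamel_eq_setIntegral f ht, setIntegral_indicator measurableSet_Iio]
  congr 2
  ext σ
  simp only [mem_Ioo, mem_inter_iff, mem_Ioc, mem_Iio]
  constructor
  · rintro ⟨h1, h2⟩
    exact ⟨⟨h1, by linarith⟩, h2⟩
  · rintro ⟨⟨h1, -⟩, h2⟩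
    exact ⟨h1, h2⟩

/-- Continuity of `(t, x, f) ↦ ∫_0^t e^{(t-σ)Δ} f(σ) (x) dσ` under pointwise convergence of
uniformly bounded source terms. -/
lemma tendsto_duhamel (hp : Params N m γ) {T A β : ℝ} (hβ : 0 ≤ β) (hβ1 : β < 1)
    {ι : Type*} {l : Filter ι} [l.IsCountablyGenerated] {τ : ι → ℝ} {t₀ : ℝ} (ht₀ : 0 < t₀)
    (ht₀T : t₀ ≤ T) (hτ : Tendsto τ l (𝓝 t₀)) (hτT : ∀ᶠ i in l, τ i ≤ T)
    {x : ι → sector N m} {x₀ : sector N m} (hx : Tendsto x l (𝓝 x₀))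
    {F : ι → ℝ → sector N m → ℝ} {f₀ : ℝ → sector N m → ℝ}
    (hF : ∀ i, Source N m γ T A β (F i))
    (hconv : ∀ σ ∈ Ioc 0 T, ∀ y, Tendsto (fun i => F i σ y) l (𝓝 (f₀ σ y))) :
    Tendsto (fun i => duhamel (F i) (τ i) (x i)) l (𝓝 (duhamel f₀ t₀ x₀)) := by
  have hpos : ∀ᶠ i in l, t₀ / 2 ≤ τ i := hτ.eventually (le_mem_nhds (by linarith))
  obtain ⟨C, hC, hCb⟩ := hp.Psi_le_rpow
  have hγm : 0 ≤ (γ + m) / 2 := by have := hp.hγ; positivity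
  rw [duhamel_eq_indicator f₀ ht₀ ht₀T x₀]
  refine Tendsto.congr' (f₁ := fun i => ∫ σ in Ioc 0 T, (Iio (τ i)).indicator
    (fun σ => heat N m (τ i - σ) (F i σ) (x i)) σ) ?_ ?_
  · filter_upwards [hpos, hτT] with i h1 h2
    exact (duhamel_eq_indicator _ (by linarith) h2 _).symm
  refine tendsto_integral_filter_of_dominated_convergence
    (fun σ => |A| * σ ^ (-β) * (C * (t₀ / 2) ^ (-((γ + m) / 2)))) ?_ ?_ ?_ ?_
  · filter_upwards [hτT] with i hi
    rw [aestronglyMeasurable_indicator_iff measurableSet_Iio,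
      Measure.restrict_restrict measurableSet_Iio]
    refine AEStronglyMeasurable.mono_set (s := Iio (τ i) ∩ Ioc 0 T) (t := Ioo 0 (τ i)) ?_ ?_
    · rintro σ ⟨h1, h2⟩
      exact ⟨h2.1, h1⟩
    · exact ((hF i).continuousOn_heat_left hp hβ hi _).aestronglyMeasurable measurableSet_Ioo
  · filter_upwards [hτT, hpos] with i hi hi2
    refine (ae_restrict_mem measurableSet_Ioc).mono fun σ hσ => ?_
    have hσ0 : 0 < σ := hσ.1
    by_cases h : σ ∈ Iio (τ i)
    · rw [indicator_of_mem h]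
      refine ((hF i).abs_heat_le hp hσ.1 h hi (x i)).trans ?_
      have h3 := hCb (τ i) (by linarith) (x i)
      have h4 := Real.rpow_le_rpow_of_nonpos (half_pos ht₀) hi2 (neg_nonpos.2 hγm)
      have h5 := hp.Psi_pos (show 0 < τ i by linarith) (x i)
      gcongr
      · exact le_abs_self A
      · exact h3.trans (by gcongr)
    · rw [indicator_of_notMem h, norm_zero]
      positivity
  · have : IntervalIntegrable (fun σ : ℝ => σ ^ (-β)) volume 0 T :=
      intervalIntegral.intervalIntegrable_rpow' (by linarith)
    exact (((intervalIntegrable_iff_integrableOn_Ioc_of_le (ht₀.le.trans ht₀T)).1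
      this).const_mul |A|).mul_const _
  · have hne : ∀ᵐ σ : ℝ ∂(volume.restrict (Ioc 0 T)), σ ≠ t₀ :=
      ae_restrict_of_ae (Measure.ae_ne volume t₀)
    filter_upwards [ae_restrict_mem measurableSet_Ioc, hne] with σ hσ hσne
    rcases lt_or_gt_of_ne hσne with h | h
    · rw [indicator_of_mem (show σ ∈ Iio t₀ from h)]
      have hlt : ∀ᶠ i in l, σ < τ i := hτ.eventually (lt_mem_nhds h)
      obtain ⟨B, hB⟩ := Source.exists_bdd (N := N) (m := m) hp T A hβ hσ.1
      refine Tendsto.congr' (f₁ := fun i => heat N m (τ i - σ) (F i σ) (x i)) ?_ ?_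
      · filter_upwards [hlt] with i hi
        rw [indicator_of_mem (show σ ∈ Iio (τ i) from hi)]
      · exact tendsto_heat (B := B) (sub_pos.2 h) (hτ.sub_const σ) hx
          (Eventually.of_forall fun i => ((hF i).continuous hσ).aestronglyMeasurable)
          (Eventually.of_forall fun i => Eventually.of_forall (hB _ (hF i) σ hσ le_rfl))
          (Eventually.of_forall (hconv σ hσ))
    · rw [indicator_of_notMem (show σ ∉ Iio t₀ from not_lt.2 h.le)]
      have hgt : ∀ᶠ i in l, τ i < σ := hτ.eventually (gt_mem_nhds h)
      refine tendsto_const_nhds.congr' ?_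
      filter_upwards [hgt] with i hi
      rw [indicator_of_notMem (show σ ∉ Iio (τ i) from not_lt.2 hi.le)]

lemma Source.continuousOn_duhamel {T A β : ℝ} {f : ℝ → sector N m → ℝ}
    (hf : Source N m γ T A β f) (hp : Params N m γ) (hβ : 0 ≤ β) (hβ1 : β < 1) :
    ContinuousOn (fun p : ℝ × sector N m => duhamel f p.1 p.2) (Ioc 0 T ×ˢ univ) := by
  rintro ⟨t, x⟩ ⟨ht, -⟩
  refine tendsto_duhamel hp hβ hβ1 ht.1 ht.2
    (continuous_fst.continuousAt.tendsto.mono_left nhdsWithin_le_nhds) ?_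
    (continuous_snd.continuousAt.tendsto.mono_left nhdsWithin_le_nhds) (fun _ => hf)
    (fun _ _ _ => tendsto_const_nhds)
  filter_upwards [self_mem_nhdsWithin] with p hp'
  exact hp'.1.2

/-- A bound on the integrand of the Duhamel integral gives a bound on the integral. -/
lemma abs_duhamel_le {f : ℝ → sector N m → ℝ} {t : ℝ} (ht : 0 < t) {x : sector N m} {g : ℝ → ℝ}
    {c : ℝ} (hg : IntegrableOn g (Ioo 0 t))
    (h : ∀ σ ∈ Ioo 0 t, |heat N m (t - σ) (f σ) x| ≤ g σ * c) :
    |duhamel f t x| ≤ (∫ σ in Ioo 0 t, g σ) * c := by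
  rw [duhamel_eq_setIntegral f ht, ← integral_mul_const]
  exact norm_integral_le_of_norm_le (G := ℝ) (hg.mul_const c)
    ((ae_restrict_mem measurableSet_Ioo).mono fun σ hσ => h σ hσ)

/-- Applying the semigroup to a Duhamel integral. -/
lemma Source.heat_duhamel {T A β : ℝ} {f : ℝ → sector N m → ℝ}
    (hf : Source N m γ T A β f) (hp : Params N m γ) (hβ : 0 ≤ β) (hβ1 : β < 1) {τ σ : ℝ}
    (hτ : 0 < τ) (hσ : 0 < σ) (hσT : σ ≤ T) (x : sector N m) :
    heat N m τ (duhamel f σ) x = ∫ s in Ioo 0 σ, heat N m (τ + σ - s) (f s) x := by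
  have hcont := hf.continuousOn_heat hp hβ hσT
  have hmeas : AEStronglyMeasurable (fun p : sector N m × ℝ => kernel N m τ x p.1 *
      heat N m (σ - p.2) (f p.2) p.1) ((leb N m).prod (volume.restrict (Ioo 0 σ))) := by
    have h1 : AEStronglyMeasurable (fun p : sector N m × ℝ => kernel N m τ x p.1)
        ((leb N m).prod (volume.restrict (Ioo 0 σ))) :=
      ((continuous_kernel_right τ x).measurable.comp measurable_fst).aestronglyMeasurable
    refine h1.mul ?_
    have h2 : AEStronglyMeasurable (fun p : ℝ × sector N m => heat N m (σ - p.1) (f p.1) p.2)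
        ((volume.restrict (Ioo 0 σ)).prod (leb N m)) := by
      have := hcont.aestronglyMeasurable (μ := (volume : Measure ℝ).prod (leb N m))
        (measurableSet_Ioo.prod MeasurableSet.univ)
      rwa [← Measure.prod_restrict, Measure.restrict_univ] at this
    exact h2.prod_swap
  have hb : ∀ s ∈ Ioo 0 σ, ∀ y, ‖kernel N m τ x y * heat N m (σ - s) (f s) y‖
      ≤ A * s ^ (-β) * (kernel N m τ x y * Psi N m γ σ y) := fun s hs y => by
    have hk := kernel_pos hτ x y
    rw [norm_mul, Real.norm_of_nonneg hk.le]
    calc _ ≤ kernel N m τ x y * (A * s ^ (-β) * Psi N m γ σ y) := by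
          gcongr
          exact hf.abs_heat_le hp hs.1 hs.2 hσT y
      _ = _ := by ring
  have hintegrable : Integrable (fun p : sector N m × ℝ => kernel N m τ x p.1 *
      heat N m (σ - p.2) (f p.2) p.1) ((leb N m).prod (volume.restrict (Ioo 0 σ))) := by
    have hpow : IntegrableOn (fun s : ℝ => A * s ^ (-β)) (Ioo 0 σ) := by
      have : IntervalIntegrable (fun σ : ℝ => σ ^ (-β)) volume 0 σ :=
        intervalIntegral.intervalIntegrable_rpow' (by linarith)
      exact ((intervalIntegrable_iff_integrableOn_Ioo_of_le hσ.le).1 this).const_mul A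
    refine ((hp.integrable_kernel_mul_Psi hτ hσ x).mul_prod hpow).mono' hmeas ?_
    have : ∀ᵐ p : sector N m × ℝ ∂((leb N m).prod (volume.restrict (Ioo 0 σ))), p.2 ∈ Ioo 0 σ :=
      Measure.quasiMeasurePreserving_snd.ae (ae_restrict_mem measurableSet_Ioo)
    filter_upwards [this] with p hp'
    refine (hb p.2 hp' p.1).trans (le_of_eq ?_)
    ring
  have e1 : heat N m τ (duhamel f σ) x = ∫ y, (∫ s in Ioo 0 σ, kernel N m τ x y *
      heat N m (σ - s) (f s) y) ∂(leb N m) := by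
    unfold heat
    refine integral_congr_ae (Eventually.of_forall fun y => ?_)
    simp only
    rw [duhamel_eq_setIntegral f hσ, ← integral_const_mul]
    rfl
  rw [e1, integral_integral_swap hintegrable]
  refine setIntegral_congr_fun measurableSet_Ioo fun s hs => ?_
  have hs' : s ∈ Ioc 0 T := ⟨hs.1, hs.2.le.trans hσT⟩
  have := heat_heat hτ (sub_pos.2 hs.2) (hf.continuous hs').aestronglyMeasurable
    (hf.integrable hp hs' (by linarith [hs.2] : 0 < τ + (σ - s)) x)
  rw [add_sub_assoc]
  exact this

/-! ### The sup norm of `Ψ` -/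

/-- `‖Ψ(σ)‖_{L^∞(Ω)}` as a real number. -/
def supPsi (N m : ℕ) (γ σ : ℝ) : ℝ := (eLpNorm (Psi N m γ σ) ∞ (leb N m)).toReal

lemma Params.eLpNorm_Psi_le (hp : Params N m γ) {σ B : ℝ} (hσ : 0 < σ)
    (hB : ∀ x, Psi N m γ σ x ≤ B) :
    eLpNorm (Psi N m γ σ) ∞ (leb N m) ≤ ENNReal.ofReal B := by
  rw [eLpNorm_exponent_top]
  refine eLpNormEssSup_le_of_ae_bound (Eventually.of_forall fun x => ?_)
  rw [Real.norm_of_nonneg (hp.Psi_pos hσ x).le]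
  exact hB x

lemma Params.eLpNorm_Psi_ne_top (hp : Params N m γ) {σ : ℝ} (hσ : 0 < σ) :
    eLpNorm (Psi N m γ σ) ∞ (leb N m) ≠ ∞ := by
  obtain ⟨C, hC, h⟩ := hp.Psi_le_rpow
  exact ((hp.eLpNorm_Psi_le hσ (h σ hσ)).trans_lt ENNReal.ofReal_lt_top).ne

lemma supPsi_nonneg (σ : ℝ) : 0 ≤ supPsi N m γ σ := ENNReal.toReal_nonneg

lemma Params.Psi_le_supPsi (hp : Params N m γ) {σ : ℝ} (hσ : 0 < σ) :
    ∀ᵐ x ∂(leb N m), Psi N m γ σ x ≤ supPsi N m γ σ := by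
  filter_upwards [ae_le_eLpNormEssSup (f := Psi N m γ σ) (μ := leb N m)] with x hx
  rw [← eLpNorm_exponent_top] at hx
  have := ENNReal.toReal_mono (hp.eLpNorm_Psi_ne_top hσ) hx
  rw [toReal_enorm] at this
  exact (Real.le_norm_self _).trans this

lemma Params.supPsi_le (hp : Params N m γ) {σ B : ℝ} (hσ : 0 < σ)
    (hB : ∀ x, Psi N m γ σ x ≤ B) : supPsi N m γ σ ≤ B := by
  have hB0 : 0 ≤ B := by
    obtain ⟨x⟩ := (inferInstance : Nonempty (sector N m))
    exact (hp.Psi_pos hσ x).le.trans (hB x)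
  have := ENNReal.toReal_mono ENNReal.ofReal_ne_top (hp.eLpNorm_Psi_le hσ hB)
  rwa [ENNReal.toReal_ofReal hB0] at this

lemma Params.antitoneOn_supPsi (hp : Params N m γ) : AntitoneOn (supPsi N m γ) (Ioi 0) := by
  intro σ hσ σ' hσ' h
  rcases h.eq_or_lt with rfl | h
  · exact le_rfl
  refine hp.supPsi_le hσ' fun x => ?_
  have hd : 0 < σ' - σ := sub_pos.2 h
  have e := hp.heat_Psi hd hσ x
  rw [sub_add_cancel] at e
  rw [← e]
  calc heat N m (σ' - σ) (Psi N m γ σ) x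
      ≤ heat N m (σ' - σ) (fun _ => supPsi N m γ σ) x :=
        heat_mono hd (hp.integrable_kernel_mul_Psi hd hσ x)
          ((integrable_kernel hd x).mul_const _) (hp.Psi_le_supPsi hσ)
    _ = (∫ y, kernel N m (σ' - σ) x y ∂(leb N m)) * supPsi N m γ σ := by
        unfold heat; rw [integral_mul_const]
    _ ≤ supPsi N m γ σ :=
        mul_le_of_le_one_left (supPsi_nonneg σ) (integral_kernel_le_one hd x)

lemma Params.integrableOn_supPsi_rpow (hp : Params N m γ) {α : ℝ} (hα : 0 < α)
    (hα' : α * ((γ + m) / 2) < 1) (T : ℝ) :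
    IntegrableOn (fun σ => supPsi N m γ σ ^ α) (Ioc 0 T) := by
  rcases le_or_gt T 0 with hT | hT
  · simp [Ioc_eq_empty (not_lt.2 hT)]
  obtain ⟨C, hC, h⟩ := hp.Psi_le_rpow
  have hγm : 0 ≤ (γ + m) / 2 := by have := hp.hγ; positivity
  have h1 : IntegrableOn (fun σ : ℝ => C ^ α * σ ^ (-(α * ((γ + m) / 2)))) (Ioc 0 T) := by
    have : IntervalIntegrable (fun σ : ℝ => σ ^ (-(α * ((γ + m) / 2)))) volume 0 T :=
      intervalIntegral.intervalIntegrable_rpow' (by linarith)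
    exact ((intervalIntegrable_iff_integrableOn_Ioc_of_le hT.le).1 this).const_mul _
  have hanti : AntitoneOn (fun σ => supPsi N m γ σ ^ α) (Ioc 0 T) := fun σ hσ σ' hσ' hle =>
    Real.rpow_le_rpow (supPsi_nonneg _) (hp.antitoneOn_supPsi hσ.1 hσ'.1 hle) hα.le
  refine h1.mono' (aemeasurable_restrict_of_antitoneOn measurableSet_Ioc
    hanti).aestronglyMeasurable ((ae_restrict_mem measurableSet_Ioc).mono fun σ hσ => ?_)
  have hσ0 : 0 < σ := hσ.1
  rw [Real.norm_of_nonneg (Real.rpow_nonneg (supPsi_nonneg σ) _)]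
  calc supPsi N m γ σ ^ α ≤ (C * σ ^ (-((γ + m) / 2))) ^ α :=
        Real.rpow_le_rpow (supPsi_nonneg _) (hp.supPsi_le hσ0 (h σ hσ0)) hα.le
    _ = C ^ α * σ ^ (-(α * ((γ + m) / 2))) := by
        rw [Real.mul_rpow hC.le (by positivity), ← Real.rpow_mul hσ0.le]
        congr 2; ring

lemma Params.psiIntegral_eq (hp : Params N m γ) {α : ℝ} (hα : 0 < α)
    (hα' : α * ((γ + m) / 2) < 1) (T : ℝ) :
    psiIntegral N m γ α T = ENNReal.ofReal (∫ σ in Ioc 0 T, supPsi N m γ σ ^ α) := by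
  rw [ofReal_integral_eq_lintegral_ofReal (hp.integrableOn_supPsi_rpow hα hα' T)
    (Eventually.of_forall fun σ => Real.rpow_nonneg (supPsi_nonneg σ) _)]
  refine setLIntegral_congr_fun measurableSet_Ioc fun σ hσ => ?_
  rw [← ENNReal.ofReal_rpow_of_nonneg (supPsi_nonneg σ) hα.le, supPsi,
    ENNReal.ofReal_toReal (hp.eLpNorm_Psi_ne_top hσ.1)]

end

end SectorHeat

namespace SectorHeat

noncomputable section

variable {N m : ℕ} {γ : ℝ}

/-! ### The nonlinearity -/

lemma rpow_mul_self_sub_le {α a b : ℝ} (hα : 0 < α) (hb : 0 ≤ b) (hab : b ≤ a) :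
    a ^ α * a - b ^ α * b ≤ (α + 1) * a ^ α * (a - b) := by
  rcases hb.eq_or_lt with rfl | hb0
  · have : 0 ≤ a ^ α * a := mul_nonneg (Real.rpow_nonneg hab _) hab
    nlinarith
  have ha0 : 0 < a := hb0.trans_le hab
  have h := one_add_mul_self_le_rpow_one_add (s := b / a - 1) (by
    have : 0 ≤ b / a := by positivity
    linarith) (p := α + 1) (by linarith)
  rw [add_sub_cancel, Real.div_rpow hb0.le ha0.le, Real.rpow_add_one hb0.ne',
    Real.rpow_add_one ha0.ne', le_div_iff₀ (by positivity)] at h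
  have e : (1 + (α + 1) * (b / a - 1)) * (a ^ α * a)
      = a ^ α * a - (α + 1) * a ^ α * (a - b) := by
    field_simp; ring
  linarith

lemma abs_rpow_mul_self_sub_le {α a b R : ℝ} (hα : 0 < α) (ha : |a| ≤ R) (hb : |b| ≤ R) :
    |(|a| ^ α * a - |b| ^ α * b)| ≤ (α + 1) * R ^ α * |a - b| := by
  wlog hab : |b| ≤ |a| generalizing a b
  · rw [abs_sub_comm, abs_sub_comm a b]
    exact this hb ha (le_of_not_ge hab)
  wlog ha0 : 0 ≤ a generalizing a b
  · have := @this (-a) (-b) (by rwa [abs_neg]) (by rwa [abs_neg]) (by rwa [abs_neg, abs_neg])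
      (by linarith)
    simp only [abs_neg] at this
    rw [← abs_neg (a - b), ← abs_neg (|a| ^ α * a - |b| ^ α * b)]
    convert this using 2 <;> ring_nf
  have hR : |a| ^ α ≤ R ^ α := Real.rpow_le_rpow (abs_nonneg _) ha hα.le
  rw [abs_of_nonneg ha0] at *
  have haα : 0 ≤ a ^ α := Real.rpow_nonneg ha0 _
  rcases le_or_gt 0 b with hb0 | hb0
  · rw [abs_of_nonneg hb0] at *
    have h1 := rpow_mul_self_sub_le hα hb0 hab
    have h2 : b ^ α * b ≤ a ^ α * a := by gcongr
    rw [abs_of_nonneg (sub_nonneg.2 h2), abs_of_nonneg (sub_nonneg.2 hab)]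
    refine h1.trans ?_
    gcongr
  · rw [abs_of_neg hb0] at *
    have h1 : (-b) ^ α ≤ a ^ α := Real.rpow_le_rpow (by linarith) hab hα.le
    have h2 : 0 ≤ (-b) ^ α := Real.rpow_nonneg (by linarith) _
    rw [abs_of_nonneg (show 0 ≤ a - b by linarith), abs_of_nonneg (by nlinarith)]
    calc a ^ α * a - (-b) ^ α * b ≤ a ^ α * (a - b) := by nlinarith
      _ ≤ (α + 1) * R ^ α * (a - b) := by
          have : a ^ α ≤ (α + 1) * R ^ α := by nlinarith
          exact mul_le_mul_of_nonneg_right this (by linarith)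

lemma nonlin_zero (α : ℝ) : nonlin N m α (fun _ => 0) = fun _ => 0 := by
  funext x; simp [nonlin]

/-! ### Curves dominated by `Ψ` -/

/-- A jointly continuous function on `(0, T] × Ω` bounded by `M Ψ`. -/
structure Curve (N m : ℕ) (γ T M : ℝ) (u : ℝ → sector N m → ℝ) : Prop where
  cont : ContinuousOn (fun p : ℝ × sector N m => u p.1 p.2) (Ioc 0 T ×ˢ univ)
  bound : ∀ t ∈ Ioc 0 T, ∀ x, |u t x| ≤ M * Psi N m γ t x

lemma Source.sub {T A A' β : ℝ} {f g : ℝ → sector N m → ℝ} (hf : Source N m γ T A β f)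
    (hg : Source N m γ T A' β g) : Source N m γ T (A + A') β (fun σ y => f σ y - g σ y) := by
  refine ⟨hf.cont.sub hg.cont, fun σ hσ y => ?_⟩
  rw [add_mul, add_mul]
  exact (abs_sub _ _).trans (add_le_add (hf.bound σ hσ y) (hg.bound σ hσ y))

lemma duhamel_sub {T A A' β : ℝ} {f g : ℝ → sector N m → ℝ} (hp : Params N m γ) (hβ : 0 ≤ β)
    (hβ1 : β < 1) (hf : Source N m γ T A β f) (hg : Source N m γ T A' β g) {t : ℝ}
    (ht : t ∈ Ioc 0 T) (x : sector N m) :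
    duhamel (fun σ y => f σ y - g σ y) t x = duhamel f t x - duhamel g t x := by
  rw [duhamel_eq_setIntegral _ ht.1, duhamel_eq_setIntegral _ ht.1, duhamel_eq_setIntegral _ ht.1,
    ← integral_sub (hf.integrableOn_heat hp hβ hβ1 ht.1 ht.2 x)
      (hg.integrableOn_heat hp hβ hβ1 ht.1 ht.2 x)]
  refine setIntegral_congr_fun measurableSet_Ioo fun σ hσ => ?_
  have hσ' : σ ∈ Ioc 0 T := ⟨hσ.1, hσ.2.le.trans ht.2⟩
  exact heat_sub (hf.integrable hp hσ' (sub_pos.2 hσ.2) x)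
    (hg.integrable hp hσ' (sub_pos.2 hσ.2) x)

/-- The exponent `α (γ + m) / 2` of the singularity of `‖Ψ(σ)‖^α` at `σ = 0`. -/
def singExp (m : ℕ) (γ α : ℝ) : ℝ := α * ((γ + m) / 2)

lemma Params.singExp_nonneg (hp : Params N m γ) {α : ℝ} (hα : 0 < α) : 0 ≤ singExp m γ α := by
  have := hp.hγ
  unfold singExp; positivity

lemma Params.exists_Psi_rpow_le (hp : Params N m γ) {α : ℝ} (hα : 0 < α) :
    ∃ C, 0 < C ∧ ∀ σ, 0 < σ → ∀ x : sector N m,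
      Psi N m γ σ x ^ α ≤ C * σ ^ (-singExp m γ α) := by
  obtain ⟨C, hC, h⟩ := hp.Psi_le_rpow
  refine ⟨C ^ α, by positivity, fun σ hσ x => ?_⟩
  calc Psi N m γ σ x ^ α ≤ (C * σ ^ (-((γ + m) / 2))) ^ α :=
        Real.rpow_le_rpow (hp.Psi_pos hσ x).le (h σ hσ x) hα.le
    _ = C ^ α * σ ^ (-singExp m γ α) := by
        rw [Real.mul_rpow hC.le (by positivity), ← Real.rpow_mul hσ.le, singExp]
        congr 2; ring

lemma Curve.exists_source (hp : Params N m γ) {α M : ℝ} (hα : 0 < α) (hM : 0 ≤ M) (T : ℝ) :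
    ∃ A, 0 ≤ A ∧ ∀ u : ℝ → sector N m → ℝ, Curve N m γ T M u →
      Source N m γ T A (singExp m γ α) (fun σ => nonlin N m α (u σ)) := by
  obtain ⟨C, hC, h⟩ := hp.exists_Psi_rpow_le hα
  refine ⟨M ^ α * C * M, by positivity, fun u hu => ⟨?_, fun σ hσ y => ?_⟩⟩
  · unfold nonlin
    exact (hu.cont.abs.rpow_const fun _ _ => Or.inr hα.le).mul hu.cont
  · have hb := hu.bound σ hσ y
    have hΨ := hp.Psi_pos hσ.1 y
    have hσ0 : 0 < σ := hσ.1
    unfold nonlin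
    rw [abs_mul, abs_of_nonneg (Real.rpow_nonneg (abs_nonneg _) _)]
    calc |u σ y| ^ α * |u σ y| ≤ (M * Psi N m γ σ y) ^ α * (M * Psi N m γ σ y) := by
          gcongr
      _ = M ^ α * Psi N m γ σ y ^ α * (M * Psi N m γ σ y) := by
          rw [Real.mul_rpow hM hΨ.le]
      _ ≤ M ^ α * (C * σ ^ (-singExp m γ α)) * (M * Psi N m γ σ y) := by
          gcongr
          exact h σ hσ0 y
      _ = _ := by ring

/-! ### Standing assumptions -/

/-- The standing assumptions of the fixed point argument. -/
structure Setting (N m : ℕ) (γ α a K M T : ℝ) : Prop where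
  hp : Params N m γ
  hα : 0 < α
  hβ : singExp m γ α < 1
  ha : |a| = 1
  hK : 0 < K
  hM : 0 < M
  hT : 0 < T
  hKM : K + 2 * (α + 1) * M ^ (α + 1) * (∫ σ in Ioc 0 T, supPsi N m γ σ ^ α) ≤ M
  hq : 2 * (α + 1) * M ^ α * (∫ σ in Ioc 0 T, supPsi N m γ σ ^ α) < 1

variable {α a K M T : ℝ}

/-- The contraction factor as a real number. -/
def realFactor (N m : ℕ) (γ α M T : ℝ) : ℝ :=
  2 * (α + 1) * M ^ α * ∫ σ in Ioc 0 T, supPsi N m γ σ ^ α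

lemma Setting.realFactor_nonneg (S : Setting N m γ α a K M T) : 0 ≤ realFactor N m γ α M T := by
  have := S.hα
  have := S.hM
  have h := integral_nonneg (μ := volume.restrict (Ioc 0 T))
    (f := fun σ => supPsi N m γ σ ^ α) fun σ => Real.rpow_nonneg (supPsi_nonneg σ) _
  unfold realFactor; positivity

lemma Setting.contractionFactor_eq (S : Setting N m γ α a K M T) :
    contractionFactor N m γ α M T = ENNReal.ofReal (realFactor N m γ α M T) := by
  have := S.hα
  have := S.hM
  unfold contractionFactor realFactor
  rw [S.hp.psiIntegral_eq S.hα S.hβ, ← ENNReal.ofReal_mul (by positivity)]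

lemma Setting.factor_mul (S : Setting N m γ α a K M T) :
    K + realFactor N m γ α M T * M ≤ M := by
  have h := S.hKM
  rw [Real.rpow_add_one S.hM.ne'] at h
  unfold realFactor
  linarith

lemma Setting.K_le_M (S : Setting N m γ α a K M T) : K ≤ M := by
  have := S.factor_mul
  have := mul_nonneg S.realFactor_nonneg S.hM.le
  linarith

lemma Setting.abs_heat_nonlin_sub_le (S : Setting N m γ α a K M T) {u v : ℝ → sector N m → ℝ}
    (hu : Curve N m γ T M u) (hv : Curve N m γ T M v) {D : ℝ}
    (hD : ∀ t ∈ Ioc 0 T, ∀ x, |u t x - v t x| ≤ D * Psi N m γ t x) {t σ : ℝ} (ht : t ≤ T)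
    (hσ : σ ∈ Ioo 0 t) (x : sector N m) :
    |heat N m (t - σ) (fun y => nonlin N m α (u σ) y - nonlin N m α (v σ) y) x|
      ≤ (α + 1) * M ^ α * supPsi N m γ σ ^ α * (D * Psi N m γ t x) := by
  have hσ' : σ ∈ Ioc 0 T := ⟨hσ.1, hσ.2.le.trans ht⟩
  have hα := S.hα
  have hM := S.hM
  have h := S.hp.abs_heat_le_Psi (sub_pos.2 hσ.2) hσ.1
    (f := fun y => nonlin N m α (u σ) y - nonlin N m α (v σ) y)
    (c := (α + 1) * M ^ α * supPsi N m γ σ ^ α * D) ?_ x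
  · rw [sub_add_cancel] at h
    rwa [← mul_assoc]
  filter_upwards [S.hp.Psi_le_supPsi hσ.1] with y hy
  have hΨ := S.hp.Psi_pos hσ.1 y
  have hs := supPsi_nonneg (N := N) (m := m) (γ := γ) σ
  have hd := hD σ hσ' y
  calc _ ≤ (α + 1) * (M * Psi N m γ σ y) ^ α * |u σ y - v σ y| :=
        abs_rpow_mul_self_sub_le S.hα (hu.bound σ hσ' y) (hv.bound σ hσ' y)
    _ ≤ (α + 1) * (M * supPsi N m γ σ) ^ α * (D * Psi N m γ σ y) := by gcongr
    _ = _ := by rw [Real.mul_rpow S.hM.le hs]; ring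

lemma Setting.abs_duhamel_nonlin_sub_le (S : Setting N m γ α a K M T) {u v : ℝ → sector N m → ℝ}
    (hu : Curve N m γ T M u) (hv : Curve N m γ T M v) {D : ℝ}
    (hD : ∀ t ∈ Ioc 0 T, ∀ x, |u t x - v t x| ≤ D * Psi N m γ t x) {t : ℝ} (ht : t ∈ Ioc 0 T)
    (x : sector N m) :
    |duhamel (fun σ => nonlin N m α (u σ)) t x - duhamel (fun σ => nonlin N m α (v σ)) t x|
      ≤ realFactor N m γ α M T * D * Psi N m γ t x := by
  obtain ⟨A, -, hA⟩ := Curve.exists_source S.hp S.hα S.hM.le T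
  have hα := S.hα
  have hM := S.hM
  have hDΨ : 0 ≤ D * Psi N m γ t x := (abs_nonneg _).trans (hD t ht x)
  rw [← duhamel_sub S.hp (S.hp.singExp_nonneg S.hα) S.hβ (hA u hu) (hA v hv) ht]
  have hintegrable := S.hp.integrableOn_supPsi_rpow S.hα S.hβ T
  have hsub : Ioo 0 t ⊆ Ioc 0 T := fun σ hσ => ⟨hσ.1, hσ.2.le.trans ht.2⟩
  refine (abs_duhamel_le ht.1 (g := fun σ => (α + 1) * M ^ α * supPsi N m γ σ ^ α)
    ((hintegrable.mono_set hsub).const_mul _)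
    fun σ hσ => S.abs_heat_nonlin_sub_le hu hv hD ht.2 hσ x).trans ?_
  rw [integral_const_mul, mul_assoc _ D]
  refine mul_le_mul_of_nonneg_right ?_ hDΨ
  have h1 : ∫ σ in Ioo 0 t, supPsi N m γ σ ^ α ≤ ∫ σ in Ioc 0 T, supPsi N m γ σ ^ α :=
    setIntegral_mono_set hintegrable (Eventually.of_forall fun σ => Real.rpow_nonneg (supPsi_nonneg σ) _)
      (Eventually.of_forall hsub)
  have h0 := integral_nonneg (μ := volume.restrict (Ioc 0 T))
    (f := fun σ => supPsi N m γ σ ^ α) fun σ => Real.rpow_nonneg (supPsi_nonneg σ) _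
  unfold realFactor
  calc _ ≤ (α + 1) * M ^ α * ∫ σ in Ioc 0 T, supPsi N m γ σ ^ α := by gcongr
    _ ≤ 2 * ((α + 1) * M ^ α * ∫ σ in Ioc 0 T, supPsi N m γ σ ^ α) := by
        have : 0 ≤ (α + 1) * M ^ α * ∫ σ in Ioc 0 T, supPsi N m γ σ ^ α := by positivity
        linarith
    _ = _ := by ring

lemma Params.curve_zero (hp : Params N m γ) (hM : 0 ≤ M) : Curve N m γ T M (fun _ _ => 0) :=
  ⟨continuousOn_const, fun t ht x => by
    have := hp.Psi_pos ht.1 x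
    rw [abs_zero]; positivity⟩

lemma Curve.abs_duhamel_le (S : Setting N m γ α a K M T) {u : ℝ → sector N m → ℝ}
    (hu : Curve N m γ T M u) {t : ℝ} (ht : t ∈ Ioc 0 T) (x : sector N m) :
    |duhamel (fun σ => nonlin N m α (u σ)) t x|
      ≤ realFactor N m γ α M T * M * Psi N m γ t x := by
  have h := S.abs_duhamel_nonlin_sub_le hu (S.hp.curve_zero S.hM.le) (D := M)
    (fun t ht x => by rw [sub_zero]; exact hu.bound t ht x) ht x
  have h0 : duhamel (fun σ => nonlin N m α ((fun _ _ => 0 : ℝ → sector N m → ℝ) σ)) t x = 0 := by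
    simp [duhamel, nonlin_zero, heat]
  rwa [h0, sub_zero] at h

/-! ### The fixed point -/

/-- The right-hand side of the integral equation. -/
def picard (α a : ℝ) (ψ : sector N m → ℝ) (u : ℝ → sector N m → ℝ) (t : ℝ) (x : sector N m) : ℝ :=
  heat N m t ψ x + a * duhamel (fun σ => nonlin N m α (u σ)) t x

lemma Dominated.continuousOn_heat {ψ : sector N m → ℝ} (h : Dominated N m γ K ψ)
    (hp : Params N m γ) (T : ℝ) :
    ContinuousOn (fun p : ℝ × sector N m => heat N m p.1 ψ p.2) (Ioc 0 T ×ˢ univ) := by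
  rintro ⟨t, x⟩ ⟨ht, -⟩
  exact (h.tendsto_heat hp ht.1 x).continuousWithinAt

lemma Curve.picard (S : Setting N m γ α a K M T) {ψ : sector N m → ℝ}
    (hψ : Dominated N m γ K ψ) {u : ℝ → sector N m → ℝ} (hu : Curve N m γ T M u) :
    Curve N m γ T M (picard α a ψ u) := by
  obtain ⟨A, -, hA⟩ := Curve.exists_source S.hp S.hα S.hM.le T
  refine ⟨(hψ.continuousOn_heat S.hp T).add (continuousOn_const.mul
    ((hA u hu).continuousOn_duhamel S.hp (S.hp.singExp_nonneg S.hα) S.hβ)), fun t ht x => ?_⟩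
  have hΨ := S.hp.Psi_pos ht.1 x
  calc |SectorHeat.picard α a ψ u t x|
      ≤ |heat N m t ψ x| + |a * duhamel (fun σ => nonlin N m α (u σ)) t x| := abs_add_le _ _
    _ ≤ K * Psi N m γ t x + realFactor N m γ α M T * M * Psi N m γ t x := by
        rw [abs_mul, S.ha, one_mul]
        exact add_le_add (hψ.abs_heat_le S.hp ht.1 x) (hu.abs_duhamel_le S ht x)
    _ = (K + realFactor N m γ α M T * M) * Psi N m γ t x := by ring
    _ ≤ M * Psi N m γ t x := by gcongr; exact S.factor_mul

open Classical in
/-- The curve `w Ψ` associated with a function `w` on `(0, T] × Ω`. -/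
def weighted (γ T : ℝ) (w : Ioc 0 T × sector N m → ℝ) (t : ℝ) (x : sector N m) : ℝ :=
  if h : t ∈ Ioc 0 T then w (⟨t, h⟩, x) * Psi N m γ t x else 0

lemma weighted_apply {w : Ioc 0 T × sector N m → ℝ} {t : ℝ} (h : t ∈ Ioc 0 T) (x : sector N m) :
    weighted γ T w t x = w (⟨t, h⟩, x) * Psi N m γ t x := dif_pos h

lemma Params.curve_weighted (hp : Params N m γ) {w : Ioc 0 T × sector N m → ℝ}
    (hw : Continuous w) (hM : ∀ p, |w p| ≤ M) : Curve N m γ T M (weighted γ T w) := by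
  constructor
  · rw [continuousOn_iff_continuous_domRestrict]
    have h1 : Continuous (fun p : (Ioc 0 T ×ˢ univ : Set (ℝ × sector N m)) =>
        ((⟨p.1.1, p.2.1⟩, p.1.2) : Ioc 0 T × sector N m)) := by fun_prop
    have h2 : Continuous (fun p : (Ioc 0 T ×ˢ univ : Set (ℝ × sector N m)) =>
        Psi N m γ p.1.1 p.1.2) := by
      have : ContinuousOn (fun p : ℝ × sector N m => Psi N m γ p.1 p.2) (Ioc 0 T ×ˢ univ) :=
        hp.dominated_psi0.continuousOn_heat hp T
      exact continuousOn_iff_continuous_domRestrict.1 this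
    refine ((hw.comp h1).mul h2).congr fun p => ?_
    exact (weighted_apply p.2.1 p.1.2).symm
  · intro t ht x
    have hΨ := hp.Psi_pos ht.1 x
    rw [weighted_apply ht, abs_mul, abs_of_pos hΨ]
    gcongr
    exact hM _

lemma Curve.continuous_div (hp : Params N m γ) {u : ℝ → sector N m → ℝ}
    (hu : Curve N m γ T M u) :
    Continuous (fun p : Ioc 0 T × sector N m => u p.1 p.2 / Psi N m γ p.1 p.2) := by
  have h1 : Continuous (fun p : Ioc 0 T × sector N m => ((p.1 : ℝ), p.2)) := by fun_prop
  have h2 : ContinuousOn (fun p : ℝ × sector N m => Psi N m γ p.1 p.2) (Ioc 0 T ×ˢ univ) :=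
    hp.dominated_psi0.continuousOn_heat hp T
  have h3 : ∀ p : Ioc 0 T × sector N m, ((p.1 : ℝ), p.2) ∈ Ioc 0 T ×ˢ (univ : Set (sector N m)) :=
    fun p => ⟨p.1.2, mem_univ _⟩
  exact (hu.cont.comp_continuous h1 h3).div (h2.comp_continuous h1 h3)
    fun p => (hp.Psi_pos p.1.2.1 p.2).ne'

lemma Setting.exists_fixedPoint (S : Setting N m γ α a K M T) {ψ : sector N m → ℝ}
    (hψ : Dominated N m γ K ψ) : ∃ u : ℝ → sector N m → ℝ, Curve N m γ T M u ∧
      ∀ t ∈ Ioc 0 T, ∀ x, u t x = SectorHeat.picard α a ψ u t x := by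
  let Y := BoundedContinuousFunction (Ioc 0 T × sector N m) ℝ
  let X := Metric.closedBall (0 : Y) M
  have hX : ∀ (w : X) p, |w.1 p| ≤ M := fun w p =>
    (w.1.norm_coe_le_norm p).trans (mem_closedBall_zero_iff.1 w.2)
  have hcurve : ∀ w : X, Curve N m γ T M (weighted γ T w.1) := fun w =>
    S.hp.curve_weighted w.1.continuous (hX w)
  have hcurve' : ∀ w : X, Curve N m γ T M (SectorHeat.picard α a ψ (weighted γ T w.1)) := fun w =>
    (hcurve w).picard S hψ
  have hbd : ∀ (w : X) (p : Ioc 0 T × sector N m),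
      ‖SectorHeat.picard α a ψ (weighted γ T w.1) p.1 p.2 / Psi N m γ p.1 p.2‖ ≤ M := fun w p => by
    have hΨ := S.hp.Psi_pos p.1.2.1 p.2
    rw [norm_div, Real.norm_of_nonneg hΨ.le, div_le_iff₀ hΨ]
    exact (hcurve' w).bound p.1 p.1.2 p.2
  let Φ : X → X := fun w => ⟨BoundedContinuousFunction.ofNormedAddCommGroup _
    ((hcurve' w).continuous_div S.hp) M (hbd w), mem_closedBall_zero_iff.2
      ((BoundedContinuousFunction.norm_le S.hM.le).2 (hbd w))⟩
  have hΦ : ∀ (w : X) (p : Ioc 0 T × sector N m),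
      (Φ w).1 p = SectorHeat.picard α a ψ (weighted γ T w.1) p.1 p.2 / Psi N m γ p.1 p.2 :=
    fun w p => rfl
  have hcontr : ContractingWith (Real.toNNReal (realFactor N m γ α M T)) Φ := by
    refine ⟨by rw [Real.toNNReal_lt_one]; exact S.hq, LipschitzWith.of_dist_le_mul fun w v => ?_⟩
    rw [Real.coe_toNNReal _ S.realFactor_nonneg, Subtype.dist_eq]
    refine (BoundedContinuousFunction.dist_le
      (mul_nonneg S.realFactor_nonneg dist_nonneg)).2 fun p => ?_
    have hΨ := S.hp.Psi_pos p.1.2.1 p.2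
    rw [hΦ, hΦ, Real.dist_eq, ← sub_div, abs_div, abs_of_pos hΨ, div_le_iff₀ hΨ]
    have key := S.abs_duhamel_nonlin_sub_le (hcurve w) (hcurve v) (D := dist w v)
      (fun t ht x => by
        have hΨ := S.hp.Psi_pos ht.1 x
        rw [weighted_apply ht, weighted_apply ht, ← sub_mul, abs_mul, abs_of_pos hΨ]
        gcongr
        exact BoundedContinuousFunction.dist_coe_le_dist (f := w.1) (g := v.1) _) p.1.2 p.2
    unfold SectorHeat.picard
    rw [add_sub_add_left_eq_sub, ← mul_sub, abs_mul, S.ha, one_mul]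
    exact key
  have : CompleteSpace X := Metric.isClosed_closedBall.completeSpace_coe
  have : Nonempty X := ⟨⟨0, Metric.mem_closedBall_self S.hM.le⟩⟩
  let w := hcontr.fixedPoint Φ
  have hw : Φ w = w := hcontr.fixedPoint_isFixedPt
  refine ⟨weighted γ T w.1, hcurve w, fun t ht x => ?_⟩
  have hΨ := S.hp.Psi_pos ht.1 x
  have h1 := hΦ w (⟨t, ht⟩, x)
  rw [hw] at h1
  rw [weighted_apply ht, h1]
  exact div_mul_cancel₀ _ hΨ.ne'

/-! ### Solutions -/

lemma normXT_le_iff (hp : Params N m γ) {D : ℝ} (hD : 0 ≤ D) {u : ℝ → sector N m → ℝ} :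
    normXT N m γ T u ≤ ENNReal.ofReal D ↔ ∀ t ∈ Ioc 0 T, ∀ x, |u t x| ≤ D * Psi N m γ t x := by
  unfold normXT
  simp only [iSup_le_iff]
  refine forall₂_congr fun t ht => forall_congr' fun x => ?_
  rw [ENNReal.ofReal_le_ofReal_iff hD, div_le_iff₀ (hp.Psi_pos ht.1 x)]

lemma Curve.toC0_apply (hp : Params N m γ) {u : ℝ → sector N m → ℝ} (hu : Curve N m γ T M u)
    {t : ℝ} (ht : t ∈ Ioc 0 T) (x : sector N m) : toC0 (u t) x = u t x := by
  refine SectorHeat.toC0_apply ?_ (hp.tendsto_zero_cocompact ht.1 (hu.bound t ht)) x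
  have h : ContinuousOn (fun x : sector N m => (t, x)) univ := by fun_prop
  have := hu.cont.comp (t := Ioc 0 T ×ˢ univ) h fun x _ => ⟨ht, mem_univ _⟩
  exact continuousOn_univ.1 this

lemma Curve.continuousOn_toC0 (hp : Params N m γ) {u : ℝ → sector N m → ℝ}
    (hu : Curve N m γ T M u) : ContinuousOn (fun t => toC0 (u t)) (Ioc 0 T) := by
  refine hp.continuousOn_C0 hu.cont (fun t ht x => hu.toC0_apply hp ht x) (τ := id)
    fun t₀ ht₀ => ⟨M, t₀ / 2, half_pos ht₀.1, ?_⟩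
  have h1 : ∀ᶠ t in 𝓝[Ioc 0 T] t₀, t₀ / 2 ≤ t :=
    nhdsWithin_le_nhds (le_mem_nhds (half_lt_self ht₀.1))
  filter_upwards [h1, self_mem_nhdsWithin] with t h1 h2
  exact ⟨h1, hu.bound t h2⟩

lemma IsSolution.curve (S : Setting N m γ α a K M T) {ψ : sector N m → ℝ}
    {u : ℝ → C₀(sector N m, ℝ)} (h : IsSolution N m γ α a M T ψ u) :
    Curve N m γ T M (fun t x => u t x) :=
  ⟨continuousOn_uncurry_C0 h.1.1, (normXT_le_iff S.hp S.hM.le).1 h.2.1⟩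

lemma IsSolution.eq_picard {ψ : sector N m → ℝ}
    {u : ℝ → C₀(sector N m, ℝ)} (h : IsSolution N m γ α a M T ψ u) {t : ℝ} (ht : t ∈ Ioc 0 T)
    (x : sector N m) : u t x = picard α a ψ (fun t x => u t x) t x := h.2.2 t ht x

lemma isSolution_of_curve (S : Setting N m γ α a K M T) {ψ : sector N m → ℝ}
    {u : ℝ → sector N m → ℝ} (hu : Curve N m γ T M u)
    (he : ∀ t ∈ Ioc 0 T, ∀ x, u t x = picard α a ψ u t x) :
    IsSolution N m γ α a M T ψ (fun t => toC0 (u t)) := by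
  have hv := fun t (ht : t ∈ Ioc 0 T) x => hu.toC0_apply S.hp ht x
  have hbound : ∀ t ∈ Ioc 0 T, ∀ x, |toC0 (u t) x| ≤ M * Psi N m γ t x := fun t ht x => by
    rw [hv t ht]; exact hu.bound t ht x
  refine ⟨⟨hu.continuousOn_toC0 S.hp, M, S.hM, hbound⟩, (normXT_le_iff S.hp S.hM.le).2 hbound,
    fun t ht x => ?_⟩
  rw [hv t ht, he t ht]
  unfold picard
  rw [duhamel_eq_setIntegral _ ht.1, intervalIntegral.integral_of_le ht.1.le,
    integral_Ioc_eq_integral_Ioo]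
  congr 2
  refine setIntegral_congr_fun measurableSet_Ioo fun σ hσ => ?_
  have : nonlin N m α (u σ) = nonlin N m α (toC0 (u σ)) := by
    funext y
    unfold nonlin
    rw [hv σ ⟨hσ.1, hσ.2.le.trans ht.2⟩]
  simp only [this]

/-- The basic estimate on differences of solutions. -/
lemma Setting.abs_sub_le_of_le (S : Setting N m γ α a K M T) {ψ₁ ψ₂ : sector N m → ℝ}
    (hψ₁ : Dominated N m γ K ψ₁) (hψ₂ : Dominated N m γ K ψ₂) {u₁ u₂ : ℝ → C₀(sector N m, ℝ)}
    (h₁ : IsSolution N m γ α a M T ψ₁ u₁) (h₂ : IsSolution N m γ α a M T ψ₂ u₂) {D E : ℝ}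
    (hD : ∀ t ∈ Ioc 0 T, ∀ x, |u₁ t x - u₂ t x| ≤ D * Psi N m γ t x)
    (hE : ∀ t ∈ Ioc 0 T, ∀ x, |heat N m t (ψ₁ - ψ₂) x| ≤ E * Psi N m γ t x) {t : ℝ}
    (ht : t ∈ Ioc 0 T) (x : sector N m) :
    |u₁ t x - u₂ t x| ≤ (E + realFactor N m γ α M T * D) * Psi N m γ t x := by
  have key := S.abs_duhamel_nonlin_sub_le (h₁.curve S) (h₂.curve S) hD ht x
  rw [h₁.eq_picard ht, h₂.eq_picard ht]
  have e : heat N m t (ψ₁ - ψ₂) x = heat N m t ψ₁ x - heat N m t ψ₂ x :=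
    heat_sub (hψ₁.integrable S.hp ht.1 x) (hψ₂.integrable S.hp ht.1 x)
  unfold SectorHeat.picard
  set d₁ := duhamel (fun σ => nonlin N m α ((fun t x => u₁ t x) σ)) t x
  set d₂ := duhamel (fun σ => nonlin N m α ((fun t x => u₂ t x) σ)) t x
  calc |heat N m t ψ₁ x + a * d₁ - (heat N m t ψ₂ x + a * d₂)|
      = |heat N m t (ψ₁ - ψ₂) x + a * (d₁ - d₂)| := by rw [e]; congr 1; ring
    _ ≤ |heat N m t (ψ₁ - ψ₂) x| + |a * (d₁ - d₂)| := abs_add_le _ _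
    _ ≤ E * Psi N m γ t x + realFactor N m γ α M T * D * Psi N m γ t x := by
        rw [abs_mul, S.ha, one_mul]
        exact add_le_add (hE t ht x) key
    _ = _ := by ring

lemma Setting.normXT_sub_le (S : Setting N m γ α a K M T) {ψ₁ ψ₂ : sector N m → ℝ}
    (hψ₁ : Dominated N m γ K ψ₁) (hψ₂ : Dominated N m γ K ψ₂) {u₁ u₂ : ℝ → C₀(sector N m, ℝ)}
    (h₁ : IsSolution N m γ α a M T ψ₁ u₁) (h₂ : IsSolution N m γ α a M T ψ₂ u₂) :
    normXT N m γ T (fun t => u₁ t - u₂ t) ≤ (1 - contractionFactor N m γ α M T)⁻¹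
      * normXT N m γ T (fun t => heat N m t (ψ₁ - ψ₂)) := by
  have hd : Dominated N m γ (K + K) (ψ₁ - ψ₂) := hψ₁.sub hψ₂
  have hK := S.hK
  have hM := S.hM
  set X := normXT N m γ T (fun t => u₁ t - u₂ t) with hXd
  set Y := normXT N m γ T (fun t => heat N m t (ψ₁ - ψ₂)) with hYd
  have hX : X ≤ ENNReal.ofReal (M + M) := by
    rw [hXd, normXT_le_iff S.hp (by positivity)]
    intro t ht x
    rw [add_mul]
    exact (abs_sub _ _).trans (add_le_add ((h₁.curve S).bound t ht x) ((h₂.curve S).bound t ht x))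
  have hY : Y ≤ ENNReal.ofReal (K + K) := by
    rw [hYd, normXT_le_iff S.hp (by positivity)]
    exact fun t ht x => hd.abs_heat_le S.hp ht.1 x
  have hX' : ENNReal.ofReal X.toReal = X := ENNReal.ofReal_toReal
    (hX.trans_lt ENNReal.ofReal_lt_top).ne
  have hY' : ENNReal.ofReal Y.toReal = Y := ENNReal.ofReal_toReal
    (hY.trans_lt ENNReal.ofReal_lt_top).ne
  have hDX := (normXT_le_iff S.hp ENNReal.toReal_nonneg).1 hX'.symm.le
  have hEY := (normXT_le_iff S.hp ENNReal.toReal_nonneg).1 hY'.symm.le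
  have hq0 := S.realFactor_nonneg
  have hq1 : realFactor N m γ α M T < 1 := S.hq
  have hstep : X ≤ ENNReal.ofReal (Y.toReal + realFactor N m γ α M T * X.toReal) := by
    rw [hXd, normXT_le_iff S.hp (by positivity)]
    exact fun t ht x => S.abs_sub_le_of_le hψ₁ hψ₂ h₁ h₂ hDX hEY ht x
  have hreal : X.toReal ≤ Y.toReal + realFactor N m γ α M T * X.toReal := by
    have := ENNReal.toReal_mono ENNReal.ofReal_ne_top hstep
    rwa [ENNReal.toReal_ofReal (by positivity)] at this
  rw [S.contractionFactor_eq, ← ENNReal.ofReal_one, ← ENNReal.ofReal_sub _ hq0,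
    ← ENNReal.ofReal_inv_of_pos (by linarith), ← hX', ← hY', ← ENNReal.ofReal_mul
    (by rw [inv_nonneg]; linarith)]
  refine ENNReal.ofReal_le_ofReal ?_
  rw [← div_eq_inv_mul, le_div_iff₀ (by linarith)]
  linarith

lemma Setting.normXT_heat_le (S : Setting N m γ α a K M T) {ψ : sector N m → ℝ} {K' : ℝ}
    (hψ : Dominated N m γ K' ψ) :
    normXT N m γ T (fun t => heat N m t ψ) ≤ normX N m γ ψ := by
  have hK := hψ.nonneg_bound S.hp
  have hX : normX N m γ ψ ≤ ENNReal.ofReal K' := (normX_le_iff S.hp hK).2 hψ.2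
  have hX' : ENNReal.ofReal (normX N m γ ψ).toReal = normX N m γ ψ := ENNReal.ofReal_toReal
    (hX.trans_lt ENNReal.ofReal_lt_top).ne
  have hd : Dominated N m γ (normX N m γ ψ).toReal ψ :=
    ⟨hψ.1, (normX_le_iff S.hp ENNReal.toReal_nonneg).1 hX'.symm.le⟩
  rw [← hX', normXT_le_iff S.hp ENNReal.toReal_nonneg]
  exact fun t ht x => hd.abs_heat_le S.hp ht.1 x

lemma Setting.unique (S : Setting N m γ α a K M T) {ψ : sector N m → ℝ}
    (hψ : Dominated N m γ K ψ) {u v : ℝ → C₀(sector N m, ℝ)}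
    (hu : IsSolution N m γ α a M T ψ u) (hv : IsSolution N m γ α a M T ψ v) :
    EqOn v u (Ioc 0 T) := by
  have h := S.normXT_sub_le hψ hψ hv hu
  have h0 : normXT N m γ T (fun t => heat N m t (ψ - ψ)) = 0 := by
    simp [normXT, heat]
  rw [h0, mul_zero, ← ENNReal.ofReal_zero, normXT_le_iff S.hp le_rfl] at h
  intro t ht
  ext x
  have := h t ht x
  rw [zero_mul] at this
  exact sub_eq_zero.1 (abs_nonpos_iff.1 this)

lemma Setting.exists_solution (S : Setting N m γ α a K M T) {ψ : sector N m → ℝ}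
    (hψ : Dominated N m γ K ψ) : ∃ u, IsSolution N m γ α a M T ψ u := by
  obtain ⟨u, hu, he⟩ := S.exists_fixedPoint hψ
  exact ⟨_, isSolution_of_curve S hu he⟩

/-- Evaluation at a point as a continuous linear functional on `C₀(Ω)`. -/
def evalC0 (x : sector N m) : C₀(sector N m, ℝ) →L[ℝ] ℝ :=
  LinearMap.mkContinuous
    { toFun := fun f => f x
      map_add' := fun _ _ => rfl
      map_smul' := fun _ _ => rfl } 1 fun f => by
    rw [one_mul, ← ZeroAtInftyContinuousMap.norm_toBCF_eq_norm]
    exact f.toBCF.norm_coe_le_norm x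

lemma evalC0_apply (x : sector N m) (f : C₀(sector N m, ℝ)) : evalC0 x f = f x := rfl

lemma norm_C0_le {f : C₀(sector N m, ℝ)} {B : ℝ} (hB : 0 ≤ B) (h : ∀ x, |f x| ≤ B) : ‖f‖ ≤ B := by
  rw [← ZeroAtInftyContinuousMap.norm_toBCF_eq_norm]
  exact (BoundedContinuousFunction.norm_le hB).2 h

lemma IsSolution.convergesInC0 (S : Setting N m γ α a K M T) {ψ : sector N m → ℝ}
    (hψ : Dominated N m γ K ψ) {u : ℝ → C₀(sector N m, ℝ)}
    (hu : IsSolution N m γ α a M T ψ u) : ConvergesInC0 N m α a T ψ u := by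
  intro t ht
  have hp := S.hp
  have hβ := hp.singExp_nonneg S.hα
  obtain ⟨A, hA0, hA⟩ := Curve.exists_source hp S.hα S.hM.le T
  have hs := hA _ (hu.curve S)
  obtain ⟨C, hC, hCb⟩ := hp.Psi_le_rpow
  set F : ℝ → C₀(sector N m, ℝ) := fun σ => toC0 (heat N m (t - σ) (nonlin N m α (u σ))) with hF
  have hcont := hs.continuousOn_heat hp hβ ht.2
  have hFx : ∀ σ ∈ Ioo 0 t, ∀ x, F σ x = heat N m (t - σ) (nonlin N m α (u σ)) x := by
    intro σ hσ x
    refine SectorHeat.toC0_apply ?_ (hp.tendsto_zero_cocompact ht.1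
      (hs.abs_heat_le hp hσ.1 hσ.2 ht.2)) x
    have h : ContinuousOn (fun x : sector N m => (σ, x)) univ := by fun_prop
    have := hcont.comp (t := Ioo 0 t ×ˢ univ) h fun x _ => ⟨hσ, mem_univ _⟩
    exact continuousOn_univ.1 this
  have hFc : ContinuousOn F (Ioo 0 t) := by
    refine hp.continuousOn_C0 hcont hFx (τ := fun _ => t)
      fun σ₀ hσ₀ => ⟨A * (σ₀ / 2) ^ (-singExp m γ α), t, ht.1, ?_⟩
    have h1 : ∀ᶠ σ in 𝓝[Ioo 0 t] σ₀, σ₀ / 2 ≤ σ :=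
      nhdsWithin_le_nhds (le_mem_nhds (half_lt_self hσ₀.1))
    filter_upwards [h1, self_mem_nhdsWithin] with σ h1 h2
    refine ⟨le_rfl, fun x => (hs.abs_heat_le hp h2.1 h2.2 ht.2 x).trans ?_⟩
    have h3 := Real.rpow_le_rpow_of_nonpos (half_pos hσ₀.1) h1 (neg_nonpos.2 hβ)
    have h4 := hp.Psi_pos ht.1 x
    gcongr
  have hFi : IntervalIntegrable F volume 0 t := by
    rw [intervalIntegrable_iff_integrableOn_Ioo_of_le ht.1.le]
    have h1 : IntegrableOn (fun σ : ℝ => A * σ ^ (-singExp m γ α) * (C * t ^ (-((γ + m) / 2))))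
        (Ioo 0 t) := by
      have : IntervalIntegrable (fun σ : ℝ => σ ^ (-singExp m γ α)) volume 0 t :=
        intervalIntegral.intervalIntegrable_rpow' (by linarith [S.hβ])
      exact (((intervalIntegrable_iff_integrableOn_Ioo_of_le ht.1.le).1 this).const_mul A).mul_const _
    refine h1.mono' (hFc.aestronglyMeasurable measurableSet_Ioo)
      ((ae_restrict_mem measurableSet_Ioo).mono fun σ hσ => ?_)
    have hσ0 : 0 < σ := hσ.1
    have ht0 : 0 < t := ht.1
    refine norm_C0_le (by positivity) fun x => ?_
    rw [hFx σ hσ]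
    refine (hs.abs_heat_le hp hσ.1 hσ.2 ht.2 x).trans ?_
    gcongr
    exact hCb t ht0 x
  have hLx : ∀ x, toC0 (heat N m t ψ) x = heat N m t ψ x := fun x =>
    SectorHeat.toC0_apply (hψ.continuous_heat hp ht.1)
      (hp.tendsto_zero_cocompact ht.1 (hψ.abs_heat_le hp ht.1)) x
  refine ⟨toC0 (heat N m t ψ), F, hLx, hFx, hFi, ?_⟩
  ext x
  have h1 : (∫ σ in (0 : ℝ)..t, F σ) x = duhamel (fun σ => nonlin N m α (u σ)) t x := by
    rw [← evalC0_apply, ← ContinuousLinearMap.intervalIntegral_comp_comm _ hFi,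
      duhamel_eq_setIntegral _ ht.1, intervalIntegral.integral_of_le ht.1.le,
      integral_Ioc_eq_integral_Ioo]
    exact setIntegral_congr_fun measurableSet_Ioo fun σ hσ => hFx σ hσ x
  have h2 : (toC0 (heat N m t ψ) + a • ∫ σ in (0 : ℝ)..t, F σ) x
      = toC0 (heat N m t ψ) x + a * (∫ σ in (0 : ℝ)..t, F σ) x := rfl
  rw [h2, h1, hLx]
  exact hu.eq_picard ht x

end

end SectorHeat

namespace SectorHeat

noncomputable section

variable {N m : ℕ} {γ α a K M T : ℝ}

/-! ### Comparison -/

lemma Curve.continuous {u : ℝ → sector N m → ℝ} (hu : Curve N m γ T M u) {t : ℝ}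
    (ht : t ∈ Ioc 0 T) : Continuous (u t) := by
  have h : ContinuousOn (fun x : sector N m => (t, x)) univ := by fun_prop
  have := hu.cont.comp (t := Ioc 0 T ×ˢ univ) h fun x _ => ⟨ht, mem_univ _⟩
  exact continuousOn_univ.1 this

lemma Curve.integrable (hp : Params N m γ) {u : ℝ → sector N m → ℝ} (hu : Curve N m γ T M u)
    {t σ : ℝ} (ht : 0 < t) (hσ : σ ∈ Ioc 0 T) (x : sector N m) :
    Integrable (fun y => kernel N m t x y * u σ y) (leb N m) := by
  refine integrable_kernel_mul_of_le ht (hu.continuous hσ).aestronglyMeasurable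
    (((hp.integrable_kernel_mul_Psi ht hσ.1 x).const_mul M).congr
      (Eventually.of_forall fun y => ?_)) (Eventually.of_forall (hu.bound σ hσ))
  simp only; ring

lemma Curve.sub {M' : ℝ} {u v : ℝ → sector N m → ℝ} (hu : Curve N m γ T M u)
    (hv : Curve N m γ T M' v) : Curve N m γ T (M + M') (fun t x => u t x - v t x) :=
  ⟨hu.cont.sub hv.cont, fun t ht x => by
    rw [add_mul]
    exact (abs_sub _ _).trans (add_le_add (hu.bound t ht x) (hv.bound t ht x))⟩

/-- The data of the linear inequality satisfied by the difference `w` of two solutions: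
`w(t) = e^{tΔ} ω + ∫_0^t e^{(t-σ)Δ} d(σ) dσ` with `|d(σ)| ≤ c σ^{-β} |w(σ)|`. -/
structure LinearProblem (N m : ℕ) (γ T M L A β c : ℝ) (ω : sector N m → ℝ)
    (w d : ℝ → sector N m → ℝ) : Prop where
  hw : Curve N m γ T M w
  hd : Source N m γ T A β d
  hω : Dominated N m γ L ω
  hβ : 0 ≤ β
  hβ1 : β < 1
  hc : 0 ≤ c
  hdw : ∀ σ ∈ Ioc 0 T, ∀ y, |d σ y| ≤ c * σ ^ (-β) * |w σ y|
  heq : ∀ t ∈ Ioc 0 T, ∀ x, w t x = heat N m t ω x + duhamel d t x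

/-- The primitive of `c σ^{-β}`. -/
def expWeight (c β σ : ℝ) : ℝ := c * (σ ^ (1 - β) / (1 - β))

lemma hasDerivAt_expWeight {c β σ : ℝ} (hβ1 : β < 1) (hσ : 0 < σ) :
    HasDerivAt (expWeight c β) (c * σ ^ (-β)) σ := by
  have h := (Real.hasDerivAt_rpow_const (p := 1 - β) (Or.inl hσ.ne')).div_const (1 - β)
  have h' := h.const_mul c
  have hne : (1 - β) ≠ 0 := by linarith
  have e : c * ((1 - β) * σ ^ (1 - β - 1) / (1 - β)) = c * σ ^ (-β) := by
    rw [show 1 - β - 1 = -β by ring]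
    field_simp
  rw [e] at h'
  exact h'

lemma continuous_expWeight {c β : ℝ} (hβ1 : β < 1) : Continuous (expWeight c β) := by
  unfold expWeight
  exact continuous_const.mul ((Real.continuous_rpow_const (by linarith)).div_const _)

lemma expWeight_zero {c β : ℝ} (hβ1 : β < 1) : expWeight c β 0 = 0 := by
  unfold expWeight
  rw [Real.zero_rpow (by linarith)]
  simp

lemma expWeight_nonneg {c β σ : ℝ} (hβ1 : β < 1) (hc : 0 ≤ c) (hσ : 0 ≤ σ) :
    0 ≤ expWeight c β σ := by
  unfold expWeight
  have : 0 < 1 - β := by linarith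
  positivity

namespace LinearProblem

variable {L A β c : ℝ} {ω : sector N m → ℝ} {w d : ℝ → sector N m → ℝ}

/-- The evolution of `w(σ)` up to time `t`. -/
lemma heat_w (P : LinearProblem N m γ T M L A β c ω w d) (hp : Params N m γ) {t σ : ℝ}
    (ht : t ≤ T) (hσ : σ ∈ Ioo 0 t) (x : sector N m) :
    heat N m (t - σ) (w σ) x
      = heat N m t ω x + ∫ s in (0 : ℝ)..σ, heat N m (t - s) (d s) x := by
  have hσ' : σ ∈ Ioc 0 T := ⟨hσ.1, hσ.2.le.trans ht⟩
  have hts : 0 < t - σ := sub_pos.2 hσ.2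
  have e : w σ = fun y => heat N m σ ω y + duhamel d σ y := funext (P.heq σ hσ')
  have hi1 : Integrable (fun y => kernel N m (t - σ) x y * heat N m σ ω y) (leb N m) := by
    refine integrable_kernel_mul_of_le hts (aestronglyMeasurable_heat P.hω.1)
      (((hp.integrable_kernel_mul_Psi hts hσ.1 x).const_mul L).congr
        (Eventually.of_forall fun y => ?_)) (Eventually.of_forall (P.hω.abs_heat_le hp hσ.1))
    simp only; ring
  have hi2 : Integrable (fun y => kernel N m (t - σ) x y * duhamel d σ y) (leb N m) := by
    refine ((P.hw.integrable hp hts hσ' x).sub hi1).congr (Eventually.of_forall fun y => ?_)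
    simp only [Pi.sub_apply, e]; ring
  rw [e, heat_add hi1 hi2, P.hω.heat_heat hp hts hσ.1, sub_add_cancel,
    P.hd.heat_duhamel hp P.hβ P.hβ1 hts hσ.1 hσ'.2, sub_add_cancel,
    intervalIntegral.integral_of_le hσ.1.le, integral_Ioc_eq_integral_Ioo]

/-- One step of the Gronwall iteration. -/
lemma improve (P : LinearProblem N m γ T M L A β c ω w d) (hp : Params N m γ)
    (hω : ω ≤ᵐ[leb N m] 0) {n : ℝ} (hn : 0 ≤ n)
    (h : ∀ σ ∈ Ioc 0 T, ∀ y, w σ y ≤ n * Real.exp (3 * expWeight c β σ) * Psi N m γ σ y) :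
    ∀ t ∈ Ioc 0 T, ∀ x, w t x ≤ n / 2 * Real.exp (3 * expWeight c β t) * Psi N m γ t x := by
  intro t ht x
  have hc := P.hc
  have hΨ := hp.Psi_pos ht.1 x
  set F : ℝ → ℝ := fun s => heat N m (t - s) (d s) x with hFd
  have hFi : IntervalIntegrable F volume 0 t :=
    P.hd.intervalIntegrable_heat hp P.hβ P.hβ1 ht.1 ht.2 x
  have hFc : ContinuousOn F (Ioo 0 t) := P.hd.continuousOn_heat_left hp P.hβ ht.2 x
  set y : ℝ → ℝ := fun σ => heat N m t ω x + ∫ s in (0 : ℝ)..σ, F s with hyd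
  have hyc : ContinuousOn y (Icc 0 t) := by
    have := intervalIntegral.continuousOn_primitive_interval
      ((intervalIntegrable_iff' (f := F)).1 hFi)
    rw [uIcc_of_le ht.1.le] at this
    exact continuousOn_const.add this
  have hyderiv : ∀ σ ∈ Ioo 0 t, HasDerivAt y (F σ) σ := fun σ hσ => by
    have hnb : Ioo 0 t ∈ 𝓝 σ := Ioo_mem_nhds hσ.1 hσ.2
    refine (intervalIntegral.integral_hasDerivAt_right ?_ ?_ (hFc.continuousAt hnb)).const_add _
    · exact hFi.mono_set (by
        rw [uIcc_of_le hσ.1.le, uIcc_of_le ht.1.le]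
        exact Icc_subset_Icc le_rfl hσ.2.le)
    · exact hFc.stronglyMeasurableAtFilter isOpen_Ioo σ hσ
  set G := expWeight c β with hGd
  set φ : ℝ → ℝ := fun σ => Real.exp (G σ) * y σ
    - n / 2 * Psi N m γ t x * Real.exp (4 * G σ) with hφd
  have hφderiv : ∀ σ ∈ Ioo 0 t, HasDerivAt φ
      (Real.exp (G σ) * (c * σ ^ (-β)) * y σ + Real.exp (G σ) * F σ
        - n / 2 * Psi N m γ t x * (Real.exp (4 * G σ) * (4 * (c * σ ^ (-β))))) σ := fun σ hσ => by
    have hG := hasDerivAt_expWeight (c := c) P.hβ1 hσ.1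
    exact (hG.exp.mul (hyderiv σ hσ)).sub (((hG.const_mul 4).exp).const_mul _)
  have hanti : AntitoneOn φ (Icc 0 t) := by
    refine antitoneOn_of_deriv_nonpos (convex_Icc 0 t) ?_ ?_ ?_
    · have hGc := (continuous_expWeight (c := c) P.hβ1).continuousOn (s := Icc 0 t)
      exact (hGc.rexp.mul hyc).sub (continuousOn_const.mul (hGc.const_mul 4).rexp)
    · rw [interior_Icc]
      exact fun σ hσ => (hφderiv σ hσ).differentiableAt.differentiableWithinAt
    · rw [interior_Icc]
      intro σ hσ
      rw [(hφderiv σ hσ).deriv]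
      have hσ' : σ ∈ Ioc 0 T := ⟨hσ.1, hσ.2.le.trans ht.2⟩
      have hσ0 : 0 < σ := hσ.1
      have hts : 0 < t - σ := sub_pos.2 hσ.2
      have hy : y σ = heat N m (t - σ) (w σ) x := (P.heat_w hp ht.2 hσ x).symm
      have hwi := P.hw.integrable hp hts hσ' x
      have hdi := P.hd.integrable hp hσ' hts x
      have hwi' : Integrable (fun y => kernel N m (t - σ) x y * (c * σ ^ (-β) * w σ y))
          (leb N m) := by
        refine (hwi.const_mul (c * σ ^ (-β))).congr (Eventually.of_forall fun z => ?_)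
        simp only; ring
      have key : c * σ ^ (-β) * y σ + F σ
          ≤ 2 * (c * σ ^ (-β)) * (n * Real.exp (3 * G σ)) * Psi N m γ t x := by
        rw [hy, ← heat_const_mul, hFd]
        simp only
        rw [← heat_add hwi' hdi]
        have e := hp.heat_Psi hts hσ0 x
        rw [sub_add_cancel] at e
        rw [← e, ← heat_const_mul]
        refine heat_mono hts ?_ ?_ (Eventually.of_forall fun z => ?_)
        · refine (hwi'.add hdi).congr (Eventually.of_forall fun z => ?_)
          simp only [Pi.add_apply]; ring
        · refine ((hp.integrable_kernel_mul_Psi hts hσ0 x).const_mul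
            (2 * (c * σ ^ (-β)) * (n * Real.exp (3 * G σ)))).congr
            (Eventually.of_forall fun z => ?_)
          simp only; ring
        · have hz := h σ hσ' z
          have hdz := (le_abs_self _).trans (P.hdw σ hσ' z)
          have hΨz := hp.Psi_pos hσ0 z
          have hg : 0 ≤ c * σ ^ (-β) := by positivity
          have hB : 0 ≤ n * Real.exp (3 * G σ) * Psi N m γ σ z := by positivity
          calc c * σ ^ (-β) * w σ z + d σ z
              ≤ c * σ ^ (-β) * (w σ z + |w σ z|) := by linarith
            _ ≤ c * σ ^ (-β) * (2 * (n * Real.exp (3 * G σ) * Psi N m γ σ z)) := by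
                refine mul_le_mul_of_nonneg_left ?_ hg
                rcases abs_cases (w σ z) with ⟨h1, -⟩ | ⟨h1, -⟩ <;> linarith
            _ = _ := by ring
      have e4 : Real.exp (4 * G σ) = Real.exp (G σ) * Real.exp (3 * G σ) := by
        rw [← Real.exp_add]; congr 1; ring
      rw [e4]
      have := mul_le_mul_of_nonneg_left key (Real.exp_pos (G σ)).le
      linarith
  have hle := hanti (left_mem_Icc.2 ht.1.le) (right_mem_Icc.2 ht.1.le) ht.1.le
  have hy0 : y 0 = heat N m t ω x := by simp [hyd]
  have hyt : y t = w t x := by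
    rw [P.heq t ht x]; rfl
  have hneg : heat N m t ω x ≤ 0 := by
    refine integral_nonpos_of_ae (hω.mono fun z hz => ?_)
    exact mul_nonpos_of_nonneg_of_nonpos (kernel_pos ht.1 x z).le hz
  have hG0 : G 0 = 0 := expWeight_zero P.hβ1
  have e4 : Real.exp (4 * G t) = Real.exp (G t) * Real.exp (3 * G t) := by
    rw [← Real.exp_add]; congr 1; ring
  simp only [hφd, hy0, hyt, hG0, mul_zero, Real.exp_zero, one_mul, mul_one] at hle
  rw [e4] at hle
  have hΨn : 0 ≤ n / 2 * Psi N m γ t x := by positivity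
  have hfin : Real.exp (G t) * w t x
      ≤ Real.exp (G t) * (n / 2 * Real.exp (3 * G t) * Psi N m γ t x) := by linarith
  exact le_of_mul_le_mul_left hfin (Real.exp_pos _)

lemma nonpos (P : LinearProblem N m γ T M L A β c ω w d) (hp : Params N m γ) (hM : 0 ≤ M)
    (hω : ω ≤ᵐ[leb N m] 0) : ∀ t ∈ Ioc 0 T, ∀ x, w t x ≤ 0 := by
  have hk : ∀ k : ℕ, ∀ t ∈ Ioc 0 T, ∀ x,
      w t x ≤ M / 2 ^ k * Real.exp (3 * expWeight c β t) * Psi N m γ t x := by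
    intro k
    induction k with
    | zero =>
      intro t ht x
      have hΨ := hp.Psi_pos ht.1 x
      have h1 : 1 ≤ Real.exp (3 * expWeight c β t) :=
        Real.one_le_exp (mul_nonneg (by norm_num) (expWeight_nonneg P.hβ1 P.hc ht.1.le))
      calc w t x ≤ M * Psi N m γ t x := (le_abs_self _).trans (P.hw.bound t ht x)
        _ ≤ M * Real.exp (3 * expWeight c β t) * Psi N m γ t x := by
            gcongr
            exact le_mul_of_one_le_right hM h1
        _ = _ := by simp
    | succ k ih =>
      have := P.improve hp hω (n := M / 2 ^ k) (by positivity) ih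
      intro t ht x
      have h2 := this t ht x
      rwa [div_div, ← pow_succ] at h2
  intro t ht x
  have hlim : Tendsto (fun k : ℕ => M / 2 ^ k * Real.exp (3 * expWeight c β t) * Psi N m γ t x)
      atTop (𝓝 0) := by
    have h1 : Tendsto (fun k : ℕ => M * ((1 : ℝ) / 2) ^ k) atTop (𝓝 (M * 0)) :=
      (tendsto_pow_atTop_nhds_zero_of_lt_one (by norm_num) (by norm_num)).const_mul M
    have h2 := (h1.mul_const (Real.exp (3 * expWeight c β t))).mul_const (Psi N m γ t x)
    simp only [mul_zero, zero_mul] at h2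
    refine h2.congr fun k => ?_
    rw [one_div, inv_pow, div_eq_mul_inv]
  exact ge_of_tendsto' hlim fun k => hk k t ht x

end LinearProblem

lemma duhamel_const_mul (f : ℝ → sector N m → ℝ) (b t : ℝ) (x : sector N m) :
    duhamel (fun σ y => b * f σ y) t x = b * duhamel f t x := by
  unfold duhamel
  simp only [heat_const_mul]
  exact intervalIntegral.integral_const_mul _ _

/-- Comparison of two solutions with ordered initial values. -/
lemma Setting.comparison (S : Setting N m γ α a K M T) {ψ₁ ψ₂ : sector N m → ℝ}
    (hψ₁ : Dominated N m γ K ψ₁) (hψ₂ : Dominated N m γ K ψ₂) {u₁ u₂ : ℝ → sector N m → ℝ}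
    (h₁ : Curve N m γ T M u₁) (h₂ : Curve N m γ T M u₂)
    (e₁ : ∀ t ∈ Ioc 0 T, ∀ x, u₁ t x = picard α a ψ₁ u₁ t x)
    (e₂ : ∀ t ∈ Ioc 0 T, ∀ x, u₂ t x = picard α a ψ₂ u₂ t x) (hle : ψ₁ ≤ᵐ[leb N m] ψ₂) :
    ∀ t ∈ Ioc 0 T, ∀ x, u₁ t x ≤ u₂ t x := by
  obtain ⟨A, -, hA⟩ := Curve.exists_source S.hp S.hα S.hM.le T
  obtain ⟨C, hC, hCb⟩ := S.hp.exists_Psi_rpow_le S.hα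
  have hα := S.hα
  have hM := S.hM
  have hβ := S.hp.singExp_nonneg S.hα
  have hsub := (hA u₁ h₁).sub (hA u₂ h₂)
  have P : LinearProblem N m γ T (M + M) (K + K) (A + A) (singExp m γ α) ((α + 1) * (M ^ α * C))
      (fun x => ψ₁ x - ψ₂ x) (fun t x => u₁ t x - u₂ t x)
      (fun σ y => a * (nonlin N m α (u₁ σ) y - nonlin N m α (u₂ σ) y)) := by
    refine ⟨h₁.sub h₂, ⟨continuousOn_const.mul hsub.cont, fun σ hσ y => ?_⟩, hψ₁.sub hψ₂, hβ, S.hβ,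
      by positivity, fun σ hσ y => ?_, fun t ht x => ?_⟩
    · rw [abs_mul, S.ha, one_mul]
      exact hsub.bound σ hσ y
    · have hΨ := S.hp.Psi_pos hσ.1 y
      rw [abs_mul, S.ha, one_mul]
      calc _ ≤ (α + 1) * (M * Psi N m γ σ y) ^ α * |u₁ σ y - u₂ σ y| :=
            abs_rpow_mul_self_sub_le S.hα (h₁.bound σ hσ y) (h₂.bound σ hσ y)
        _ ≤ (α + 1) * (M ^ α * (C * σ ^ (-singExp m γ α))) * |u₁ σ y - u₂ σ y| := by
            rw [Real.mul_rpow hM.le hΨ.le]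
            gcongr
            exact hCb σ hσ.1 y
        _ = _ := by ring
    · rw [e₁ t ht, e₂ t ht, duhamel_const_mul,
        duhamel_sub S.hp hβ S.hβ (hA u₁ h₁) (hA u₂ h₂) ht,
        heat_sub (hψ₁.integrable S.hp ht.1 x) (hψ₂.integrable S.hp ht.1 x)]
      unfold picard
      ring
  intro t ht x
  have := P.nonpos S.hp (by positivity) (hle.mono fun y hy => by simpa using hy) t ht x
  linarith

lemma Curve.neg {u : ℝ → sector N m → ℝ} (h : Curve N m γ T M u) :
    Curve N m γ T M (fun t x => -u t x) :=
  ⟨h.cont.neg, fun t ht x => by rw [abs_neg]; exact h.bound t ht x⟩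

lemma picard_neg (ψ : sector N m → ℝ) (u : ℝ → sector N m → ℝ) (t : ℝ) (x : sector N m) :
    picard α a (fun x => -ψ x) (fun t x => -u t x) t x = -picard α a ψ u t x := by
  have h1 : heat N m t (fun x => -ψ x) x = -heat N m t ψ x := by
    have := heat_const_mul t (-1) ψ x
    simpa using this
  have h2 : (fun σ => nonlin N m α (fun y => -u σ y))
      = fun σ y => -1 * nonlin N m α (u σ) y := by
    funext σ y
    simp [nonlin]
  unfold picard
  simp only
  rw [h1, h2, duhamel_const_mul]
  ring

lemma picard_zero (t : ℝ) (x : sector N m) :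
    picard α a (fun _ => 0) (fun _ _ => 0) t x = 0 := by
  simp [picard, duhamel, nonlin_zero, heat]

lemma Setting.nonneg (S : Setting N m γ α a K M T) {ψ : sector N m → ℝ}
    (hψ : Dominated N m γ K ψ) {u : ℝ → sector N m → ℝ} (hu : Curve N m γ T M u)
    (he : ∀ t ∈ Ioc 0 T, ∀ x, u t x = picard α a ψ u t x) (h0 : 0 ≤ᵐ[leb N m] ψ) :
    ∀ t ∈ Ioc 0 T, ∀ x, 0 ≤ u t x := by
  have hz : Dominated N m γ K (fun _ : sector N m => (0 : ℝ)) :=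
    ⟨aestronglyMeasurable_const, Eventually.of_forall fun x => by
      rw [abs_zero]; exact mul_nonneg S.hK.le (S.hp.psi0_nonneg x)⟩
  exact S.comparison hz hψ (S.hp.curve_zero S.hM.le) hu
    (fun t _ x => (picard_zero t x).symm) he h0

lemma Dominated.abs {ψ : sector N m → ℝ} (h : Dominated N m γ K ψ) :
    Dominated N m γ K (fun x => |ψ x|) :=
  ⟨h.1.norm, h.2.mono fun x hx => by rwa [abs_abs]⟩

lemma Setting.abs_le (S : Setting N m γ α a K M T) {ψ : sector N m → ℝ}
    (hψ : Dominated N m γ K ψ) {u v : ℝ → sector N m → ℝ} (hu : Curve N m γ T M u)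
    (hv : Curve N m γ T M v) (he : ∀ t ∈ Ioc 0 T, ∀ x, u t x = picard α a ψ u t x)
    (he' : ∀ t ∈ Ioc 0 T, ∀ x, v t x = picard α a (fun x => |ψ x|) v t x) :
    ∀ t ∈ Ioc 0 T, ∀ x, |u t x| ≤ v t x := by
  intro t ht x
  refine abs_le'.2 ⟨?_, ?_⟩
  · exact S.comparison hψ hψ.abs hu hv he he' (Eventually.of_forall fun y => le_abs_self _) t ht x
  · refine S.comparison hψ.neg hψ.abs hu.neg hv (fun t ht x => ?_) he'
      (Eventually.of_forall fun y => neg_le_abs _) t ht x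
    rw [picard_neg, he t ht x]

end

end SectorHeat

namespace SectorHeat

noncomputable section

variable {N m : ℕ} {γ α a K M T : ℝ}

/-! ### Local integrability of `ψ₀` -/

lemma le_halfKernel_one {t b : ℝ} (ht : 0 < t) (hb : 0 ≤ b) :
    Real.exp (-1 / (4 * t)) / (2 * t) * (b * gauss t b) ≤ halfKernel t 1 b := by
  unfold halfKernel gauss
  have h1 : Real.exp (-(1 - b) ^ 2 / (4 * t))
      = Real.exp (-1 / (4 * t)) * Real.exp (-b ^ 2 / (4 * t)) * Real.exp (b / (2 * t)) := by
    rw [← Real.exp_add, ← Real.exp_add]; congr 1; field_simp; ring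
  have h2 : Real.exp (-(1 + b) ^ 2 / (4 * t))
      = Real.exp (-1 / (4 * t)) * Real.exp (-b ^ 2 / (4 * t)) * Real.exp (-(b / (2 * t))) := by
    rw [← Real.exp_add, ← Real.exp_add]; congr 1; field_simp; ring
  have h3 : b / (2 * t) ≤ Real.exp (b / (2 * t)) - Real.exp (-(b / (2 * t))) := by
    have h4 := Real.add_one_le_exp (b / (2 * t))
    have h5 : Real.exp (-(b / (2 * t))) ≤ 1 := Real.exp_le_one_iff.2 (by
      have : 0 ≤ b / (2 * t) := by positivity
      linarith)
    linarith
  rw [h1, h2]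
  calc _ = (4 * Real.pi * t) ^ (-(1 : ℝ) / 2) * (Real.exp (-1 / (4 * t))
        * Real.exp (-b ^ 2 / (4 * t))) * (b / (2 * t)) := by field_simp
    _ ≤ (4 * Real.pi * t) ^ (-(1 : ℝ) / 2) * (Real.exp (-1 / (4 * t))
        * Real.exp (-b ^ 2 / (4 * t))) * (Real.exp (b / (2 * t)) - Real.exp (-(b / (2 * t)))) := by
        gcongr
    _ = _ := by ring

/-- The point with constrained coordinates equal to `1` and the others equal to `0`. -/
def basePoint (N m : ℕ) : sector N m :=
  ⟨WithLp.toLp 2 (fun i => if (i : ℕ) < m then 1 else 0), fun i hi => by simp [hi]⟩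

lemma gaussProd_le_kernel {s : ℝ} (hs : 0 < s) :
    ∃ C, 0 < C ∧ ∀ y : sector N m,
      gaussProd s y ≤ C * kernel N m (1 / (4 * s)) (basePoint N m) y := by
  have ht : 0 < 1 / (4 * s) := by positivity
  set t := 1 / (4 * s) with htd
  set c := ∏ i : Fin N, (if (i : ℕ) < m then Real.exp (-1 / (4 * t)) / (2 * t) else 1) with hcd
  have hc : 0 < c := Finset.prod_pos fun i _ => by split_ifs <;> positivity
  refine ⟨(Real.pi / s) ^ ((N : ℝ) / 2) * c⁻¹, by positivity, fun y => ?_⟩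
  rw [gaussProd_eq_prod hs, kernel_eq_prod ht, mul_assoc]
  gcongr
  rw [le_inv_mul_iff₀ hc, hcd, ← Finset.prod_mul_distrib]
  refine Finset.prod_le_prod (fun i _ => ?_) fun i _ => ?_
  · have := gauss_pos ht (y.1 i)
    split_ifs with h
    · have := coord_pos y h
      positivity
    · positivity
  · unfold coordKernel basePoint
    split_ifs with h
    · simp only [h, if_true]
      exact le_halfKernel_one ht (coord_pos y h).le
    · simp only [h, if_false, one_mul]
      rw [zero_sub, gauss_neg]

lemma Params.integrable_gaussProd_mul_psi0 (hp : Params N m γ) {s : ℝ} (hs : 0 < s) :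
    Integrable (fun y => gaussProd s y * psi0 N m γ y) (leb N m) := by
  obtain ⟨C, hC, h⟩ := gaussProd_le_kernel (N := N) (m := m) hs
  refine ((hp.integrable_kernel_mul_psi0 (t := 1 / (4 * s)) (by positivity)
    (basePoint N m)).const_mul C).mono' ?_ (Eventually.of_forall fun y => ?_)
  · exact ((continuous_gaussProd s).measurable.mul measurable_psi0).aestronglyMeasurable
  · have h1 := hp.psi0_nonneg y
    have h2 := gaussProd_pos s y
    rw [Real.norm_of_nonneg (by positivity), ← mul_assoc]
    exact mul_le_mul_of_nonneg_right (h y) h1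

lemma exists_pos_le_gaussProd {S : Set (sector N m)} (hS : IsCompact S) (s : ℝ) :
    ∃ δ, 0 < δ ∧ ∀ x ∈ S, δ ≤ gaussProd s x := by
  rcases S.eq_empty_or_nonempty with rfl | hne
  · exact ⟨1, one_pos, fun x hx => hx.elim⟩
  obtain ⟨x₀, -, h⟩ := hS.exists_isMinOn hne (continuous_gaussProd s).continuousOn
  exact ⟨gaussProd s x₀, gaussProd_pos s x₀, fun x hx => h hx⟩

lemma Params.locallyIntegrable_psi0 (hp : Params N m γ) :
    LocallyIntegrable (psi0 N m γ) (leb N m) := by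
  rw [locallyIntegrable_iff]
  intro S hS
  obtain ⟨δ, hδ, h⟩ := exists_pos_le_gaussProd hS 1
  have hi := (hp.integrable_gaussProd_mul_psi0 one_pos).integrableOn (s := S)
  refine Integrable.mono' (hi.const_mul δ⁻¹) measurable_psi0.aestronglyMeasurable ?_
  filter_upwards [ae_restrict_mem hS.measurableSet] with x hx
  rw [Real.norm_of_nonneg (hp.psi0_nonneg x), le_inv_mul_iff₀ hδ]
  exact mul_le_mul_of_nonneg_right (h x hx) (hp.psi0_nonneg x)

lemma Dominated.locallyIntegrable (hp : Params N m γ) {ψ : sector N m → ℝ}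
    (h : Dominated N m γ K ψ) : LocallyIntegrable ψ (leb N m) := by
  have h1 : LocallyIntegrable (fun x => K * psi0 N m γ x) (leb N m) := by
    have := hp.locallyIntegrable_psi0.smul K
    exact this
  refine h1.mono h.1 (h.2.mono fun x hx => ?_)
  rw [Real.norm_eq_abs]
  exact hx.trans (le_abs_self _)

lemma Dominated.memBall (hp : Params N m γ) {ψ : sector N m → ℝ}
    (h : Dominated N m γ K ψ) : MemBall N m γ K ψ := by
  have hn : normX N m γ ψ ≤ ENNReal.ofReal K := (normX_le_iff hp (h.nonneg_bound hp)).2 h.2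
  refine ⟨⟨h.locallyIntegrable hp, ⟨?_, hn.trans_lt ENNReal.ofReal_lt_top⟩⟩, hn⟩
  exact (h.1.aemeasurable.div measurable_psi0.aemeasurable).aestronglyMeasurable

lemma MemX.dominated (hp : Params N m γ) {ψ : sector N m → ℝ} (h : MemX N m γ ψ) :
    Dominated N m γ (normX N m γ ψ).toReal ψ := by
  have hX' : ENNReal.ofReal (normX N m γ ψ).toReal = normX N m γ ψ :=
    ENNReal.ofReal_toReal h.2.2.ne
  exact ⟨h.1.aestronglyMeasurable, (normX_le_iff hp ENNReal.toReal_nonneg).1 hX'.symm.le⟩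

lemma Params.exists_dominated_of_le_Psi (hp : Params N m γ) :
    ∃ C, 1 ≤ C ∧ ∀ t, 0 < t → ∀ (f : sector N m → ℝ) (M : ℝ), 0 ≤ M →
      AEStronglyMeasurable f (leb N m) → (∀ x, |f x| ≤ M * Psi N m γ t x) →
      Dominated N m γ (C * M) f := by
  obtain ⟨C, hC, h⟩ := hp.Psi_le_psi0
  refine ⟨C, hC, fun t ht f M hM hf hb => ⟨hf, hp.ae_ne_zero.mono fun x hx => ?_⟩⟩
  calc |f x| ≤ M * Psi N m γ t x := hb x
    _ ≤ M * (C * psi0 N m γ x) := by gcongr; exact h t ht x hx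
    _ = _ := by ring

lemma Params.exists_isSemigroupBound (hp : Params N m γ) : ∃ C, IsSemigroupBound N m γ C := by
  obtain ⟨C, hC, h⟩ := hp.exists_dominated_of_le_Psi
  refine ⟨C, hC, fun t ht ψ hψ => ?_⟩
  have hd := hψ.dominated hp
  have h1 := h t ht (heat N m t ψ) _ ENNReal.toReal_nonneg (aestronglyMeasurable_heat hd.1)
    (hd.abs_heat_le hp ht)
  have h2 := h1.memBall hp
  refine ⟨h2.1, h2.2.trans (le_of_eq ?_)⟩
  have hne : normX N m γ ψ ≠ ∞ := hψ.2.2.ne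
  rw [ENNReal.ofReal_mul (by linarith), ENNReal.ofReal_toReal hne]

/-- A semigroup bound controls everything that is bounded by `M Ψ(t)`. -/
lemma IsSemigroupBound.dominated {C : ℝ} (hC : IsSemigroupBound N m γ C) (hp : Params N m γ)
    {t : ℝ} (ht : 0 < t) (hM : 0 ≤ M) {f : sector N m → ℝ}
    (hf : AEStronglyMeasurable f (leb N m)) (hb : ∀ x, |f x| ≤ M * Psi N m γ t x) :
    Dominated N m γ (C * M) f := by
  have h1 := hp.dominated_psi0.memBall hp
  have hC0 : 0 ≤ C := zero_le_one.trans hC.1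
  have h2 : normX N m γ (Psi N m γ t) ≤ ENNReal.ofReal C := by
    refine (hC.2 t ht _ h1.1).2.trans ?_
    have := h1.2
    rw [ENNReal.ofReal_one] at this
    exact mul_le_of_le_one_right zero_le this
  refine ⟨hf, ?_⟩
  filter_upwards [(normX_le_iff hp hC0).1 h2] with x hx
  rw [abs_of_pos (hp.Psi_pos ht x)] at hx
  calc |f x| ≤ M * Psi N m γ t x := hb x
    _ ≤ M * (C * psi0 N m γ x) := by gcongr
    _ = _ := by ring

/-! ### Pointwise convergence of the semigroup at `t = 0` -/

/-- The reflection factor of the heat kernel. -/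
def reflFactor (m : ℕ) {N : ℕ} (t : ℝ) (x y : EuclideanSpace ℝ (Fin N)) : ℝ :=
  ∏ i : Fin N, if (i : ℕ) < m then 1 - Real.exp (-(x i * y i / t)) else 1

lemma kernel_eq_reflFactor {t : ℝ} (ht : 0 < t) (x y : sector N m) :
    kernel N m t x y = (4 * Real.pi * t) ^ (-(N : ℝ) / 2) * Real.exp (-‖x.1 - y.1‖ ^ 2 / (4 * t))
      * reflFactor m t x.1 y.1 := by
  rw [kernel_eq_prod ht, ← prod_gauss ht, reflFactor, ← Finset.prod_mul_distrib]
  refine Finset.prod_congr rfl fun i _ => ?_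
  unfold coordKernel
  split_ifs with h
  · rw [halfKernel_eq_mul ht]; rfl
  · rw [mul_one]; rfl

lemma abs_reflFactor_le_one {t : ℝ} (ht : 0 < t) (x y : sector N m) :
    |reflFactor m t x.1 y.1| ≤ 1 := by
  unfold reflFactor
  rw [Finset.abs_prod]
  refine Finset.prod_le_one (fun i _ => abs_nonneg _) fun i _ => ?_
  split_ifs with h
  · have h1 := coord_pos x h
    have h2 := coord_pos y h
    have h3 : 0 ≤ x.1 i * y.1 i / t := by positivity
    have h4 : Real.exp (-(x.1 i * y.1 i / t)) ≤ 1 := Real.exp_le_one_iff.2 (by linarith)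
    have h5 := Real.exp_pos (-(x.1 i * y.1 i / t))
    rw [abs_le]
    constructor <;> linarith
  · simp

lemma heat_eq_integral {t : ℝ} (ht : 0 < t) (η : sector N m → ℝ) (x : sector N m) :
    heat N m t η x = ∫ z : EuclideanSpace ℝ (Fin N), (4 * Real.pi) ^ (-(N : ℝ) / 2)
      * Real.exp (-(1 / 4) * ‖z‖ ^ 2) * (reflFactor m t x.1 (x.1 + Real.sqrt t • z)
        * Function.extend Subtype.val η 0 (x.1 + Real.sqrt t • z)) := by
  set η' : EuclideanSpace ℝ (Fin N) → ℝ := Function.extend Subtype.val η 0 with hη'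
  have hval : ∀ y : sector N m, η' y.1 = η y := fun y => Subtype.val_injective.extend_apply _ _ y
  set f : EuclideanSpace ℝ (Fin N) → ℝ := fun y => (4 * Real.pi * t) ^ (-(N : ℝ) / 2)
    * Real.exp (-‖x.1 - y‖ ^ 2 / (4 * t)) * (reflFactor m t x.1 y * η' y) with hf
  have e1 : heat N m t η x = ∫ y, f y := by
    have : heat N m t η x = ∫ y, f y.1 ∂(leb N m) := by
      unfold heat
      congr 1; funext y
      rw [hf, kernel_eq_reflFactor ht]
      simp only [hval]
      ring
    rw [this, integral_leb, setIntegral_eq_integral_of_forall_compl_eq_zero]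
    intro y hy
    have : η' y = 0 := by
      rw [hη', Function.extend_apply']
      · rfl
      · rintro ⟨z, rfl⟩
        exact hy z.2
    simp [hf, this]
  have hst : 0 < Real.sqrt t := Real.sqrt_pos.2 ht
  have e2 := Measure.integral_comp_smul (volume : Measure (EuclideanSpace ℝ (Fin N)))
    (fun z => f (x.1 + z)) (Real.sqrt t)
  rw [integral_add_left_eq_self f, finrank_euclideanSpace, Fintype.card_fin,
    abs_of_pos (by positivity), smul_eq_mul] at e2
  have e3 : ∫ y, f y = Real.sqrt t ^ N * ∫ z, f (x.1 + Real.sqrt t • z) := by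
    rw [e2]; field_simp
  rw [e1, e3, ← integral_const_mul]
  congr 1; funext z
  have h1 : -‖x.1 - (x.1 + Real.sqrt t • z)‖ ^ 2 / (4 * t) = -(1 / 4) * ‖z‖ ^ 2 := by
    rw [sub_add_cancel_left, norm_neg, norm_smul, mul_pow, Real.norm_of_nonneg hst.le,
      Real.sq_sqrt ht.le]
    field_simp
  have h2 : Real.sqrt t ^ N * (4 * Real.pi * t) ^ (-(N : ℝ) / 2)
      = (4 * Real.pi) ^ (-(N : ℝ) / 2) := by
    rw [Real.mul_rpow (by positivity) ht.le, Real.sqrt_eq_rpow, ← Real.rpow_natCast,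
      ← Real.rpow_mul ht.le, mul_left_comm, ← Real.rpow_add ht]
    rw [show (1 / 2 * (N : ℝ) + -(N : ℝ) / 2) = 0 by ring, Real.rpow_zero, mul_one]
  rw [hf]
  simp only
  rw [h1, ← h2]
  ring

lemma tendsto_reflFactor (x : sector N m) (z : EuclideanSpace ℝ (Fin N)) :
    Tendsto (fun t => reflFactor m t x.1 (x.1 + Real.sqrt t • z)) (𝓝[>] 0) (𝓝 1) := by
  have h : ∀ i : Fin N, Tendsto (fun t => if (i : ℕ) < m then
      1 - Real.exp (-(x.1 i * (x.1 + Real.sqrt t • z) i / t)) else 1) (𝓝[>] 0) (𝓝 1) := by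
    intro i
    split_ifs with hi
    · have hx := coord_pos x hi
      have h1 : Tendsto (fun t : ℝ => x.1 i * (x.1 + Real.sqrt t • z) i) (𝓝[>] 0)
          (𝓝 (x.1 i * x.1 i)) := by
        have : Continuous (fun t : ℝ => x.1 i * (x.1 + Real.sqrt t • z) i) := by fun_prop
        have h2 := this.tendsto 0
        simp only [Real.sqrt_zero, zero_smul, add_zero] at h2
        exact h2.mono_left nhdsWithin_le_nhds
      have h2 := h1.pos_mul_atTop (by positivity) tendsto_inv_nhdsGT_zero
      have h3 := (Real.tendsto_exp_neg_atTop_nhds_zero.comp h2).const_sub 1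
      simp only [sub_zero] at h3
      exact h3
    · exact tendsto_const_nhds
  have := tendsto_finsetProd (Finset.univ : Finset (Fin N)) fun i _ => h i
  simpa [reflFactor] using this

lemma tendsto_heat_zero {η : sector N m → ℝ} (hη : Continuous η) {B : ℝ} (hB : ∀ x, |η x| ≤ B)
    (x : sector N m) : Tendsto (fun t => heat N m t η x) (𝓝[>] 0) (𝓝 (η x)) := by
  set η' : EuclideanSpace ℝ (Fin N) → ℝ := Function.extend Subtype.val η 0 with hη'
  have hval : ∀ y : sector N m, η' y.1 = η y := fun y => Subtype.val_injective.extend_apply _ _ y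
  have hB0 : 0 ≤ B := (abs_nonneg _).trans (hB x)
  have hemb := (sector N m).isOpen.isOpenEmbedding_subtypeVal
  have hcont : ContinuousAt η' x.1 := by
    rw [← hemb.continuousAt_iff]
    exact hη.continuousAt.congr (Eventually.of_forall fun y => (hval y).symm)
  have hzero : ∀ y, y ∉ (sector N m : Set (EuclideanSpace ℝ (Fin N))) → η' y = 0 := fun y hy => by
    rw [hη', Function.extend_apply']
    · rfl
    · rintro ⟨z, rfl⟩
      exact hy z.2
  have hgi : Integrable (fun z : EuclideanSpace ℝ (Fin N) => (4 * Real.pi) ^ (-(N : ℝ) / 2)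
      * Real.exp (-(1 / 4) * ‖z‖ ^ 2)) := by
    refine Integrable.const_mul ?_ _
    by_contra h
    have h1 := GaussianFourier.integral_rexp_neg_mul_sq_norm (V := EuclideanSpace ℝ (Fin N))
      (b := 1 / 4) (by norm_num)
    rw [integral_undef h] at h1
    have : 0 < (Real.pi / (1 / 4)) ^ ((Module.finrank ℝ (EuclideanSpace ℝ (Fin N)) : ℝ) / 2) := by
      positivity
    linarith
  have hone : ∫ z : EuclideanSpace ℝ (Fin N), (4 * Real.pi) ^ (-(N : ℝ) / 2)
      * Real.exp (-(1 / 4) * ‖z‖ ^ 2) * (1 * η x) = η x := by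
    rw [integral_mul_const, integral_const_mul,
      GaussianFourier.integral_rexp_neg_mul_sq_norm (by norm_num), finrank_euclideanSpace,
      Fintype.card_fin, show Real.pi / (1 / 4) = 4 * Real.pi by ring,
      ← Real.rpow_add (by positivity), show (-(N : ℝ) / 2 + (N : ℝ) / 2) = 0 by ring,
      Real.rpow_zero, one_mul, one_mul]
  rw [← hone]
  refine Tendsto.congr' (f₁ := fun t => ∫ z : EuclideanSpace ℝ (Fin N),
    (4 * Real.pi) ^ (-(N : ℝ) / 2)
      * Real.exp (-(1 / 4) * ‖z‖ ^ 2) * (reflFactor m t x.1 (x.1 + Real.sqrt t • z)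
        * η' (x.1 + Real.sqrt t • z))) ?_ ?_
  · filter_upwards [self_mem_nhdsWithin] with t ht
    exact (heat_eq_integral ht η x).symm
  refine tendsto_integral_filter_of_dominated_convergence
    (fun z => (4 * Real.pi) ^ (-(N : ℝ) / 2) * Real.exp (-(1 / 4) * ‖z‖ ^ 2) * B) ?_ ?_
    (hgi.mul_const B) ?_
  · have hm' : Measurable η' := by
      have h1 := (MeasurableEmbedding.subtype_coe
        (sector N m).isOpen.measurableSet).measurable_extend hη.measurable
        (measurable_const (a := (0 : ℝ)))
      exact h1
    filter_upwards with t
    have h2 : Measurable (fun z : EuclideanSpace ℝ (Fin N) => x.1 + Real.sqrt t • z) := by fun_prop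
    have h3 : Measurable (fun y : EuclideanSpace ℝ (Fin N) => reflFactor m t x.1 y) := by
      unfold reflFactor
      refine Finset.measurable_prod _ fun i _ => ?_
      split_ifs
      · fun_prop
      · exact measurable_const
    refine Measurable.aestronglyMeasurable ?_
    refine Measurable.mul ?_ ((h3.comp h2).mul (hm'.comp h2))
    fun_prop
  · filter_upwards [self_mem_nhdsWithin] with t ht
    refine Eventually.of_forall fun z => ?_
    rw [norm_mul, Real.norm_of_nonneg (by positivity)]
    gcongr
    by_cases hy : x.1 + Real.sqrt t • z ∈ (sector N m : Set (EuclideanSpace ℝ (Fin N)))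
    · rw [norm_mul]
      have h1 := abs_reflFactor_le_one (m := m) (N := N) ht x ⟨_, hy⟩
      have h2 := hB ⟨_, hy⟩
      rw [← hval] at h2
      calc _ ≤ 1 * B := mul_le_mul h1 h2 (abs_nonneg _) zero_le_one
        _ = B := one_mul B
    · rw [hzero _ hy, mul_zero, norm_zero]
      exact hB0
  · refine Eventually.of_forall fun z => ?_
    refine Tendsto.const_mul _ ((tendsto_reflFactor x z).mul ?_)
    rw [← hval]
    have h1 : Tendsto (fun t : ℝ => x.1 + Real.sqrt t • z) (𝓝[>] 0) (𝓝 x.1) := by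
      have : Continuous (fun t : ℝ => x.1 + Real.sqrt t • z) := by fun_prop
      have h2 := this.tendsto 0
      simp only [Real.sqrt_zero, zero_smul, add_zero] at h2
      exact h2.mono_left nhdsWithin_le_nhds
    exact hcont.tendsto.comp h1

end

end SectorHeat

namespace SectorHeat

noncomputable section

variable {N m : ℕ} {γ α a K M T : ℝ}

/-! ### Convergence of the semigroup in weighted `L¹` -/

lemma integrable_gaussProd {s : ℝ} (hs : 0 < s) :
    Integrable (gaussProd s : sector N m → ℝ) (leb N m) := by
  obtain ⟨C, hC, h⟩ := gaussProd_le_kernel (N := N) (m := m) hs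
  refine ((integrable_kernel (t := 1 / (4 * s)) (by positivity)
    (basePoint N m)).const_mul C).mono' (continuous_gaussProd s).aestronglyMeasurable
    (Eventually.of_forall fun y => ?_)
  rw [Real.norm_of_nonneg (gaussProd_pos s y).le]
  exact h y

lemma lintegral_kernel_gaussProd_le (hm : m ≤ N) {t : ℝ} (ht : 0 < t) (ht1 : t ≤ 1)
    (y : sector N m) :
    ∫⁻ x, ENNReal.ofReal (kernel N m t x y) * ENNReal.ofReal (gaussProd 1 x) ∂(leb N m)
      ≤ ENNReal.ofReal (gaussProd (1 / 5) y) := by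
  have e : ∀ x : sector N m, ENNReal.ofReal (kernel N m t x y) * ENNReal.ofReal (gaussProd 1 x)
      = ENNReal.ofReal (kernel N m t y x * gaussProd 1 x) := fun x => by
    rw [kernel_symm, ENNReal.ofReal_mul (kernel_pos ht y x).le]
  simp_rw [e]
  rw [← ofReal_integral_eq_lintegral_ofReal (integrable_kernel_mul_gaussProd ht one_pos y)
    (Eventually.of_forall fun x => (mul_pos (kernel_pos ht y x) (gaussProd_pos 1 x)).le)]
  refine ENNReal.ofReal_le_ofReal ?_
  have h := heat_gaussProd ht one_pos y hm
  unfold heat at h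
  rw [h]
  have h1 : (1 + 4 * 1 * t) ^ (-(m + (N : ℝ) / 2)) ≤ 1 :=
    Real.rpow_le_one_of_one_le_of_nonpos (by linarith) (by
      have : 0 ≤ (m : ℝ) + (N : ℝ) / 2 := by positivity
      linarith)
  refine (mul_le_of_le_one_left (gaussProd_pos _ y).le h1).trans (gaussProd_anti ?_ y)
  rw [div_le_div_iff₀ (by norm_num) (by positivity)]
  linarith

lemma lintegral_heat_gaussProd_le (hm : m ≤ N) {t : ℝ} (ht : 0 < t) (ht1 : t ≤ 1)
    {ρ : sector N m → ℝ} (hρ : AEStronglyMeasurable ρ (leb N m)) :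
    ∫⁻ x, ‖heat N m t ρ x‖ₑ * ENNReal.ofReal (gaussProd 1 x) ∂(leb N m)
      ≤ ∫⁻ y, ‖ρ y‖ₑ * ENNReal.ofReal (gaussProd (1 / 5) y) ∂(leb N m) := by
  have hg : Measurable (fun x : sector N m => ENNReal.ofReal (gaussProd 1 x)) :=
    ((continuous_gaussProd 1).measurable).ennreal_ofReal
  calc _ ≤ ∫⁻ x, (∫⁻ y, ENNReal.ofReal (kernel N m t x y) * ENNReal.ofReal (gaussProd 1 x)
          * ‖ρ y‖ₑ ∂(leb N m)) ∂(leb N m) := by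
        refine lintegral_mono fun x => ?_
        have h1 : ‖heat N m t ρ x‖ₑ
            ≤ ∫⁻ y, ENNReal.ofReal (kernel N m t x y) * ‖ρ y‖ₑ ∂(leb N m) := by
          refine (enorm_integral_le_lintegral_enorm _).trans (le_of_eq ?_)
          refine lintegral_congr fun y => ?_
          rw [enorm_mul, Real.enorm_of_nonneg (kernel_pos ht x y).le]
        calc _ ≤ (∫⁻ y, ENNReal.ofReal (kernel N m t x y) * ‖ρ y‖ₑ ∂(leb N m))
              * ENNReal.ofReal (gaussProd 1 x) := by gcongr
          _ = _ := by
              rw [← lintegral_mul_const' _ _ ENNReal.ofReal_ne_top]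
              refine lintegral_congr fun y => ?_
              ring
    _ = ∫⁻ y, (∫⁻ x, ENNReal.ofReal (kernel N m t x y) * ENNReal.ofReal (gaussProd 1 x)
          * ‖ρ y‖ₑ ∂(leb N m)) ∂(leb N m) := by
        refine lintegral_lintegral_swap ?_
        have h1 : AEMeasurable (fun p : sector N m × sector N m =>
            ENNReal.ofReal (kernel N m t p.1 p.2)) ((leb N m).prod (leb N m)) :=
          (measurable_kernel t).ennreal_ofReal.aemeasurable
        exact (h1.mul (hg.comp measurable_fst).aemeasurable).mul hρ.comp_snd.enorm
    _ ≤ _ := by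
        refine lintegral_mono fun y => ?_
        rw [lintegral_mul_const' _ _ enorm_ne_top, mul_comm]
        gcongr
        exact lintegral_kernel_gaussProd_le hm ht ht1 y

lemma tendsto_lintegral_heat_sub {η : sector N m → ℝ} (hη : Continuous η) {B : ℝ}
    (hB : ∀ x, |η x| ≤ B) :
    Tendsto (fun t => ∫⁻ x, ‖heat N m t η x - η x‖ₑ * ENNReal.ofReal (gaussProd 1 x) ∂(leb N m))
      (𝓝[>] 0) (𝓝 0) := by
  have hB0 : 0 ≤ B := by
    obtain ⟨x⟩ := (inferInstance : Nonempty (sector N m))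
    exact (abs_nonneg _).trans (hB x)
  have h0 : ∫⁻ _x : sector N m, (0 : ℝ≥0∞) ∂(leb N m) = 0 := lintegral_zero
  rw [← h0]
  refine tendsto_lintegral_filter_of_dominated_convergence'
    (fun x => ENNReal.ofReal (2 * B) * ENNReal.ofReal (gaussProd 1 x)) ?_ ?_ ?_ ?_
  · filter_upwards with t
    exact ((aestronglyMeasurable_heat hη.aestronglyMeasurable).sub
      hη.aestronglyMeasurable).enorm.mul
      ((continuous_gaussProd 1).measurable.ennreal_ofReal.aemeasurable)
  · filter_upwards [self_mem_nhdsWithin] with t ht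
    refine Eventually.of_forall fun x => ?_
    gcongr
    rw [Real.enorm_eq_ofReal_abs]
    refine ENNReal.ofReal_le_ofReal ?_
    have h1 : |heat N m t η x| ≤ B := by
      have h2 := abs_heat_le (t := t) ht (x := x) (f := η) (g := fun _ => B)
        ((integrable_kernel ht x).mul_const B) (Eventually.of_forall hB)
      refine h2.trans ?_
      unfold heat
      rw [integral_mul_const]
      exact mul_le_of_le_one_left hB0 (integral_kernel_le_one ht x)
    calc _ ≤ |heat N m t η x| + |η x| := abs_sub _ _
      _ ≤ 2 * B := by linarith [hB x]
  · rw [lintegral_const_mul' _ _ ENNReal.ofReal_ne_top]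
    refine ENNReal.mul_ne_top ENNReal.ofReal_ne_top ?_
    have := (integrable_gaussProd (N := N) (m := m) one_pos).lintegral_lt_top
    exact this.ne
  · refine Eventually.of_forall fun x => ?_
    have h1 := ((tendsto_heat_zero hη hB x).sub_const (η x)).enorm
    rw [sub_self, enorm_zero] at h1
    have h2 := ENNReal.Tendsto.mul_const (b := ENNReal.ofReal (gaussProd 1 x)) h1
      (Or.inr ENNReal.ofReal_ne_top)
    rwa [zero_mul] at h2

/-- Convergence of `e^{tΔ} ψ` to `ψ` in a weighted `L¹` space. -/
lemma Dominated.tendsto_lintegral (hp : Params N m γ) {ψ : sector N m → ℝ}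
    (hψ : Dominated N m γ K ψ) :
    Tendsto (fun t => ∫⁻ x, ‖heat N m t ψ x - ψ x‖ₑ * ENNReal.ofReal (gaussProd 1 x) ∂(leb N m))
      (𝓝[>] 0) (𝓝 0) := by
  have hintegrable : Integrable (fun y => gaussProd (1 / 5) y * ψ y) (leb N m) := by
    refine ((hp.integrable_gaussProd_mul_psi0 (s := 1 / 5) (by norm_num)).const_mul K).mono'
      ((continuous_gaussProd _).aestronglyMeasurable.mul hψ.1) (hψ.2.mono fun y hy => ?_)
    have := gaussProd_pos (1 / 5) y
    rw [norm_mul, Real.norm_of_nonneg this.le, Real.norm_eq_abs]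
    calc _ ≤ gaussProd (1 / 5) y * (K * psi0 N m γ y) := by gcongr
      _ = _ := by ring
  rw [ENNReal.tendsto_nhds_zero]
  intro ε hε
  have hε3 : ε / 3 ≠ 0 := by
    rw [Ne, ENNReal.div_eq_zero_iff, not_or]
    exact ⟨hε.ne', by norm_num⟩
  obtain ⟨η', hη'c, hη'ε, hη'cont, -⟩ := hintegrable.exists_hasCompactSupport_lintegral_sub_le hε3
  set η : sector N m → ℝ := fun y => η' y / gaussProd (1 / 5) y with hη
  have hηcont : Continuous η :=
    hη'cont.div (continuous_gaussProd _) fun y => (gaussProd_pos _ y).ne'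
  have hηc : HasCompactSupport η := by
    refine hη'c.mono fun y hy hy' => hy ?_
    simp [hη, hy']
  obtain ⟨B, hB⟩ := hηcont.bounded_above_of_compact_support hηc
  have hρ : AEStronglyMeasurable (fun y => ψ y - η y) (leb N m) :=
    hψ.1.sub hηcont.aestronglyMeasurable
  have hρε : ∫⁻ y, ‖ψ y - η y‖ₑ * ENNReal.ofReal (gaussProd (1 / 5) y) ∂(leb N m) ≤ ε / 3 := by
    refine le_trans (le_of_eq (lintegral_congr fun y => ?_)) hη'ε
    have := gaussProd_pos (1 / 5) y
    rw [← Real.enorm_of_nonneg this.le, ← enorm_mul, hη]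
    congr 1
    simp only
    field_simp
  have hρε' : ∫⁻ y, ‖ψ y - η y‖ₑ * ENNReal.ofReal (gaussProd 1 y) ∂(leb N m) ≤ ε / 3 := by
    refine le_trans (lintegral_mono fun y => ?_) hρε
    gcongr
    exact gaussProd_anti (by norm_num) y
  have h1 := ENNReal.tendsto_nhds_zero.1 (tendsto_lintegral_heat_sub hηcont hB) (ε / 3)
    (pos_iff_ne_zero.2 hε3)
  have hle1 : ∀ᶠ t : ℝ in 𝓝[>] 0, t ≤ 1 :=
    nhdsWithin_le_nhds (ge_mem_nhds zero_lt_one)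
  have hw : AEMeasurable (fun x : sector N m => ENNReal.ofReal (gaussProd 1 x)) (leb N m) :=
    (continuous_gaussProd 1).measurable.ennreal_ofReal.aemeasurable
  filter_upwards [h1, hle1, self_mem_nhdsWithin] with t h1 h2 h3
  have ht : 0 < t := h3
  have hm1 : AEMeasurable (fun x => ‖heat N m t (fun y => ψ y - η y) x‖ₑ
      * ENNReal.ofReal (gaussProd 1 x)) (leb N m) :=
    (aestronglyMeasurable_heat hρ).enorm.mul hw
  have hm2 : AEMeasurable (fun x => ‖heat N m t η x - η x‖ₑ
      * ENNReal.ofReal (gaussProd 1 x)) (leb N m) :=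
    ((aestronglyMeasurable_heat hηcont.aestronglyMeasurable).sub
      hηcont.aestronglyMeasurable).enorm.mul hw
  calc _ ≤ ∫⁻ x, (‖heat N m t (fun y => ψ y - η y) x‖ₑ * ENNReal.ofReal (gaussProd 1 x)
        + ‖heat N m t η x - η x‖ₑ * ENNReal.ofReal (gaussProd 1 x)
        + ‖ψ x - η x‖ₑ * ENNReal.ofReal (gaussProd 1 x)) ∂(leb N m) := by
        refine lintegral_mono fun x => ?_
        rw [← add_mul, ← add_mul]
        gcongr
        rw [heat_sub (hψ.integrable hp ht x)
          (integrable_kernel_mul_of_bdd ht x hηcont.aestronglyMeasurable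
            (Eventually.of_forall hB))]
        have e : heat N m t ψ x - ψ x = (heat N m t ψ x - heat N m t η x)
            + (heat N m t η x - η x) - (ψ x - η x) := by ring
        rw [e]
        exact (enorm_sub_le).trans (by gcongr; exact enorm_add_le _ _)
    _ = (∫⁻ x, ‖heat N m t (fun y => ψ y - η y) x‖ₑ * ENNReal.ofReal (gaussProd 1 x) ∂(leb N m))
        + (∫⁻ x, ‖heat N m t η x - η x‖ₑ * ENNReal.ofReal (gaussProd 1 x) ∂(leb N m))
        + ∫⁻ x, ‖ψ x - η x‖ₑ * ENNReal.ofReal (gaussProd 1 x) ∂(leb N m) := by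
        have hm12 : AEMeasurable (fun x => ‖heat N m t (fun y => ψ y - η y) x‖ₑ
            * ENNReal.ofReal (gaussProd 1 x) + ‖heat N m t η x - η x‖ₑ
            * ENNReal.ofReal (gaussProd 1 x)) (leb N m) := hm1.add hm2
        rw [lintegral_add_left' hm12, lintegral_add_left' hm1]
    _ ≤ ε / 3 + ε / 3 + ε / 3 := by
        gcongr
        exact (lintegral_heat_gaussProd_le hp.hm ht h2 hρ).trans hρε
    _ = ε := ENNReal.add_thirds ε

lemma Dominated.tendstoL1loc_heat (hp : Params N m γ) {ψ : sector N m → ℝ}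
    (hψ : Dominated N m γ K ψ) :
    TendstoL1loc N m (𝓝[>] 0) (fun t => heat N m t ψ) ψ := by
  intro S hS
  obtain ⟨δ, hδ, h⟩ := exists_pos_le_gaussProd hS 1
  have h1 := ENNReal.Tendsto.const_mul (a := ENNReal.ofReal δ⁻¹) (hψ.tendsto_lintegral hp)
    (Or.inr ENNReal.ofReal_ne_top)
  rw [mul_zero] at h1
  refine tendsto_of_tendsto_of_tendsto_of_le_of_le tendsto_const_nhds h1 (fun _ => zero_le)
    fun t => ?_
  simp only
  rw [← lintegral_const_mul' _ _ ENNReal.ofReal_ne_top]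
  refine le_trans (setLIntegral_mono' hS.measurableSet fun x hx => ?_) (setLIntegral_le_lintegral S _)
  rw [mul_left_comm, ← ENNReal.ofReal_mul (by positivity)]
  refine le_mul_of_one_le_right zero_le ?_
  rw [← ENNReal.ofReal_one]
  refine ENNReal.ofReal_le_ofReal ?_
  rw [le_inv_mul_iff₀ hδ, mul_one]
  exact h x hx

/-! ### Weak convergence -/

lemma isCompact_preimage_tsupport (φ : 𝓓(sector N m, ℝ)) :
    IsCompact (Subtype.val ⁻¹' tsupport φ : Set (sector N m)) := by
  rw [Subtype.isCompact_iff,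
    image_preimage_eq_of_subset fun x hx => ⟨⟨x, φ.tsupport_subset hx⟩, rfl⟩]
  exact φ.hasCompactSupport

lemma hasCompactSupport_testFunction (φ : 𝓓(sector N m, ℝ)) :
    HasCompactSupport (fun x : sector N m => φ x) := by
  refine HasCompactSupport.of_support_subset_isCompact (isCompact_preimage_tsupport φ) ?_
  intro x hx
  exact subset_tsupport _ hx

lemma continuous_testFunction (φ : 𝓓(sector N m, ℝ)) : Continuous (fun x : sector N m => φ x) :=
  φ.continuous.comp continuous_subtype_val

lemma integrable_mul_testFunction {f : sector N m → ℝ} (hf : LocallyIntegrable f (leb N m))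
    (φ : 𝓓(sector N m, ℝ)) : Integrable (fun x => f x * φ x) (leb N m) := by
  have := hf.integrable_smul_left_of_hasCompactSupport (continuous_testFunction φ)
    (hasCompactSupport_testFunction φ)
  refine this.congr (Eventually.of_forall fun x => ?_)
  simp only [smul_eq_mul]; ring

lemma Params.memY_testFunction (hp : Params N m γ) (φ : 𝓓(sector N m, ℝ)) :
    MemY N m γ (fun x => φ x) := by
  refine ⟨(continuous_testFunction φ).locallyIntegrable, ?_⟩
  refine (integrable_mul_testFunction hp.locallyIntegrable_psi0 φ).congr
    (Eventually.of_forall fun x => ?_)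
  simp only; ring

lemma TendstoWeakStar.tendstoDistr (hp : Params N m γ) {ι : Type*} {l : Filter ι}
    {f : ι → sector N m → ℝ} {g : sector N m → ℝ} (h : TendstoWeakStar N m γ l f g) :
    TendstoDistr N m l f g := fun φ => h _ (hp.memY_testFunction φ)

lemma TendstoL1loc.tendstoDistr {ι : Type*} {l : Filter ι}
    {f : ι → sector N m → ℝ} {g : sector N m → ℝ} (h : TendstoL1loc N m l f g)
    (hf : ∀ᶠ i in l, LocallyIntegrable (f i) (leb N m)) (hg : LocallyIntegrable g (leb N m)) :
    TendstoDistr N m l f g := by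
  intro φ
  obtain ⟨B, hB⟩ := (continuous_testFunction φ).bounded_above_of_compact_support
    (hasCompactSupport_testFunction φ)
  set S : Set (sector N m) := Subtype.val ⁻¹' tsupport φ with hS
  have hSc : IsCompact S := isCompact_preimage_tsupport φ
  rw [tendsto_iff_edist_tendsto_0]
  have h1 := ENNReal.Tendsto.const_mul (a := ENNReal.ofReal B) (h S hSc)
    (Or.inr ENNReal.ofReal_ne_top)
  rw [mul_zero] at h1
  refine tendsto_of_tendsto_of_tendsto_of_le_of_le' tendsto_const_nhds h1
    (Eventually.of_forall fun _ => zero_le) ?_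
  filter_upwards [hf] with i hi
  rw [edist_eq_enorm_sub, ← integral_sub (integrable_mul_testFunction hi φ)
    (integrable_mul_testFunction hg φ)]
  refine (enorm_integral_le_lintegral_enorm _).trans ?_
  rw [← lintegral_const_mul' _ _ ENNReal.ofReal_ne_top,
    ← lintegral_indicator hSc.measurableSet]
  refine lintegral_mono fun x => ?_
  by_cases hx : x ∈ S
  · rw [indicator_of_mem hx, ← sub_mul, enorm_mul, mul_comm]
    gcongr
    rw [← ofReal_norm]
    exact ENNReal.ofReal_le_ofReal (hB x)
  · have : φ x.1 = 0 := image_eq_zero_of_notMem_tsupport hx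
    simp [this]

/-- Test functions are dense in `𝒴`. -/
lemma Params.exists_testFunction (hp : Params N m γ) {φ : sector N m → ℝ} (hφ : MemY N m γ φ)
    {ε : ℝ≥0∞} (hε : ε ≠ 0) : ∃ η : 𝓓(sector N m, ℝ),
      ∫⁻ x, ‖(φ x - η x) * psi0 N m γ x‖ₑ ∂(leb N m) ≤ ε := by
  set ν : Measure (sector N m) := (leb N m).withDensity fun x => ENNReal.ofReal (psi0 N m γ x)
    with hν
  have hmeas : Measurable fun x : sector N m => ENNReal.ofReal (psi0 N m γ x) :=
    measurable_psi0.ennreal_ofReal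
  have hlt : ∀ᵐ x ∂(leb N m), ENNReal.ofReal (psi0 N m γ x) < ∞ :=
    Eventually.of_forall fun x => ENNReal.ofReal_lt_top
  have hfin : IsLocallyFiniteMeasure ν := by
    refine ⟨fun x => ?_⟩
    obtain ⟨U, hU, hUi⟩ := hp.locallyIntegrable_psi0 x
    obtain ⟨V, hVU, hV, hxV⟩ := mem_nhds_iff.1 hU
    refine ⟨V, hV.mem_nhds hxV, ?_⟩
    rw [hν, withDensity_apply _ hV.measurableSet]
    have := (hUi.mono_set hVU).2
    rw [hasFiniteIntegral_iff_ofReal (Eventually.of_forall hp.psi0_nonneg)] at this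
    exact this
  have hconv : ∀ f : sector N m → ℝ, AEStronglyMeasurable f (leb N m) →
      ∫⁻ x, ‖f x‖ₑ ∂ν = ∫⁻ x, ‖f x * psi0 N m γ x‖ₑ ∂(leb N m) := fun f hf => by
    rw [hν, lintegral_withDensity_eq_lintegral_mul₀' hmeas.aemeasurable
      (hf.enorm.mono_ac (withDensity_absolutelyContinuous _ _))]
    refine lintegral_congr fun x => ?_
    rw [Pi.mul_apply, enorm_mul, Real.enorm_of_nonneg (hp.psi0_nonneg x), mul_comm]
  have hφm := hφ.1.aestronglyMeasurable
  have hφi : Integrable φ ν := by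
    refine ⟨hφm.mono_ac (withDensity_absolutelyContinuous _ _), ?_⟩
    rw [HasFiniteIntegral, hconv φ hφm]
    exact hφ.2.2
  have hε2 : ε / 2 ≠ 0 := by
    rw [Ne, ENNReal.div_eq_zero_iff, not_or]
    exact ⟨hε, by norm_num⟩
  obtain ⟨η₁, hc, hη₁ε, hη₁, -⟩ := hφi.exists_hasCompactSupport_lintegral_sub_le hε2
  have hνK : ν (tsupport η₁) < ∞ := hc.isCompact.measure_lt_top
  obtain ⟨δ, hδ, hδε⟩ : ∃ δ : ℝ, 0 < δ ∧ ENNReal.ofReal δ * ν (tsupport η₁) ≤ ε / 2 := by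
    have h1 : Tendsto (fun δ : ℝ => ENNReal.ofReal δ * ν (tsupport η₁)) (𝓝[>] 0) (𝓝 0) := by
      have h2 : Tendsto (fun δ : ℝ => ENNReal.ofReal δ) (𝓝[>] 0) (𝓝 0) := by
        have := (ENNReal.continuous_ofReal.tendsto 0)
        rw [ENNReal.ofReal_zero] at this
        exact this.mono_left nhdsWithin_le_nhds
      have h3 := ENNReal.Tendsto.mul_const (b := ν (tsupport η₁)) h2 (Or.inr hνK.ne)
      rwa [zero_mul] at h3
    obtain ⟨δ, h1, h2⟩ := ((ENNReal.tendsto_nhds_zero.1 h1 (ε / 2)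
      (pos_iff_ne_zero.2 hε2)).and self_mem_nhdsWithin).exists
    exact ⟨δ, h2, h1⟩
  set η₂ : EuclideanSpace ℝ (Fin N) → ℝ := Function.extend Subtype.val η₁ 0 with hη₂
  have hval : ∀ y : sector N m, η₂ y.1 = η₁ y := fun y => Subtype.val_injective.extend_apply _ _ y
  have hη₂c : Continuous η₂ := hc.continuous_extend_zero (sector N m).isOpen hη₁
  have hη₂s : HasCompactSupport η₂ := hc.extend_zero continuous_subtype_val
  have hη₂t : tsupport η₂ ⊆ Subtype.val '' tsupport η₁ :=
    hc.tsupport_extend_zero_subset continuous_subtype_val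
  obtain ⟨g, hg, hgd, hgs⟩ := hη₂c.exists_contDiff_approx ⊤ (ε := fun _ => δ) continuous_const
    fun _ => hδ
  let η : 𝓓(sector N m, ℝ) := ⟨g, hg, hη₂s.mono hgs, fun x hx => by
    obtain ⟨y, -, rfl⟩ := hη₂t (closure_mono hgs hx)
    exact y.2⟩
  have hηg : ∀ x, η x = g x := fun x => rfl
  have hηm : AEStronglyMeasurable (fun x : sector N m => φ x - η x) (leb N m) :=
    hφm.sub (continuous_testFunction η).aestronglyMeasurable
  refine ⟨η, ?_⟩
  rw [← hconv _ hηm]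
  have hm1 : AEMeasurable (fun x => ‖φ x - η₁ x‖ₑ) ν :=
    (hφi.1.sub hη₁.aestronglyMeasurable).enorm
  calc ∫⁻ x, ‖φ x - η x‖ₑ ∂ν ≤ ∫⁻ x, (‖φ x - η₁ x‖ₑ + ‖η₁ x - η x‖ₑ) ∂ν := by
        refine lintegral_mono fun x => ?_
        have : φ x - η x = (φ x - η₁ x) + (η₁ x - η x) := by ring
        rw [this]
        exact enorm_add_le _ _
    _ = ∫⁻ x, ‖φ x - η₁ x‖ₑ ∂ν + ∫⁻ x, ‖η₁ x - η x‖ₑ ∂ν := lintegral_add_left' hm1 _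
    _ ≤ ε / 2 + ε / 2 := by
        gcongr
        calc ∫⁻ x, ‖η₁ x - η x‖ₑ ∂ν
            ≤ ∫⁻ x, (tsupport η₁).indicator (fun _ => ENNReal.ofReal δ) x ∂ν := by
              refine lintegral_mono fun x => ?_
              by_cases hx : x ∈ tsupport η₁
              · rw [indicator_of_mem hx, Real.enorm_eq_ofReal_abs]
                refine ENNReal.ofReal_le_ofReal ?_
                have := (hgd x.1).le
                rwa [dist_comm, Real.dist_eq, hval] at this
              · have h1 : η₁ x = 0 := image_eq_zero_of_notMem_tsupport hx
                have h2 : g x.1 = 0 := by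
                  by_contra h
                  exact hgs h (by rw [hval, h1])
                rw [hηg, h1, h2]
                simp
          _ = ENNReal.ofReal δ * ν (tsupport η₁) := by
              rw [lintegral_indicator (isClosed_tsupport _).measurableSet, setLIntegral_const]
          _ ≤ ε / 2 := hδε
    _ = ε := ENNReal.add_halves ε

lemma Dominated.integrable_mul (hp : Params N m γ) {f φ : sector N m → ℝ}
    (hf : Dominated N m γ K f) (hφ : MemY N m γ φ) :
    Integrable (fun x => f x * φ x) (leb N m) := by
  refine (hφ.2.norm.const_mul K).mono' (hf.1.mul hφ.1.aestronglyMeasurable)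
    (hf.2.mono fun x hx => ?_)
  rw [norm_mul, norm_mul, Real.norm_of_nonneg (hp.psi0_nonneg x)]
  calc ‖f x‖ * ‖φ x‖ ≤ K * psi0 N m γ x * ‖φ x‖ := by gcongr; exact hx
    _ = K * (‖φ x‖ * psi0 N m γ x) := by ring

lemma Dominated.enorm_integral_mul_le (hp : Params N m γ) {f φ : sector N m → ℝ}
    (hf : Dominated N m γ K f) :
    ‖∫ x, f x * φ x ∂(leb N m)‖ₑ
      ≤ ENNReal.ofReal K * ∫⁻ x, ‖φ x * psi0 N m γ x‖ₑ ∂(leb N m) := by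
  refine (enorm_integral_le_lintegral_enorm _).trans ?_
  rw [← lintegral_const_mul' _ _ ENNReal.ofReal_ne_top]
  refine lintegral_mono_ae (hf.2.mono fun x hx => ?_)
  rw [enorm_mul, enorm_mul, mul_left_comm, mul_comm ‖f x‖ₑ]
  gcongr
  rw [Real.enorm_of_nonneg (hp.psi0_nonneg x), ← ENNReal.ofReal_mul (hf.nonneg_bound hp),
    Real.enorm_eq_ofReal_abs]
  exact ENNReal.ofReal_le_ofReal hx

/-- On bounded sets of `𝒳`, convergence in `𝓓'` implies weak-* convergence. -/
lemma TendstoDistr.tendstoWeakStar (hp : Params N m γ) {ι : Type*} {l : Filter ι}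
    {f : ι → sector N m → ℝ} {g : sector N m → ℝ} (h : TendstoDistr N m l f g)
    (hf : ∀ᶠ i in l, Dominated N m γ K (f i)) (hg : Dominated N m γ K g) :
    TendstoWeakStar N m γ l f g := by
  intro φ hφ
  rw [tendsto_iff_edist_tendsto_0, ENNReal.tendsto_nhds_zero]
  intro ε hε
  have hK := hg.nonneg_bound hp
  have hε3 : ε / 3 ≠ 0 := by
    rw [Ne, ENNReal.div_eq_zero_iff, not_or]
    exact ⟨hε.ne', by norm_num⟩
  have hεK : ε / 3 / ENNReal.ofReal (K + 1) ≠ 0 := by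
    rw [Ne, ENNReal.div_eq_zero_iff, not_or]
    exact ⟨hε3, ENNReal.ofReal_ne_top⟩
  obtain ⟨η, hη⟩ := hp.exists_testFunction hφ hεK
  have hsmall : ∀ f, Dominated N m γ K f →
      edist (∫ x, f x * φ x ∂(leb N m)) (∫ x, f x * η x ∂(leb N m)) ≤ ε / 3 := fun f hf => by
    rw [edist_eq_enorm_sub, ← integral_sub (hf.integrable_mul hp hφ)
      (hf.integrable_mul hp (hp.memY_testFunction η))]
    simp only [← mul_sub]
    refine (hf.enorm_integral_mul_le hp).trans ?_
    calc _ ≤ ENNReal.ofReal (K + 1) * (ε / 3 / ENNReal.ofReal (K + 1)) := by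
          gcongr; linarith
      _ ≤ ε / 3 := ENNReal.mul_div_le
  have h1 := ENNReal.tendsto_nhds_zero.1 (tendsto_iff_edist_tendsto_0.1 (h η)) (ε / 3)
    (pos_iff_ne_zero.2 hε3)
  filter_upwards [h1, hf] with i hi hfi
  calc _ ≤ edist (∫ x, f i x * φ x ∂(leb N m)) (∫ x, f i x * η x ∂(leb N m))
        + edist (∫ x, f i x * η x ∂(leb N m)) (∫ x, g x * η x ∂(leb N m))
        + edist (∫ x, g x * η x ∂(leb N m)) (∫ x, g x * φ x ∂(leb N m)) := edist_triangle4 _ _ _ _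
    _ ≤ ε / 3 + ε / 3 + ε / 3 := by
        gcongr
        · exact hsmall _ hfi
        · rw [edist_comm]; exact hsmall _ hg
    _ = ε := ENNReal.add_thirds ε

/-! ### The initial value of a solution -/

lemma integral_Ioo_rpow {A β t : ℝ} (hβ1 : β < 1) (ht : 0 < t) :
    ∫ σ in Ioo 0 t, A * σ ^ (-β) = expWeight A β t := by
  rw [integral_const_mul, ← integral_Ioc_eq_integral_Ioo, ← intervalIntegral.integral_of_le ht.le,
    integral_rpow (Or.inl (by linarith)), Real.zero_rpow (by linarith), expWeight,
    show -β + 1 = 1 - β by ring, sub_zero]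

lemma Source.abs_duhamel_le {A β : ℝ} {f : ℝ → sector N m → ℝ} (hf : Source N m γ T A β f)
    (hp : Params N m γ) (hβ1 : β < 1) {t : ℝ} (ht : t ∈ Ioc 0 T) (x : sector N m) :
    |duhamel f t x| ≤ expWeight A β t * Psi N m γ t x := by
  rw [← integral_Ioo_rpow hβ1 ht.1]
  refine SectorHeat.abs_duhamel_le ht.1 ?_ fun σ hσ => hf.abs_heat_le hp hσ.1 hσ.2 ht.2 x
  have : IntervalIntegrable (fun σ : ℝ => σ ^ (-β)) volume 0 t :=
    intervalIntegral.intervalIntegrable_rpow' (by linarith)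
  exact ((intervalIntegrable_iff_integrableOn_Ioo_of_le ht.1.le).1 this).const_mul A

lemma IsSolution.tendstoL1loc (S : Setting N m γ α a K M T) {ψ : sector N m → ℝ}
    (hψ : Dominated N m γ K ψ) {u : ℝ → C₀(sector N m, ℝ)}
    (hu : IsSolution N m γ α a M T ψ u) : TendstoL1loc N m (𝓝[>] 0) (fun t => u t) ψ := by
  have hp := S.hp
  obtain ⟨A, hA0, hA⟩ := Curve.exists_source hp S.hα S.hM.le T
  have hs := hA _ (hu.curve S)
  obtain ⟨C, hC, hCb⟩ := hp.Psi_le_psi0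
  intro Q hQ
  have hfin : ∫⁻ x in Q, ENNReal.ofReal (C * psi0 N m γ x) ∂(leb N m) ≠ ∞ := by
    have h1 := (hp.locallyIntegrable_psi0.integrableOn_isCompact hQ).const_mul C
    exact (Integrable.lintegral_lt_top h1).ne
  have hw : Tendsto (fun t => ENNReal.ofReal (expWeight A (singExp m γ α) t)) (𝓝[>] 0) (𝓝 0) := by
    have h1 := (continuous_expWeight (c := A) S.hβ).tendsto 0
    rw [expWeight_zero S.hβ] at h1
    have h2 := (ENNReal.continuous_ofReal.tendsto 0).comp h1
    rw [ENNReal.ofReal_zero] at h2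
    exact h2.mono_left nhdsWithin_le_nhds
  have h1 := (ENNReal.Tendsto.mul_const hw (Or.inr hfin)).add (hψ.tendstoL1loc_heat hp Q hQ)
  rw [zero_mul, add_zero] at h1
  refine tendsto_of_tendsto_of_tendsto_of_le_of_le' tendsto_const_nhds h1
    (Eventually.of_forall fun _ => zero_le) ?_
  have hT : ∀ᶠ t in 𝓝[>] (0 : ℝ), t ≤ T := nhdsWithin_le_nhds (ge_mem_nhds S.hT)
  filter_upwards [hT, self_mem_nhdsWithin] with t htT ht0
  have ht : t ∈ Ioc 0 T := ⟨ht0, htT⟩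
  rw [← lintegral_const_mul' _ _ ENNReal.ofReal_ne_top, ← lintegral_add_left]
  · refine lintegral_mono_ae (ae_restrict_of_ae (hp.ae_ne_zero.mono fun x hx => ?_))
    have hG := expWeight_nonneg (σ := t) S.hβ hA0 ht.1.le
    have hd : ‖a * duhamel (fun σ => nonlin N m α (u σ)) t x‖ₑ
        ≤ ENNReal.ofReal (expWeight A (singExp m γ α) t) * ENNReal.ofReal (C * psi0 N m γ x) := by
      rw [Real.enorm_eq_ofReal_abs, abs_mul, S.ha, one_mul, ← ENNReal.ofReal_mul hG]
      refine ENNReal.ofReal_le_ofReal ((hs.abs_duhamel_le hp S.hβ ht x).trans ?_)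
      gcongr
      exact hCb t ht.1 x hx
    have e : u t x - ψ x = a * duhamel (fun σ => nonlin N m α (u σ)) t x
        + (heat N m t ψ x - ψ x) := by
      rw [hu.eq_picard ht x]; unfold picard; ring
    rw [e]
    exact (enorm_add_le _ _).trans (by gcongr)
  · exact (measurable_psi0.const_mul C).ennreal_ofReal.const_mul _

lemma IsSolution.dominated (S : Setting N m γ α a K M T) {ψ : sector N m → ℝ}
    {u : ℝ → C₀(sector N m, ℝ)} (hu : IsSolution N m γ α a M T ψ u) {C : ℝ}
    (hC : IsSemigroupBound N m γ C) {t : ℝ} (ht : t ∈ Ioc 0 T) : Dominated N m γ (C * M) (u t) :=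
  hC.dominated S.hp ht.1 S.hM.le (map_continuous (u t)).aestronglyMeasurable
    ((hu.curve S).bound t ht)

lemma IsSolution.tendstoDistr (S : Setting N m γ α a K M T) {ψ : sector N m → ℝ}
    (hψ : Dominated N m γ K ψ) {u : ℝ → C₀(sector N m, ℝ)}
    (hu : IsSolution N m γ α a M T ψ u) : TendstoDistr N m (𝓝[>] 0) (fun t => u t) ψ :=
  (hu.tendstoL1loc S hψ).tendstoDistr
    (Eventually.of_forall fun t => (map_continuous (u t)).locallyIntegrable)
    (hψ.locallyIntegrable S.hp)

lemma Setting.dominated_mul (S : Setting N m γ α a K M T) {ψ : sector N m → ℝ}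
    (hψ : Dominated N m γ K ψ) {C : ℝ} (hC : 1 ≤ C) : Dominated N m γ (C * M) ψ :=
  hψ.mono S.hp (S.K_le_M.trans (le_mul_of_one_le_left S.hM.le hC))

lemma IsSolution.tendstoWeakStar (S : Setting N m γ α a K M T) {ψ : sector N m → ℝ}
    (hψ : Dominated N m γ K ψ) {u : ℝ → C₀(sector N m, ℝ)}
    (hu : IsSolution N m γ α a M T ψ u) :
    TendstoWeakStar N m γ (𝓝[>] 0) (fun t => u t) ψ := by
  obtain ⟨C, hC⟩ := S.hp.exists_isSemigroupBound
  refine (hu.tendstoDistr S hψ).tendstoWeakStar S.hp (K := C * M) ?_ (S.dominated_mul hψ hC.1)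
  have hT : ∀ᶠ t in 𝓝[>] (0 : ℝ), t ≤ T := nhdsWithin_le_nhds (ge_mem_nhds S.hT)
  filter_upwards [hT, self_mem_nhdsWithin] with t htT ht0
  exact hu.dominated S hC ⟨ht0, htT⟩

end

end SectorHeat

namespace SectorHeat

noncomputable section

variable {N m : ℕ} {γ α a K M T : ℝ}

/-! ### Continuous dependence on the initial value -/

lemma Params.memY_kernel (hp : Params N m γ) {t : ℝ} (ht : 0 < t) (x : sector N m) :
    MemY N m γ (kernel N m t x) :=
  ⟨(continuous_kernel_right t x).locallyIntegrable, hp.integrable_kernel_mul_psi0 ht x⟩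

lemma TendstoWeakStar.tendsto_heat (hp : Params N m γ) {ι : Type*} {l : Filter ι}
    {f : ι → sector N m → ℝ} {g : sector N m → ℝ} (h : TendstoWeakStar N m γ l f g) {t : ℝ}
    (ht : 0 < t) (x : sector N m) :
    Tendsto (fun i => heat N m t (f i) x) l (𝓝 (heat N m t g x)) := by
  simpa only [heat, mul_comm] using h _ (hp.memY_kernel ht x)

/-- The iterates of the fixed point map started at `0`. -/
def picardIter (α a : ℝ) (ψ : sector N m → ℝ) : ℕ → ℝ → sector N m → ℝ
  | 0 => fun _ _ => 0
  | n + 1 => picard α a ψ (picardIter α a ψ n)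

lemma Setting.curve_picardIter (S : Setting N m γ α a K M T) {ψ : sector N m → ℝ}
    (hψ : Dominated N m γ K ψ) (n : ℕ) : Curve N m γ T M (picardIter α a ψ n) := by
  induction n with
  | zero => exact S.hp.curve_zero S.hM.le
  | succ n ih => exact ih.picard S hψ

lemma Setting.abs_sub_picardIter_le (S : Setting N m γ α a K M T) {ψ : sector N m → ℝ}
    (hψ : Dominated N m γ K ψ) {u : ℝ → sector N m → ℝ} (hu : Curve N m γ T M u)
    (he : ∀ t ∈ Ioc 0 T, ∀ x, u t x = picard α a ψ u t x) (n : ℕ) :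
    ∀ t ∈ Ioc 0 T, ∀ x, |u t x - picardIter α a ψ n t x|
      ≤ realFactor N m γ α M T ^ n * M * Psi N m γ t x := by
  induction n with
  | zero => simpa [picardIter] using hu.bound
  | succ n ih =>
    intro t ht x
    have h := S.abs_duhamel_nonlin_sub_le hu (S.curve_picardIter hψ n) ih ht x
    rw [he t ht x, picardIter, picard, picard, add_sub_add_left_eq_sub, ← mul_sub, abs_mul, S.ha,
      one_mul]
    refine h.trans_eq ?_
    ring

variable {ψk : ℕ → sector N m → ℝ} {ψ : sector N m → ℝ}

lemma Setting.tendsto_picardIter (S : Setting N m γ α a K M T)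
    (hψk : ∀ k, Dominated N m γ K (ψk k))
    (h : TendstoWeakStar N m γ atTop ψk ψ) (n : ℕ) :
    ∀ t ∈ Ioc 0 T, ∀ x,
      Tendsto (fun k => picardIter α a (ψk k) n t x) atTop (𝓝 (picardIter α a ψ n t x)) := by
  obtain ⟨A, -, hA⟩ := Curve.exists_source S.hp S.hα S.hM.le T
  induction n with
  | zero => exact fun t ht x => tendsto_const_nhds
  | succ n ih =>
    intro t ht x
    refine (h.tendsto_heat S.hp ht.1 x).add (Tendsto.const_mul a ?_)
    refine tendsto_duhamel S.hp (S.hp.singExp_nonneg S.hα) S.hβ ht.1 ht.2 tendsto_const_nhds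
      (Eventually.of_forall fun _ => ht.2) tendsto_const_nhds
      (fun k => hA _ (S.curve_picardIter (hψk k) n)) fun σ hσ y => ?_
    exact ((ih σ hσ y).abs.rpow_const (Or.inr S.hα.le)).mul (ih σ hσ y)

variable {uk : ℕ → ℝ → sector N m → ℝ} {u : ℝ → sector N m → ℝ}

lemma Setting.tendsto_apply (S : Setting N m γ α a K M T) (hψk : ∀ k, Dominated N m γ K (ψk k))
    (hψ : Dominated N m γ K ψ) (h : TendstoWeakStar N m γ atTop ψk ψ)
    (huk : ∀ k, Curve N m γ T M (uk k)) (hu : Curve N m γ T M u)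
    (hek : ∀ k, ∀ t ∈ Ioc 0 T, ∀ x, uk k t x = picard α a (ψk k) (uk k) t x)
    (he : ∀ t ∈ Ioc 0 T, ∀ x, u t x = picard α a ψ u t x) {t : ℝ} (ht : t ∈ Ioc 0 T)
    (x : sector N m) : Tendsto (fun k => uk k t x) atTop (𝓝 (u t x)) := by
  have hlim : Tendsto (fun n => realFactor N m γ α M T ^ n * M * Psi N m γ t x) atTop (𝓝 0) := by
    have := ((tendsto_pow_atTop_nhds_zero_of_lt_one S.realFactor_nonneg S.hq).mul_const M).mul_const
      (Psi N m γ t x)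
    simpa using this
  rw [Metric.tendsto_nhds]
  intro ε hε
  obtain ⟨n, hn⟩ := (hlim.eventually (gt_mem_nhds (show 0 < ε / 3 by positivity))).exists
  filter_upwards [Metric.tendsto_nhds.1 (S.tendsto_picardIter hψk h n t ht x) (ε / 3)
    (by positivity)] with k hk
  have h1 := (S.abs_sub_picardIter_le (hψk k) (huk k) (hek k) n t ht x).trans_lt hn
  have h2 := (S.abs_sub_picardIter_le hψ hu he n t ht x).trans_lt hn
  rw [Real.dist_eq, abs_lt] at *
  constructor <;> linarith

lemma TendstoWeakStar.tendsto_heat_prod (hp : Params N m γ)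
    (hψk : ∀ k, Dominated N m γ K (ψk k)) (hψ : Dominated N m γ K ψ)
    (h : TendstoWeakStar N m γ atTop ψk ψ) {t : ℝ} (ht : 0 < t) (x : sector N m) :
    Tendsto (fun q : ℕ × ℝ × sector N m => heat N m q.2.1 (ψk q.1) q.2.2) (atTop ×ˢ 𝓝 (t, x))
      (𝓝 (heat N m t ψ x)) := by
  obtain ⟨C, hC, hb⟩ := hp.Psi_le_rpow
  have ht2 : 0 < t / 2 := by positivity
  have hK := hψ.nonneg_bound hp
  have hsnd : Tendsto (fun q : ℕ × ℝ × sector N m => q.2) (atTop ×ˢ 𝓝 (t, x)) (𝓝 (t, x)) :=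
    tendsto_snd
  have hτ : Tendsto (fun q : ℕ × ℝ × sector N m => q.2.1) (atTop ×ˢ 𝓝 (t, x)) (𝓝 t) :=
    continuous_fst.continuousAt.tendsto.comp hsnd
  have hx : Tendsto (fun q : ℕ × ℝ × sector N m => q.2.2) (atTop ×ˢ 𝓝 (t, x)) (𝓝 x) :=
    continuous_snd.continuousAt.tendsto.comp hsnd
  have key : Tendsto (fun q : ℕ × ℝ × sector N m =>
      heat N m (q.2.1 - t / 2) (heat N m (t / 2) (ψk q.1)) q.2.2) (atTop ×ˢ 𝓝 (t, x))
      (𝓝 (heat N m (t / 2) (heat N m (t / 2) ψ) x)) := by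
    refine SectorHeat.tendsto_heat (B := K * (C * (t / 2) ^ (-((γ + m) / 2)))) ht2 ?_ hx
      (Eventually.of_forall fun q => aestronglyMeasurable_heat (hψk q.1).1)
      (Eventually.of_forall fun q => Eventually.of_forall fun y =>
        ((hψk q.1).abs_heat_le hp ht2 y).trans (by gcongr; exact hb _ ht2 y))
      (Eventually.of_forall fun y => (h.tendsto_heat hp ht2 y).comp tendsto_fst)
    simpa [sub_half] using hτ.sub_const (t / 2)
  rw [hψ.heat_heat hp ht2 ht2, add_halves] at key
  refine key.congr' ?_
  filter_upwards [hτ.eventually (lt_mem_nhds (half_lt_self ht))] with q hq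
  rw [(hψk q.1).heat_heat hp (sub_pos.2 hq) ht2, sub_add_cancel]

lemma Setting.tendstoUniformlyOn (S : Setting N m γ α a K M T)
    (hψk : ∀ k, Dominated N m γ K (ψk k))
    (hψ : Dominated N m γ K ψ) (h : TendstoWeakStar N m γ atTop ψk ψ)
    (huk : ∀ k, Curve N m γ T M (uk k)) (hu : Curve N m γ T M u)
    (hek : ∀ k, ∀ t ∈ Ioc 0 T, ∀ x, uk k t x = picard α a (ψk k) (uk k) t x)
    (he : ∀ t ∈ Ioc 0 T, ∀ x, u t x = picard α a ψ u t x) {t₀ : ℝ} (ht₀ : 0 < t₀) :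
    TendstoUniformlyOn (fun k (p : ℝ × sector N m) => uk k p.1 p.2) (fun p => u p.1 p.2) atTop
      (Icc t₀ T ×ˢ univ) := by
  obtain ⟨A, -, hA⟩ := Curve.exists_source S.hp S.hα S.hM.le T
  have hM := S.hM
  have hsub : Icc t₀ T ⊆ Ioc 0 T := fun t ht => ⟨ht₀.trans_le ht.1, ht.2⟩
  refine tendstoUniformlyOn_of_continuous_convergence ?_
    (hu.cont.mono (prod_mono hsub subset_rfl)) fun ε hε => ?_
  · rintro ⟨t, x⟩ ⟨ht, -⟩
    have htT := hsub ht
    have hle : (atTop : Filter ℕ) ×ˢ 𝓝[Icc t₀ T ×ˢ univ] (t, x) ≤ atTop ×ˢ 𝓝 (t, x) :=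
      prod_mono_right _ nhdsWithin_le_nhds
    have hsnd : Tendsto (fun q : ℕ × ℝ × sector N m => q.2)
        (atTop ×ˢ 𝓝[Icc t₀ T ×ˢ univ] (t, x)) (𝓝 (t, x)) :=
      tendsto_snd.mono_right nhdsWithin_le_nhds
    have hmem : ∀ᶠ q : ℕ × ℝ × sector N m in atTop ×ˢ 𝓝[Icc t₀ T ×ˢ univ] (t, x),
        q.2.1 ∈ Ioc 0 T := by
      filter_upwards [tendsto_snd.eventually (self_mem_nhdsWithin
        (a := (t, x)) (s := Icc t₀ T ×ˢ (univ : Set (sector N m))))] with q hq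
      exact hsub hq.1
    have h1 := (h.tendsto_heat_prod S.hp hψk hψ htT.1 x).mono_left hle
    have h2 := tendsto_duhamel S.hp (S.hp.singExp_nonneg S.hα) S.hβ htT.1 htT.2
      (l := atTop ×ˢ 𝓝[Icc t₀ T ×ˢ univ] (t, x))
      (τ := fun q : ℕ × ℝ × sector N m => q.2.1)
      (continuous_fst.continuousAt.tendsto.comp hsnd) (hmem.mono fun q hq => hq.2)
      (x := fun q : ℕ × ℝ × sector N m => q.2.2)
      (continuous_snd.continuousAt.tendsto.comp hsnd)
      (F := fun q σ => nonlin N m α (uk q.1 σ)) (f₀ := fun σ => nonlin N m α (u σ))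
      (fun q => hA _ (huk q.1)) fun σ hσ y => by
        have := (S.tendsto_apply hψk hψ h huk hu hek he hσ y).comp
          (tendsto_fst (g := 𝓝[Icc t₀ T ×ˢ univ] (t, x)))
        exact (this.abs.rpow_const (Or.inr S.hα.le)).mul this
    rw [he t htT x]
    refine (h1.add (h2.const_mul a)).congr' ?_
    filter_upwards [hmem] with q hq
    exact (hek q.1 q.2.1 hq q.2.2).symm
  · obtain ⟨B, hB, hlt⟩ := S.hp.Psi_lt_outside_compact ht₀ (show 0 < ε / M by positivity)
    have key : ∀ v : ℝ → sector N m → ℝ, Curve N m γ T M v →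
        ∀ z ∈ (Icc t₀ T ×ˢ univ) \ (Icc t₀ T ×ˢ B), |v z.1 z.2| < ε := by
      rintro v hv ⟨t, x⟩ ⟨⟨ht, -⟩, hn⟩
      have hx : x ∉ B := fun hx => hn ⟨ht, hx⟩
      refine (hv.bound t (hsub ht) x).trans_lt ?_
      rw [mul_comm, ← lt_div_iff₀ hM]
      exact hlt t ht.1 x hx
    exact ⟨Icc t₀ T ×ˢ B, prod_mono subset_rfl (subset_univ _), isCompact_Icc.prod hB,
      Eventually.of_forall fun k => key _ (huk k), key _ hu⟩

lemma Setting.tendstoUniformlyOn_C0 (S : Setting N m γ α a K M T)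
    {vk : ℕ → ℝ → C₀(sector N m, ℝ)} {v : ℝ → C₀(sector N m, ℝ)}
    (hψk : ∀ k, Dominated N m γ K (ψk k)) (hψ : Dominated N m γ K ψ)
    (h : TendstoWeakStar N m γ atTop ψk ψ)
    (hvk : ∀ k, IsSolution N m γ α a M T (ψk k) (vk k)) (hv : IsSolution N m γ α a M T ψ v)
    {t₀ : ℝ} (ht₀ : 0 < t₀) : TendstoUniformlyOn vk v atTop (Icc t₀ T) := by
  have key := S.tendstoUniformlyOn hψk hψ h (fun k => (hvk k).curve S) (hv.curve S)
    (fun k t ht x => (hvk k).eq_picard ht x) (fun t ht x => hv.eq_picard ht x) ht₀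
  rw [Metric.tendstoUniformlyOn_iff] at key ⊢
  intro ε hε
  filter_upwards [key (ε / 2) (by positivity)] with k hk t ht
  rw [dist_eq_norm]
  refine (norm_C0_le (by positivity) fun x => ?_).trans_lt (half_lt_self hε)
  have := hk (t, x) ⟨ht, mem_univ _⟩
  rw [Real.dist_eq] at this
  exact this.le

lemma Setting.of_psiIntegral_le (hm : m ≤ N) (hγ : 0 < γ) (hγN : γ < N) (hα : 0 < α)
    (hαm : α < 2 / (γ + m)) (ha : a = 1 ∨ a = -1) (hK : 0 < K) (hM : 0 < M) (hT : 0 < T)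
    (hKM : ENNReal.ofReal K
      + ENNReal.ofReal (2 * (α + 1) * M ^ (α + 1)) * psiIntegral N m γ α T ≤ ENNReal.ofReal M)
    (hcontr : contractionFactor N m γ α M T < 1) : Setting N m γ α a K M T := by
  have hp : Params N m γ := ⟨hm, hγ, hγN⟩
  have hβ : singExp m γ α < 1 := by
    rw [lt_div_iff₀ (by positivity)] at hαm
    unfold singExp
    linarith
  have h0 : 0 ≤ ∫ σ in Ioc 0 T, supPsi N m γ σ ^ α :=
    integral_nonneg fun σ => Real.rpow_nonneg (supPsi_nonneg σ) _
  rw [hp.psiIntegral_eq hα hβ, ← ENNReal.ofReal_mul (by positivity),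
    ← ENNReal.ofReal_add hK.le (by positivity), ENNReal.ofReal_le_ofReal_iff hM.le] at hKM
  rw [contractionFactor, hp.psiIntegral_eq hα hβ, ← ENNReal.ofReal_mul (by positivity),
    ENNReal.ofReal_lt_one] at hcontr
  refine ⟨hp, hα, hβ, ?_, hK, hM, hT, hKM, hcontr⟩
  rcases ha with rfl | rfl <;> simp

end

end SectorHeat
open SectorHeat

theorem mainTheorem2 (N m : ℕ) (γ α a K M T : ℝ) (hm : m ≤ N)
    (hγ : 0 < γ) (hγN : γ < N) (hα : 0 < α) (hαm : α < 2 / (γ + m))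
    (ha : a = 1 ∨ a = -1) (hK : 0 < K) (hM : 0 < M) (hT : 0 < T)
    (hKM : ENNReal.ofReal K
      + ENNReal.ofReal (2 * (α + 1) * M ^ (α + 1)) * psiIntegral N m γ α T ≤ ENNReal.ofReal M)
    (hcontr : contractionFactor N m γ α M T < 1) :
    -- existence and uniqueness
    (∀ ψ, MemBall N m γ K ψ → ∃ u, IsSolution N m γ α a M T ψ u ∧
      ∀ v, IsSolution N m γ α a M T ψ v → EqOn v u (Ioc 0 T)) ∧
    -- absolute convergence of the integral in `C_0(Ω)`
    (∀ ψ u, MemBall N m γ K ψ → IsSolution N m γ α a M T ψ u → ConvergesInC0 N m α a T ψ u) ∧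
    -- (i) initial value
    (∃ C, IsSemigroupBound N m γ C) ∧
    (∀ ψ u, MemBall N m γ K ψ → IsSolution N m γ α a M T ψ u →
      TendstoL1loc N m (𝓝[>] 0) (fun t => u t) ψ ∧
      TendstoDistr N m (𝓝[>] 0) (fun t => u t) ψ ∧
      ∀ C, IsSemigroupBound N m γ C →
        MemBall N m γ (C * M) ψ ∧ (∀ t ∈ Ioc 0 T, MemBall N m γ (C * M) (u t)) ∧
        TendstoWeakStar N m γ (𝓝[>] 0) (fun t => u t) ψ) ∧
    -- (ii) Lipschitz dependence
    (∀ ψ₁ ψ₂ u₁ u₂, MemBall N m γ K ψ₁ → MemBall N m γ K ψ₂ →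
      IsSolution N m γ α a M T ψ₁ u₁ → IsSolution N m γ α a M T ψ₂ u₂ →
      normXT N m γ T (fun t => u₁ t - u₂ t)
          ≤ (1 - contractionFactor N m γ α M T)⁻¹
            * normXT N m γ T (fun t => heat N m t (ψ₁ - ψ₂)) ∧
        (1 - contractionFactor N m γ α M T)⁻¹
            * normXT N m γ T (fun t => heat N m t (ψ₁ - ψ₂))
          ≤ (1 - contractionFactor N m γ α M T)⁻¹ * normX N m γ (ψ₁ - ψ₂)) ∧
    -- (iii) continuity under convergence of the data in `𝓓'(Ω)`, equivalently in `𝓑_K^*`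
    (∀ (ψk : ℕ → sector N m → ℝ) (ψ : sector N m → ℝ) (uk : ℕ → ℝ → C₀(sector N m, ℝ))
      (u : ℝ → C₀(sector N m, ℝ)),
      (∀ k, MemBall N m γ K (ψk k)) → MemBall N m γ K ψ →
      (∀ k, IsSolution N m γ α a M T (ψk k) (uk k)) → IsSolution N m γ α a M T ψ u →
      (TendstoDistr N m atTop ψk ψ ↔ TendstoWeakStar N m γ atTop ψk ψ) ∧
      (TendstoDistr N m atTop ψk ψ →
        (∀ t ∈ Ioc 0 T, Tendsto (fun k => uk k t) atTop (𝓝 (u t))) ∧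
        ∀ t₀ ∈ Ioo 0 T, TendstoUniformlyOn uk u atTop (Icc t₀ T))) ∧
    -- (iv) domination by the solution with initial value `|ψ|`
    (∀ ψ u v, MemBall N m γ K ψ → IsSolution N m γ α a M T ψ u →
      IsSolution N m γ α a M T (fun x => |ψ x|) v →
      ∀ t ∈ Ioc 0 T, ∀ x, |u t x| ≤ v t x) ∧
    -- (v) positivity
    (∀ ψ u, MemBall N m γ K ψ → IsSolution N m γ α a M T ψ u → 0 ≤ᵐ[leb N m] ψ →
      ∀ t ∈ Ioc 0 T, ∀ x, 0 ≤ u t x) ∧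
    -- (vi) comparison
    (∀ ψ₁ ψ₂ u₁ u₂, MemBall N m γ K ψ₁ → MemBall N m γ K ψ₂ →
      IsSolution N m γ α a M T ψ₁ u₁ → IsSolution N m γ α a M T ψ₂ u₂ →
      ψ₁ ≤ᵐ[leb N m] ψ₂ → ∀ t ∈ Ioc 0 T, ∀ x, u₁ t x ≤ u₂ t x) := by
  have S : Setting N m γ α a K M T :=
    .of_psiIntegral_le hm hγ hγN hα hαm ha hK hM hT hKM hcontr
  have hd : ∀ {ψ}, MemBall N m γ K ψ → Dominated N m γ K ψ := fun h => h.dominated S.hp S.hK.le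
  refine ⟨fun ψ hψ => ?_, fun ψ u hψ hu => hu.convergesInC0 S (hd hψ),
    S.hp.exists_isSemigroupBound, fun ψ u hψ hu => ⟨hu.tendstoL1loc S (hd hψ),
      hu.tendstoDistr S (hd hψ), fun C hC => ⟨(S.dominated_mul (hd hψ) hC.1).memBall S.hp,
        fun t ht => (hu.dominated S hC ht).memBall S.hp, hu.tendstoWeakStar S (hd hψ)⟩⟩,
    fun ψ₁ ψ₂ u₁ u₂ hψ₁ hψ₂ h₁ h₂ => ⟨S.normXT_sub_le (hd hψ₁) (hd hψ₂) h₁ h₂, ?_⟩,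
    fun ψk ψ uk u hψk hψ huk hu => ?_,
    fun ψ u v hψ hu hv => S.abs_le (hd hψ) (hu.curve S) (hv.curve S)
      (fun t ht x => hu.eq_picard ht x) fun t ht x => hv.eq_picard ht x,
    fun ψ u hψ hu h0 => S.nonneg (hd hψ) (hu.curve S) (fun t ht x => hu.eq_picard ht x) h0,
    fun ψ₁ ψ₂ u₁ u₂ hψ₁ hψ₂ h₁ h₂ hle => S.comparison (hd hψ₁) (hd hψ₂) (h₁.curve S) (h₂.curve S)
      (fun t ht x => h₁.eq_picard ht x) (fun t ht x => h₂.eq_picard ht x) hle⟩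
  · obtain ⟨u, hu⟩ := S.exists_solution (hd hψ)
    exact ⟨u, hu, fun v hv => S.unique (hd hψ) hu hv⟩
  · gcongr
    exact S.normXT_heat_le ((hd hψ₁).sub (hd hψ₂))
  · have hw : TendstoDistr N m atTop ψk ψ → TendstoWeakStar N m γ atTop ψk ψ := fun h =>
      h.tendstoWeakStar S.hp (Eventually.of_forall fun k => hd (hψk k)) (hd hψ)
    have hunif : TendstoDistr N m atTop ψk ψ → ∀ t₀, 0 < t₀ →
        TendstoUniformlyOn uk u atTop (Icc t₀ T) := fun h t₀ ht₀ =>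
      S.tendstoUniformlyOn_C0 (fun k => hd (hψk k)) (hd hψ) (hw h) huk hu ht₀
    exact ⟨⟨hw, fun h => h.tendstoDistr S.hp⟩, fun h =>
      ⟨fun t ht => (hunif h t ht.1).tendsto_at ⟨le_rfl, ht.2⟩, fun t₀ ht₀ => hunif h t₀ ht₀.1⟩⟩
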